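/- For real $\lambda,t$ let $M_\lambda$ and $V_t$ be the unitary operators on $L^2(\mathbb{R})$ given by $M_\lambda f(x)=e^{i\lambda x}f(x)$ and $V_tf(x)=e^{t/2}f(e^tx)$, and let $\mathcal{A}_h$ (the hyperbolic algebra) be the weak-star closed algebra of bounded operators on $L^2(\mathbb{R})$ generated by $\{M_\lambda,V_t : \lambda,t\ge 0\}$. Let $H^2(\mathbb{R})\subseteq L^2(\mathbb{R})$ be the Hardy space of boundary values of functions $G$ holomorphic in the open upper half-plane with $\sup_{y>0}\int|G(x+iy)|^2\,dx<\infty$, and put $$\mathcal{L}_M=\{L^2[-a,b] : a,b\in[0,\infty]\},\qquad \mathcal{L}_S=\{|x|^{is}H^2(\mathbb{R}) : s\in\mathbb{R}\}\cup\{0,L^2(\mathbb{R})\}.$$ For a set $\mathcal{L}$ of closed subspaces of $L^2(\mathbb{R})$ let $\operatorname{Alg}\mathcal{L}$ be the algebra of bounded operators that leave every $K\in\mathcal{L}$ invariant. Let $\mathcal{C}_2$ be the set of Hilbert–Schmidt operators on $L^2(\mathbb{R})$, and for $k\in L^2(\mathbb{R}^2)$ let $\operatorname{Int}k$ be the integral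 operator $(\operatorname{Int}k)f(x)=\int k(x,y)f(y)\,dy$. For $x\in\mathbb{R}\setminus\{0\}$ let $q(x)=\exp(-\tfrac12\operatorname{Log}x)$, where $\operatorname{Log}x=\log|x|$ if $x>0$ and $\operatorname{Log}x=\log|x|+i\pi$ if $x<0$; for $v,w$ in the open lower half-plane let $r_{v,w}(x)=\frac1{(x-v)(x-w)}$. Let $V$ be the closed linear span in $L^2(\mathbb{R},|x|\,dx)$ of the functions $\bar q\,r_{v,w}$, where $v,w$ run over the points of the open lower half-plane with rational real and imaginary parts. Let $W=L^2(\mathbb{R}_+,e^t\,dt)$, with $\mathbb{R}_+=[0,\infty)$, and let $V\otimes W$ be the closed linear span of $\{h(x)\phi(t) : h\in V,\ \phi\in W\}$ in $L^2(|x|\,dx\times e^t\,dt)$. For $F\in V\otimes W$ define $k_F\in L^2(\mathbb{R}^2)$ by $$k_F(x,y)=\begin{cases}F(x,\log(y/x)) & \text{if } xy>0 \text{ and } \log(y/x)\ge 0,\\ 0&\text{otherwise.}\end{cases}$$ Then $$\mathcal{A}_h\cap\mathcal{C}_2=\operatorname{Alg}(\mathcal{L}_M\cup\mathcal{L}_S)\cap\mathcal{C}_2=\{\operatorname{Int}k_F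 : F\in V\otimes W\}.$$ -/

import Mathlib

open MeasureTheory Filter Topology
open scoped ENNReal NNReal

namespace HypAlg

noncomputable section

/-- The Hilbert space `L²(ℝ)`. -/
abbrev L2R : Type := Lp ℂ 2 (volume : Measure ℝ)

/-! ### Multiplication and dilation operators -/

lemma memLp_phase {θ : ℝ → ℝ} (hθ : Measurable θ) (f : L2R) :
    MemLp (fun x : ℝ => Complex.exp (Complex.I * (θ x : ℂ)) * f x) 2 volume := by
  refine (Lp.memLp f).of_le ?_ (Eventually.of_forall fun x => ?_)
  · exact (by fun_prop : Measurable fun x : ℝ =>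
      Complex.exp (Complex.I * (θ x : ℂ))).aestronglyMeasurable.mul (Lp.aestronglyMeasurable f)
  · rw [norm_mul, mul_comm Complex.I, Complex.norm_exp_ofReal_mul_I, one_mul]

/-- The operator on `L²(ℝ)` of multiplication by the unimodular function `x ↦ exp (i θ(x))`. -/
def phaseMul (θ : ℝ → ℝ) (hθ : Measurable θ) : L2R →L[ℂ] L2R :=
  LinearMap.mkContinuous
    { toFun := fun f => (memLp_phase hθ f).toLp _
      map_add' := fun f g => by
        rw [← MemLp.toLp_add]
        refine MemLp.toLp_congr _ _ ?_
        filter_upwards [Lp.coeFn_add f g] with x hx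
        simp only [hx, Pi.add_apply, mul_add]
      map_smul' := fun c f => by
        rw [RingHom.id_apply, ← MemLp.toLp_const_smul]
        refine MemLp.toLp_congr _ _ ?_
        filter_upwards [Lp.coeFn_smul c f] with x hx
        simp [hx, mul_left_comm] }
    1 (fun f => by
      rw [one_mul]
      refine Lp.norm_le_norm_of_ae_le ?_
      filter_upwards [(memLp_phase hθ f).coeFn_toLp] with x hx
      refine le_of_eq ?_
      simp only [LinearMap.coe_mk, AddHom.coe_mk]
      rw [hx, norm_mul, mul_comm Complex.I, Complex.norm_exp_ofReal_mul_I, one_mul])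

lemma phaseMul_apply (θ : ℝ → ℝ) (hθ : Measurable θ) (f : L2R) :
    phaseMul θ hθ f =ᵐ[volume] fun x : ℝ => Complex.exp (Complex.I * (θ x : ℂ)) * f x :=
  (memLp_phase hθ f).coeFn_toLp

/-- `M_lam f(x) = exp(i lam x) f(x)`. -/
def M (lam : ℝ) : L2R →L[ℂ] L2R := phaseMul (fun x => lam * x) (by fun_prop)

/-- Multiplication by `|x|^{is} = exp(i s log |x|)` (for `x ≠ 0`). -/
def absPow (s : ℝ) : L2R →L[ℂ] L2R := phaseMul (fun x => s * Real.log |x|) (by fun_prop)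

lemma eLpNorm_dilate (t : ℝ) {f : ℝ → ℂ} (hf : AEStronglyMeasurable f volume) :
    eLpNorm (fun x : ℝ => f (Real.exp t * x)) 2 volume
      = (ENNReal.ofReal |(Real.exp t)⁻¹|) ^ (1 / (2 : ℝ≥0∞)).toReal * eLpNorm f 2 volume := by
  have h := Real.map_volume_mul_left (Real.exp_ne_zero t)
  have hf' : AEStronglyMeasurable f (Measure.map (fun x => Real.exp t * x) volume) := by
    rw [h]; exact hf.smul_measure _
  have := eLpNorm_map_measure (p := 2) hf' (by fun_prop)
  rw [h, eLpNorm_smul_measure_of_ne_top (by norm_num), smul_eq_mul] at this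
  exact this.symm

lemma qmp_dilate (t : ℝ) :
    Measure.QuasiMeasurePreserving (fun x : ℝ => Real.exp t * x) volume volume := by
  refine ⟨by fun_prop, ?_⟩
  rw [Real.map_volume_mul_left (Real.exp_ne_zero t)]
  exact Measure.smul_absolutelyContinuous

lemma memLp_dilate (t : ℝ) (f : L2R) :
    MemLp (fun x : ℝ => ((Real.exp (t / 2) : ℝ) : ℂ) * f (Real.exp t * x)) 2 volume := by
  have h : MemLp (fun x : ℝ => f (Real.exp t * x)) 2 volume := by
    refine ⟨(Lp.aestronglyMeasurable f).comp_quasiMeasurePreserving (qmp_dilate t), ?_⟩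
    rw [eLpNorm_dilate t (Lp.aestronglyMeasurable f)]
    exact ENNReal.mul_lt_top (ENNReal.rpow_lt_top_of_nonneg (by simp) ENNReal.ofReal_ne_top)
      (Lp.memLp f).2
  exact h.const_mul _

/-- `V_t f(x) = exp(t/2) f(exp(t) x)`. -/
def dil (t : ℝ) : L2R →L[ℂ] L2R :=
  LinearMap.mkContinuous
    { toFun := fun f => (memLp_dilate t f).toLp _
      map_add' := fun f g => by
        rw [← MemLp.toLp_add]
        refine MemLp.toLp_congr _ _ ?_
        filter_upwards [(qmp_dilate t).ae (Lp.coeFn_add f g)] with x hx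
        simp only [hx, Pi.add_apply, mul_add]
      map_smul' := fun c f => by
        rw [RingHom.id_apply, ← MemLp.toLp_const_smul]
        refine MemLp.toLp_congr _ _ ?_
        filter_upwards [(qmp_dilate t).ae (Lp.coeFn_smul c f)] with x hx
        simp [hx, mul_left_comm] }
    (Real.exp (t / 2) *
      ((ENNReal.ofReal |(Real.exp t)⁻¹|) ^ (1 / (2 : ℝ≥0∞)).toReal).toReal) (fun f => by
      simp only [LinearMap.coe_mk, AddHom.coe_mk]
      rw [Lp.norm_toLp, Lp.norm_def]
      have h : (fun x : ℝ => ((Real.exp (t / 2) : ℝ) : ℂ) * f (Real.exp t * x))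
          = ((Real.exp (t / 2) : ℝ) : ℂ) • fun x : ℝ => f (Real.exp t * x) := rfl
      rw [h, eLpNorm_const_smul, eLpNorm_dilate t (Lp.aestronglyMeasurable f), ENNReal.toReal_mul,
        ENNReal.toReal_mul, mul_assoc]
      refine le_of_eq ?_
      congr 1
      simp only [toReal_enorm, Complex.norm_real, Real.norm_eq_abs, abs_of_pos (Real.exp_pos _)])

lemma dil_apply (t : ℝ) (f : L2R) :
    dil t f =ᵐ[volume] fun x : ℝ => ((Real.exp (t / 2) : ℝ) : ℂ) * f (Real.exp t * x) :=
  (memLp_dilate t f).coeFn_toLp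

/-! ### The weak-star topology and the hyperbolic algebra -/

/-- Pairs of square-summable sequences of vectors; they represent the normal functionals
`T ↦ ∑ₙ ⟨T xₙ, yₙ⟩` on the bounded operators. -/
abbrev SqSumPairs : Type :=
  {p : (ℕ → L2R) × (ℕ → L2R) //
    (Summable fun n => ‖p.1 n‖ ^ 2) ∧ Summable fun n => ‖p.2 n‖ ^ 2}

/-- The weak-star (`σ`-weak, ultraweak) topology on the bounded operators on `L²(ℝ)`: the coarsest
topology that makes all the functionals `T ↦ ∑ₙ ⟨T xₙ, yₙ⟩` with `∑ ‖xₙ‖² < ∞`, `∑ ‖yₙ‖² < ∞`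
continuous. -/
@[reducible] def weakStar : TopologicalSpace (L2R →L[ℂ] L2R) :=
  TopologicalSpace.induced
    (fun T (p : SqSumPairs) => ∑' n, inner ℂ (p.1.2 n) (T (p.1.1 n))) Pi.topologicalSpace

/-- The hyperbolic algebra: the smallest weak-star closed algebra of operators containing
`M_lam` and `V_t` for all `lam, t ≥ 0`. -/
def algH : Subalgebra ℂ (L2R →L[ℂ] L2R) :=
  sInf {A | (∀ lam : ℝ, 0 ≤ lam → M lam ∈ A) ∧ (∀ t : ℝ, 0 ≤ t → dil t ∈ A) ∧
    IsClosed[weakStar] (A : Set (L2R →L[ℂ] L2R))}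

/-! ### The Hardy space and the subspace lattices -/

/-- `G` is holomorphic on the open upper half-plane, `sup_{y>0} ∫ |G(x+iy)|² dx < ∞`, and `f` is
the boundary value function of `G` (in the sense of `L²`). -/
structure IsHardyExtension (G : ℂ → ℂ) (f : L2R) : Prop where
  differentiableOn : DifferentiableOn ℂ G {z : ℂ | 0 < z.im}
  bounded : ∃ C : ℝ≥0, ∀ y : ℝ, 0 < y →
    eLpNorm (fun x : ℝ => G (x + y * Complex.I)) 2 volume ≤ C
  boundary : Tendsto (fun y : ℝ => eLpNorm (fun x : ℝ => G (x + y * Complex.I) - f x) 2 volume)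
    (𝓝[>] 0) (𝓝 0)

lemma IsHardyExtension.aesm {G : ℂ → ℂ} {f : L2R} (h : IsHardyExtension G f) {y : ℝ} (hy : 0 < y) :
    AEStronglyMeasurable (fun x : ℝ => G (x + y * Complex.I)) volume := by
  refine (h.differentiableOn.continuousOn.comp_continuous (by fun_prop) fun x => ?_).aestronglyMeasurable
  simpa using hy

/-- The Hardy space `H²(ℝ)` as a subspace of `L²(ℝ)`. -/
def H2 : Submodule ℂ L2R where
  carrier := {f | ∃ G : ℂ → ℂ, IsHardyExtension G f}
  zero_mem' := by
    refine ⟨fun _ => 0, differentiableOn_const _, ⟨0, fun y _ => by simp⟩, ?_⟩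
    refine tendsto_const_nhds.congr fun y => ?_
    have : (fun x : ℝ => (0 : ℂ) - (0 : L2R) x) =ᵐ[volume] 0 := by
      filter_upwards [Lp.coeFn_zero ℂ 2 (volume : Measure ℝ)] with x hx
      simp only [hx, Pi.zero_apply, sub_zero]
    rw [eLpNorm_congr_ae this, eLpNorm_zero]
  add_mem' := by
    rintro f g ⟨F, hF⟩ ⟨G, hG⟩
    refine ⟨fun z => F z + G z, hF.differentiableOn.add hG.differentiableOn, ?_, ?_⟩
    · obtain ⟨C, hC⟩ := hF.bounded
      obtain ⟨D, hD⟩ := hG.bounded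
      refine ⟨C + D, fun y hy => ?_⟩
      push_cast
      exact (eLpNorm_add_le (hF.aesm hy) (hG.aesm hy) (by norm_num)).trans
        (add_le_add (hC y hy) (hD y hy))
    · have h0 := hF.boundary.add hG.boundary
      rw [add_zero] at h0
      refine tendsto_of_tendsto_of_tendsto_of_le_of_le' tendsto_const_nhds h0
        (Eventually.of_forall fun _ => zero_le) ?_
      filter_upwards [self_mem_nhdsWithin] with y hy
      refine le_trans (le_of_eq ?_) (eLpNorm_add_le
        ((hF.aesm hy).sub (Lp.aestronglyMeasurable f))
        ((hG.aesm hy).sub (Lp.aestronglyMeasurable g)) (by norm_num))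
      refine eLpNorm_congr_ae ?_
      filter_upwards [Lp.coeFn_add f g] with x hx
      simp only [hx, Pi.add_apply]
      ring
  smul_mem' := by
    rintro c f ⟨F, hF⟩
    refine ⟨fun z => c * F z, hF.differentiableOn.const_mul c, ?_, ?_⟩
    · obtain ⟨C, hC⟩ := hF.bounded
      refine ⟨‖c‖₊ * C, fun y hy => ?_⟩
      have : (fun x : ℝ => c * F (x + y * Complex.I)) = c • fun x : ℝ => F (x + y * Complex.I) := rfl
      rw [this, eLpNorm_const_smul]
      push_cast
      exact mul_le_mul_right (hC y hy) _
    · have h0 := ENNReal.Tendsto.const_mul (a := ‖c‖ₑ) hF.boundary (Or.inr enorm_ne_top)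
      rw [mul_zero] at h0
      refine h0.congr fun y => ?_
      rw [← eLpNorm_const_smul]
      refine eLpNorm_congr_ae ?_
      filter_upwards [Lp.coeFn_smul c f] with x hx
      simp only [hx, Pi.smul_apply, smul_eq_mul]
      ring

/-- The interval `[-a, b]` for `a, b ∈ [0, ∞]`. -/
def interval (a b : ℝ≥0∞) : Set ℝ := {x | -(a : EReal) ≤ (x : EReal) ∧ (x : EReal) ≤ (b : EReal)}

/-- `L²[-a, b]`: the functions in `L²(ℝ)` that vanish almost everywhere off `[-a, b]`. -/
def L2interval (a b : ℝ≥0∞) : Submodule ℂ L2R where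
  carrier := {f | ∀ᵐ x : ℝ, x ∉ interval a b → f x = 0}
  zero_mem' := by
    filter_upwards [Lp.coeFn_zero ℂ 2 (volume : Measure ℝ)] with x hx _
    simp only [hx, Pi.zero_apply]
  add_mem' := by
    intro f g hf hg
    filter_upwards [hf, hg, Lp.coeFn_add f g] with x h1 h2 h3 hx
    simp only [h3, Pi.add_apply, h1 hx, h2 hx, add_zero]
  smul_mem' := by
    intro c f hf
    filter_upwards [hf, Lp.coeFn_smul c f] with x h1 h3 hx
    simp [h3, h1 hx]

/-- `𝓛_M = {L²[-a,b] : a, b ∈ [0,∞]}`. -/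
def latM : Set (Submodule ℂ L2R) := {K | ∃ a b : ℝ≥0∞, K = L2interval a b}

/-- `𝓛_S = {|x|^{is} H²(ℝ) : s ∈ ℝ} ∪ {0, L²(ℝ)}`. -/
def latS : Set (Submodule ℂ L2R) :=
  {K | ∃ s : ℝ, K = H2.map (absPow s).toLinearMap} ∪ {⊥, ⊤}

/-- `Alg 𝓛`: the operators leaving every subspace in `𝓛` invariant. -/
def Alg (L : Set (Submodule ℂ L2R)) : Subalgebra ℂ (L2R →L[ℂ] L2R) where
  carrier := {T | ∀ K ∈ L, ∀ f ∈ K, T f ∈ K}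
  mul_mem' := fun hS hT K hK f hf => hS K hK _ (hT K hK f hf)
  add_mem' := fun hS hT K hK f hf => K.add_mem (hS K hK f hf) (hT K hK f hf)
  algebraMap_mem' := fun c K _ _ hf => K.smul_mem c hf

/-! ### Hilbert–Schmidt operators and integral operators -/

/-- The Hilbert–Schmidt operators on `L²(ℝ)`: those `T` with `∑ᵢ ‖T eᵢ‖² < ∞` for an orthonormal
basis `(eᵢ)`. -/
def C2 : Set (L2R →L[ℂ] L2R) :=
  {T | ∃ (ι : Type) (e : HilbertBasis ι ℂ L2R), Summable fun i => ‖T (e i)‖ ^ 2}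

/-- Kernels in `L²(ℝ²)`. -/
abbrev L2R2 : Type := Lp ℂ 2 (volume : Measure (ℝ × ℝ))

lemma eLpNorm_two_sq {α : Type} [MeasurableSpace α] (μ : Measure α) (f : α → ℂ) :
    eLpNorm f 2 μ ^ 2 = ∫⁻ x, ‖f x‖ₑ ^ 2 ∂μ := by
  have h := eLpNorm_nnreal_pow_eq_lintegral (μ := μ) (f := f) (p := 2) (by norm_num)
  simpa using h

lemma eLpNorm_slice_sq (k : L2R2) :
    ∫⁻ x : ℝ, eLpNorm (fun y : ℝ => k (x, y)) 2 volume ^ 2 = eLpNorm k 2 volume ^ 2 := by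
  have hk : AEStronglyMeasurable k ((volume : Measure ℝ).prod volume) := Lp.aestronglyMeasurable k
  rw [eLpNorm_two_sq]
  simp_rw [eLpNorm_two_sq]
  exact (lintegral_prod _ (hk.enorm.pow_const 2)).symm

lemma memLp_slice (k : L2R2) : ∀ᵐ x : ℝ, MemLp (fun y : ℝ => k (x, y)) 2 volume := by
  have hk : AEStronglyMeasurable k ((volume : Measure ℝ).prod volume) := Lp.aestronglyMeasurable k
  have hm : AEMeasurable (fun x : ℝ => eLpNorm (fun y : ℝ => k (x, y)) 2 volume ^ 2) volume := by
    simp_rw [eLpNorm_two_sq]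
    exact (hk.enorm.pow_const 2).lintegral_prod_right'
  have h := ae_lt_top' hm (by
    rw [eLpNorm_slice_sq]; exact (ENNReal.pow_lt_top (Lp.memLp k).2).ne)
  filter_upwards [h, hk.prodMk_left] with x hx hx'
  exact ⟨hx', by simpa using hx⟩

lemma integrable_slice (k : L2R2) (f : L2R) : ∀ᵐ x : ℝ, Integrable fun y : ℝ => k (x, y) * f y := by
  filter_upwards [memLp_slice k] with x hx
  exact hx.integrable_mul (Lp.memLp f)

lemma eLpNorm_mul_two_le {φ f : ℝ → ℂ} (hφ : AEStronglyMeasurable φ volume)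
    (hf : AEStronglyMeasurable f volume) :
    eLpNorm (fun y : ℝ => φ y * f y) 1 volume ≤ eLpNorm φ 2 volume * eLpNorm f 2 volume :=
  eLpNorm_smul_le_mul_eLpNorm (p := 2) (q := 2) (r := 1) (f := f) (φ := φ) hf hφ

lemma eLpNorm_kernel_le (k : L2R2) (f : L2R) :
    eLpNorm (fun x : ℝ => ∫ y : ℝ, k (x, y) * f y) 2 volume
      ≤ eLpNorm k 2 volume * eLpNorm f 2 volume := by
  have h1 : ∀ᵐ x : ℝ, ‖∫ y : ℝ, k (x, y) * f y‖ₑ ^ 2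
      ≤ eLpNorm (fun y : ℝ => k (x, y)) 2 volume ^ 2 * eLpNorm f 2 volume ^ 2 := by
    filter_upwards [memLp_slice k] with x hx
    rw [← mul_pow]
    refine pow_le_pow_left' ?_ 2
    refine (enorm_integral_le_lintegral_enorm _).trans ?_
    rw [← eLpNorm_one_eq_lintegral_enorm]
    exact eLpNorm_mul_two_le hx.1 (Lp.aestronglyMeasurable f)
  have h2 : eLpNorm (fun x : ℝ => ∫ y : ℝ, k (x, y) * f y) 2 volume ^ 2
      ≤ (eLpNorm k 2 volume * eLpNorm f 2 volume) ^ 2 := by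
    rw [eLpNorm_two_sq, mul_pow, ← eLpNorm_slice_sq,
      ← lintegral_mul_const' _ _ (ENNReal.pow_lt_top (Lp.memLp f).2).ne]
    exact lintegral_mono_ae h1
  exact (ENNReal.pow_le_pow_left_iff two_ne_zero).1 h2

lemma memLp_kernel (k : L2R2) (f : L2R) :
    MemLp (fun x : ℝ => ∫ y : ℝ, k (x, y) * f y) 2 volume := by
  have hk : AEStronglyMeasurable k ((volume : Measure ℝ).prod volume) := Lp.aestronglyMeasurable k
  refine ⟨?_, (eLpNorm_kernel_le k f).trans_lt (ENNReal.mul_lt_top (Lp.memLp k).2 (Lp.memLp f).2)⟩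
  exact (hk.mul (Lp.aestronglyMeasurable f).comp_snd).integral_prod_right'

/-- The integral operator `(Int k) f(x) = ∫ k(x,y) f(y) dy` with kernel `k ∈ L²(ℝ²)`. -/
def intOp (k : L2R2) : L2R →L[ℂ] L2R :=
  LinearMap.mkContinuous
    { toFun := fun f => (memLp_kernel k f).toLp _
      map_add' := fun f g => by
        rw [← MemLp.toLp_add]
        refine MemLp.toLp_congr _ _ ?_
        filter_upwards [integrable_slice k f, integrable_slice k g] with x hf hg
        rw [Pi.add_apply, ← integral_add hf hg]
        refine integral_congr_ae ?_
        filter_upwards [Lp.coeFn_add f g] with y hy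
        simp only [hy, Pi.add_apply, mul_add]
      map_smul' := fun c f => by
        rw [RingHom.id_apply, ← MemLp.toLp_const_smul]
        refine MemLp.toLp_congr _ _ (Eventually.of_forall fun x => ?_)
        rw [Pi.smul_apply, smul_eq_mul, ← integral_const_mul]
        refine integral_congr_ae ?_
        filter_upwards [Lp.coeFn_smul c f] with y hy
        simp only [hy, Pi.smul_apply, smul_eq_mul, mul_left_comm] }
    ‖k‖ (fun f => by
      simp only [LinearMap.coe_mk, AddHom.coe_mk]
      rw [Lp.norm_toLp, Lp.norm_def, Lp.norm_def, ← ENNReal.toReal_mul]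
      exact ENNReal.toReal_mono (ENNReal.mul_lt_top (Lp.memLp k).2 (Lp.memLp f).2).ne
        (eLpNorm_kernel_le k f))

lemma intOp_apply (k : L2R2) (f : L2R) :
    intOp k f =ᵐ[volume] fun x : ℝ => ∫ y : ℝ, k (x, y) * f y :=
  (memLp_kernel k f).coeFn_toLp

/-! ### The spaces `V`, `W` and `V ⊗ W` -/

/-- The measure `|x| dx` on `ℝ`. -/
def muV : Measure ℝ := volume.withDensity fun x => ENNReal.ofReal |x|

/-- The measure `e^t dt` on `ℝ₊ = [0, ∞)`, regarded as a measure on `ℝ`. -/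
def muW : Measure ℝ :=
  (volume.restrict (Set.Ici 0)).withDensity fun t => ENNReal.ofReal (Real.exp t)

instance : SigmaFinite muV := SigmaFinite.withDensity_ofReal _

instance : SigmaFinite muW := SigmaFinite.withDensity_ofReal _

/-- `W = L²(ℝ₊, e^t dt)`. -/
abbrev W : Type := Lp ℂ 2 muW

/-- `q(x) = exp (-(1/2) Log x)`, where `Log x = log |x| + i Arg x` and `Arg x ∈ {0, π}` for real
`x ≠ 0`. -/
def q (x : ℝ) : ℂ := Complex.exp (-(1 / 2) * Complex.log (x : ℂ))

/-- `r_{v,w}(x) = 1 / ((x - v)(x - w))`. -/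
def r (v w : ℂ) (x : ℝ) : ℂ := 1 / (((x : ℂ) - v) * ((x : ℂ) - w))

/-- The points of the open lower half-plane with rational real and imaginary parts. -/
def lowerHalfQ : Set ℂ := {v | v.im < 0 ∧ (∃ a : ℚ, v.re = a) ∧ ∃ b : ℚ, v.im = b}

/-- The function `q̄ r_{v,w}`. -/
def qr (v w : ℂ) (x : ℝ) : ℂ := starRingEnd ℂ (q x) * r v w x

lemma integrable_normSq_inv {v : ℂ} (hv : v.im < 0) :
    Integrable fun x : ℝ => (Complex.normSq ((x : ℂ) - v))⁻¹ := by
  have h := (((integrable_inv_one_add_sq).comp_div hv.ne).comp_sub_right v.re).const_mul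
    ((v.im ^ 2)⁻¹)
  refine h.congr (Eventually.of_forall fun x => ?_)
  have hv' := hv.ne
  simp only [Complex.normSq_apply, Complex.sub_re, Complex.sub_im, Complex.ofReal_re,
    Complex.ofReal_im]
  rw [← mul_inv]
  congr 1
  field_simp
  ring

lemma norm_q_sq {x : ℝ} (hx : x ≠ 0) : ‖q x‖ ^ 2 * |x| = 1 := by
  have h : ‖q x‖ = Real.exp (-(1 / 2) * Real.log |x|) := by
    rw [q, Complex.norm_exp]
    congr 1
    have : (-(1 / 2) : ℂ) = ((-(1 / 2) : ℝ) : ℂ) := by push_cast; rfl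
    rw [this, Complex.re_ofReal_mul, Complex.log_re, Complex.norm_real, Real.norm_eq_abs]
  rw [h, ← Real.exp_nat_mul]
  nth_rewrite 2 [← Real.exp_log (abs_pos.2 hx)]
  rw [← Real.exp_add]
  push_cast
  rw [show (2 : ℝ) * (-(1 / 2) * Real.log |x|) + Real.log |x| = 0 by ring, Real.exp_zero]

lemma measurable_qr (v w : ℂ) : Measurable (qr v w) := by
  unfold qr q r
  fun_prop

lemma memLp_qr {v w : ℂ} (hv : v.im < 0) (hw : w.im < 0) : MemLp (qr v w) 2 muV := by
  have hm := measurable_qr v w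
  rw [memLp_two_iff_integrable_sq_norm hm.aestronglyMeasurable, muV,
    integrable_withDensity_iff (by fun_prop) (Eventually.of_forall fun _ => ENNReal.ofReal_lt_top)]
  refine ((integrable_normSq_inv hv).const_mul ((w.im ^ 2)⁻¹)).mono'
    (by fun_prop) ?_
  have h0 : ∀ᵐ x : ℝ, x ≠ 0 := by simp [ae_iff]
  filter_upwards [h0] with x hx
  rw [ENNReal.toReal_ofReal (abs_nonneg x), Real.norm_of_nonneg (by positivity), qr, norm_mul,
    RCLike.norm_conj, mul_pow, mul_right_comm, norm_q_sq hx, one_mul, r, norm_div, norm_one,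
    norm_mul, div_pow, one_pow, mul_pow, Complex.sq_norm, Complex.sq_norm, one_div, mul_inv,
    mul_comm]
  refine mul_le_mul_of_nonneg_right ?_ (inv_nonneg.2 (Complex.normSq_nonneg _))
  refine inv_anti₀ (by have := hw.ne; positivity) ?_
  simp only [Complex.normSq_apply, Complex.sub_re, Complex.sub_im, Complex.ofReal_re,
    Complex.ofReal_im]
  nlinarith [sq_nonneg (x - w.re)]

/-- `V`: the closed linear span in `L²(|x| dx)` of the functions `q̄ r_{v,w}`, where `v, w` run over
the rational points of the lower half-plane. -/
def V : Submodule ℂ (Lp ℂ 2 muV) :=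
  (Submodule.span ℂ {h | ∃ (v w : ℂ) (hv : v ∈ lowerHalfQ) (hw : w ∈ lowerHalfQ),
    h = (memLp_qr hv.1 hw.1).toLp (qr v w)}).topologicalClosure

lemma memLp_tens (h : Lp ℂ 2 muV) (φ : W) :
    MemLp (fun p : ℝ × ℝ => h p.1 * φ p.2) 2 (muV.prod muW) := by
  have hm : AEStronglyMeasurable (fun p : ℝ × ℝ => h p.1 * φ p.2) (muV.prod muW) :=
    (Lp.aestronglyMeasurable h).comp_fst.mul (Lp.aestronglyMeasurable φ).comp_snd
  rw [memLp_two_iff_integrable_sq_norm hm]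
  simp_rw [norm_mul, mul_pow]
  exact ((memLp_two_iff_integrable_sq_norm (Lp.aestronglyMeasurable h)).1 (Lp.memLp h)).mul_prod
    ((memLp_two_iff_integrable_sq_norm (Lp.aestronglyMeasurable φ)).1 (Lp.memLp φ))

/-- `V ⊗ W`, identified with the closed linear span of the functions `h(x) φ(t)`, `h ∈ V`, `φ ∈ W`,
in `L²(|x| dx × e^t dt)`. -/
def VtensorW : Submodule ℂ (Lp ℂ 2 (muV.prod muW)) :=
  (Submodule.span ℂ {F | ∃ h ∈ V, ∃ φ : W,
    F = (memLp_tens h φ).toLp fun p : ℝ × ℝ => h p.1 * φ p.2}).topologicalClosure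

/-! ### The kernels `k_F` -/

/-- `k_F(x,y) = F(x, log (y/x))` if `xy > 0` and `log (y/x)` lies in `ℝ₊`, the domain of the second
variable of `F`; and `k_F(x,y) = 0` otherwise. -/
def kerFun (F : ℝ × ℝ → ℂ) (x y : ℝ) : ℂ :=
  if 0 < x * y ∧ 0 ≤ Real.log (y / x) then F (x, Real.log (y / x)) else 0

/-- The region of the plane in which `x y > 0` and `log (y / x) ≥ 0`. -/
def cone : Set (ℝ × ℝ) := {p | 0 < p.1 * p.2 ∧ 0 ≤ Real.log (p.2 / p.1)}

lemma measurableSet_cone : MeasurableSet cone :=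
  MeasurableSet.inter
    (measurableSet_lt (f := fun _ : ℝ × ℝ => (0 : ℝ)) (g := fun p : ℝ × ℝ => p.1 * p.2)
      (by fun_prop) (by fun_prop))
    (measurableSet_le (f := fun _ : ℝ × ℝ => (0 : ℝ)) (g := fun p : ℝ × ℝ => Real.log (p.2 / p.1))
      (by fun_prop) (by fun_prop))

/-- The change of variables `y = e^t x`. -/
lemma measurePreserving_cone :
    MeasurePreserving (fun p : ℝ × ℝ => (p.1, Real.log (p.2 / p.1)))
      (volume.restrict cone) (muV.prod muW) := by
  have hΦ : Measurable fun p : ℝ × ℝ => (p.1, Real.log (p.2 / p.1)) := by fun_prop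
  refine ⟨hΦ, Measure.ext fun A hA => ?_⟩
  rw [Measure.map_apply hΦ hA, Measure.restrict_apply (hΦ hA), Measure.volume_eq_prod,
    Measure.prod_apply ((hΦ hA).inter measurableSet_cone), Measure.prod_apply hA, muV,
    lintegral_withDensity_eq_lintegral_mul _ (by fun_prop) (measurable_measure_prodMk_left hA)]
  refine lintegral_congr_ae ?_
  have h0 : ∀ᵐ x : ℝ, x ≠ 0 := by simp [ae_iff]
  filter_upwards [h0] with x hx
  have hAx : MeasurableSet (Prod.mk x ⁻¹' A) := measurable_prodMk_left hA
  have himg : Prod.mk x ⁻¹' ((fun p : ℝ × ℝ => (p.1, Real.log (p.2 / p.1))) ⁻¹' A ∩ cone)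
      = (fun t : ℝ => x * Real.exp t) '' (Prod.mk x ⁻¹' A ∩ Set.Ici 0) := by
    ext y
    simp only [Set.mem_preimage, Set.mem_inter_iff, cone, Set.mem_ofPred_eq, Set.mem_image,
      Set.mem_Ici]
    constructor
    · rintro ⟨h1, h2, h3⟩
      refine ⟨Real.log (y / x), ⟨h1, h3⟩, ?_⟩
      have : 0 < y / x := by
        have : y / x = x * y / x ^ 2 := by field_simp
        rw [this]; positivity
      rw [Real.exp_log this]
      field_simp
    · rintro ⟨t, ⟨h1, h2⟩, rfl⟩
      have : x * Real.exp t / x = Real.exp t := by field_simp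
      rw [this, Real.log_exp]
      refine ⟨h1, ?_, h2⟩
      have := Real.exp_pos t
      rw [← mul_assoc]
      have := mul_self_pos.2 hx
      positivity
  have hinj : Set.InjOn (fun t : ℝ => x * Real.exp t) (Prod.mk x ⁻¹' A ∩ Set.Ici 0) :=
    fun a _ b _ hab => Real.exp_injective (mul_left_cancel₀ hx hab)
  have hms := hAx.inter (measurableSet_Ici (a := (0 : ℝ)))
  have hcov := lintegral_image_eq_lintegral_abs_deriv_mul hms
    (fun t _ => ((Real.hasDerivAt_exp t).const_mul x).hasDerivWithinAt) hinj (fun _ => 1)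
  simp only [lintegral_const, one_mul, Measure.restrict_apply_univ, mul_one] at hcov
  rw [himg, hcov]
  simp_rw [abs_mul, abs_of_pos (Real.exp_pos _), ENNReal.ofReal_mul (abs_nonneg x)]
  rw [lintegral_const_mul _ (by fun_prop), Pi.mul_apply, muW, withDensity_apply _ hAx,
    Measure.restrict_restrict hAx]

lemma memLp_kerFun (F : Lp ℂ 2 (muV.prod muW)) :
    MemLp (fun p : ℝ × ℝ => kerFun F p.1 p.2) 2 volume := by
  have h : (fun p : ℝ × ℝ => kerFun F p.1 p.2) =
      cone.indicator (F ∘ fun p : ℝ × ℝ => (p.1, Real.log (p.2 / p.1))) := by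
    ext p
    by_cases hp : 0 < p.1 * p.2 ∧ 0 ≤ Real.log (p.2 / p.1)
    · rw [kerFun, if_pos hp, Set.indicator_of_mem (show p ∈ cone from hp)]
      rfl
    · rw [kerFun, if_neg hp, Set.indicator_of_notMem (show p ∉ cone from hp)]
  rw [h, memLp_indicator_iff_restrict measurableSet_cone]
  exact (Lp.memLp F).comp_measurePreserving measurePreserving_cone

/-- The kernel `k_F` as an element of `L²(ℝ²)`. -/
def ker (F : Lp ℂ 2 (muV.prod muW)) : L2R2 := (memLp_kerFun F).toLp _

end

end HypAlg

/-! The theorem follows from a cycle of three inclusions: `algH_le_Alg`, a description of the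
kernels of Hilbert–Schmidt operators in the reflexive algebra, and `VtensorW_le_goodKernels`.

The generators leave both lattices invariant, and the invariance algebra of a family of closed
subspaces is weak-star closed, so it contains the hyperbolic algebra.

Let now `Int k` leave the lattices invariant. Invariance of the intervals forces `k` to vanish
unless `y = e^t x` with `t ≥ 0` (`ae_eq_zero_off_cone`), so `k = k_F`, where `F` lives on the
coordinates `(x, t)` with the Jacobian weight `|x| e^t`. In these coordinates `|x|^{-is} |y|^{is} =
e^{ist}`. Invariance of all the spaces `|x|^{is} H²` therefore says that a Fourier transform in `t`
vanishes, and for almost every `t` the slice `F(·, t)` annihilates the functions `1 / ((x e^t - v)(x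
- w))` in the weight `|x|` (`ae_integral_slice_eq_zero`). Since `q² x = 1` and the functions
`z^{1/2} r_{v,w}` are total in `H²`, this means that `F(·, t) q |x|` lies in `H²`. If `E` is
orthogonal to `V ⊗ W`, the same kind of test shows that `conj(E(·, t) q) |x|` lies in `H²`. Two
functions in `H²` have a product with integral zero, and here that product is `conj(E) F |x|`,
because `|q|² |x| = 1`. Hence `F` is orthogonal to `E`, and `F` lies in the closed subspace `V ⊗ W`
(`mem_VtensorW_of_mem_Alg_latS`).

Conversely, `q̄ |x| = q x` is the boundary function of `z^{1/2}`. Multiplication by `q x r_{v,w}`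
belongs to the hyperbolic algebra, since Cauchy kernels are Laplace integrals of the `M_lam`, and
`q` is a multiple of the limit of the Gaussian integrals `∫ e^{-(ε - ix) t²} dt`. The operator with
kernel `k_F`, `F = q̄ r ⊗ φ`, is the superposition of `M_{q x r} V_t` against `e^{-t/2} φ(t)`, so it
is in the algebra; linearity and norm closure give all of `V ⊗ W`.

The Hardy space enters through the criterion `mem_H2_iff`: an `L²` function is in `H²` exactly when
it annihilates the Cauchy kernels with poles in the lower half-plane. One direction is a contour
shift, the other is the convergence of Poisson integrals. -/

namespace HypAlg

/-! ### Weak-star closed algebras of operators -/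

/-- The normal functional `T ↦ ∑ₙ ⟨yₙ, T xₙ⟩`. -/
noncomputable def normalFun (p : SqSumPairs) (T : L2R →L[ℂ] L2R) : ℂ :=
  ∑' n, inner ℂ (p.1.2 n) (T (p.1.1 n))

/-- The sum of squares on the right makes one summable majorant serve all operators of norm at most
`C` in the series of a normal functional. -/
lemma norm_inner_apply_le (T : L2R →L[ℂ] L2R) {C : ℝ} (hT : ‖T‖ ≤ C) (f g : L2R) :
    ‖inner ℂ g (T f)‖ ≤ C * (‖f‖ ^ 2 + ‖g‖ ^ 2) := by
  have h1 : ‖inner ℂ g (T f)‖ ≤ ‖g‖ * ‖T f‖ := norm_inner_le_norm _ _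
  have h2 : ‖T f‖ ≤ C * ‖f‖ := (T.le_opNorm f).trans (by gcongr)
  have h3 : 0 ≤ C := (norm_nonneg T).trans hT
  have h4 : ‖g‖ * ‖T f‖ ≤ ‖g‖ * (C * ‖f‖) := by gcongr
  nlinarith [sq_nonneg (‖f‖ - ‖g‖), mul_nonneg h3 (sq_nonneg (‖f‖ - ‖g‖)),
    mul_nonneg h3 (sq_nonneg ‖f‖), mul_nonneg h3 (sq_nonneg ‖g‖)]

lemma SqSumPairs.summable (p : SqSumPairs) (C : ℝ) :
    Summable fun n => C * (‖p.1.1 n‖ ^ 2 + ‖p.1.2 n‖ ^ 2) :=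
  (p.2.1.add p.2.2).mul_left C

lemma summable_normalFun (p : SqSumPairs) (T : L2R →L[ℂ] L2R) :
    Summable fun n => inner ℂ (p.1.2 n) (T (p.1.1 n)) :=
  Summable.of_norm_bounded (p.summable ‖T‖) fun _ => norm_inner_apply_le T le_rfl _ _

lemma normalFun_add (p : SqSumPairs) (S T : L2R →L[ℂ] L2R) :
    normalFun p (S + T) = normalFun p S + normalFun p T := by
  simp only [normalFun, add_apply, inner_add_right]
  exact (summable_normalFun p S).tsum_add (summable_normalFun p T)

lemma normalFun_smul (p : SqSumPairs) (c : ℂ) (T : L2R →L[ℂ] L2R) :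
    normalFun p (c • T) = c * normalFun p T := by
  simp only [normalFun, smul_apply, inner_smul_right, tsum_mul_left]

/-- A weak-star closed subspace is determined by the finite combinations of normal functionals that
vanish on it. -/
lemma mem_of_forall_normalFun {A : Submodule ℂ (L2R →L[ℂ] L2R)}
    (hA : IsClosed[weakStar] (A : Set (L2R →L[ℂ] L2R))) {T : L2R →L[ℂ] L2R}
    (h : ∀ (I : Finset SqSumPairs) (c : SqSumPairs → ℂ),
      (∀ S ∈ A, ∑ p ∈ I, c p * normalFun p S = 0) → ∑ p ∈ I, c p * normalFun p T = 0) :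
    T ∈ A := by
  by_contra hT
  have hopen : IsOpen[weakStar] ((A : Set (L2R →L[ℂ] L2R))ᶜ) :=
    @IsClosed.isOpen_compl _ weakStar _ hA
  obtain ⟨U, hU, hUA⟩ := isOpen_induced_iff.1 hopen
  have hTU : (fun p => normalFun p T) ∈ U := by
    have : T ∈ ((A : Set (L2R →L[ℂ] L2R))ᶜ) := hT
    rw [← hUA] at this
    exact this
  -- A basic neighbourhood of `T` involves finitely many functionals, so the question passes to `I →
  -- ℂ`. There the image of `A` is a subspace missing `Φ T`, and a linear form separates the two;
  -- its coordinates are the coefficients `c`.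
  obtain ⟨I, u, hu, hIU⟩ := isOpen_pi_iff.1 hU _ hTU
  let Φ : (L2R →L[ℂ] L2R) →ₗ[ℂ] (I → ℂ) :=
    { toFun := fun S p => normalFun p S
      map_add' := fun S S' => by ext p; exact normalFun_add _ _ _
      map_smul' := fun c S => by ext p; exact normalFun_smul _ _ _ }
  have hΦ : Φ T ∉ A.map Φ := by
    rintro ⟨S, hS, hST⟩
    have hSU : (fun p => normalFun p S) ∈ U := by
      refine hIU fun p hp => ?_
      have := congrFun hST ⟨p, hp⟩
      change normalFun p S ∈ u p
      rw [show normalFun p S = normalFun p T from this]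
      exact (hu p hp).2
    have : S ∈ ((A : Set (L2R →L[ℂ] L2R))ᶜ) := by
      rw [← hUA]; exact hSU
    exact this hS
  obtain ⟨ℓ, hℓ, hker⟩ := Submodule.exists_le_ker_of_notMem hΦ
  classical
  let c : SqSumPairs → ℂ := fun p => if hp : p ∈ I then ℓ (Pi.single ⟨p, hp⟩ 1) else 0
  have hc : ∀ S, ∑ p ∈ I, c p * normalFun p S = ℓ (Φ S) := by
    intro S
    rw [LinearMap.pi_apply_eq_sum_univ ℓ (Φ S), ← Finset.sum_coe_sort I]
    refine Finset.sum_congr rfl fun p _ => ?_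
    simp only [c, p.2, dif_pos, smul_eq_mul]
    rw [mul_comm]
    congr 2
    ext j
    simp [Pi.single_apply, eq_comm]
  apply hℓ
  rw [← hc]
  refine h I c fun S hS => ?_
  rw [hc]
  exact hker ⟨S, hS, rfl⟩

/-- On norm-bounded sequences, convergence of matrix coefficients implies convergence of every
normal functional, by dominated convergence of the defining series. -/
lemma mem_of_tendsto_inner {A : Submodule ℂ (L2R →L[ℂ] L2R)}
    (hA : IsClosed[weakStar] (A : Set (L2R →L[ℂ] L2R))) {T : L2R →L[ℂ] L2R}
    {S : ℕ → L2R →L[ℂ] L2R} (hS : ∀ n, S n ∈ A) {C : ℝ} (hC : ∀ n, ‖S n‖ ≤ C)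
    (hT : ∀ f g : L2R, Tendsto (fun n => inner ℂ g (S n f)) atTop (𝓝 (inner ℂ g (T f)))) :
    T ∈ A := by
  refine mem_of_forall_normalFun hA fun I c hc => ?_
  have h : Tendsto (fun n => ∑ p ∈ I, c p * normalFun p (S n)) atTop
      (𝓝 (∑ p ∈ I, c p * normalFun p T)) := by
    refine tendsto_finsetSum _ fun p _ => Tendsto.const_mul _ ?_
    exact tendsto_tsum_of_dominated_convergence (p.summable C) (fun k => hT _ _)
      (Eventually.of_forall fun n k => norm_inner_apply_le _ (hC n) _ _)
  refine tendsto_nhds_unique h ?_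
  simp only [hc _ (hS _)]
  exact tendsto_const_nhds

/-- Weak integrals of bounded operator families stay in a weak-star closed subspace: summation and
integration can be interchanged, so a combination of normal functionals that vanishes on `A` also
vanishes on the integral. All superpositions of generators enter the hyperbolic algebra this way. -/
lemma mem_of_inner_eq_integral {A : Submodule ℂ (L2R →L[ℂ] L2R)}
    (hA : IsClosed[weakStar] (A : Set (L2R →L[ℂ] L2R))) {T : L2R →L[ℂ] L2R}
    {μ : Measure ℝ} {S : ℝ → L2R →L[ℂ] L2R} (hS : ∀ᵐ t ∂μ, S t ∈ A) {C : ℝ}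
    (hC : ∀ t, ‖S t‖ ≤ C) {ψ : ℝ → ℂ} (hψ : Integrable ψ μ)
    (hm : ∀ f g : L2R, AEStronglyMeasurable (fun t => inner ℂ g (S t f)) μ)
    (hT : ∀ f g : L2R, inner ℂ g (T f) = ∫ t, ψ t * inner ℂ g (S t f) ∂μ) :
    T ∈ A := by
  refine mem_of_forall_normalFun hA fun I c hc => ?_
  have hC0 : 0 ≤ C := (norm_nonneg _).trans (hC 0)
  have hint : ∀ f g : L2R, Integrable (fun t => ψ t * inner ℂ g (S t f)) μ := fun f g =>
    hψ.mul_bdd (hm f g)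
      (Eventually.of_forall fun t => norm_inner_apply_le _ (hC t) f g)
  have hnorm : ∀ f g : L2R, ∫ t, ‖ψ t * inner ℂ g (S t f)‖ ∂μ
      ≤ ((∫ t, ‖ψ t‖ ∂μ) * C) * (‖f‖ ^ 2 + ‖g‖ ^ 2) := fun f g => by
    rw [mul_assoc, ← integral_mul_const]
    refine integral_mono (hint f g).norm (hψ.norm.mul_const _) fun t => ?_
    simp only [norm_mul]
    gcongr
    exact norm_inner_apply_le _ (hC t) f g
  have key : ∀ p, Integrable (fun t => ψ t * normalFun p (S t)) μ ∧
      normalFun p T = ∫ t, ψ t * normalFun p (S t) ∂μ := by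
    intro p
    have hs : Summable fun n => ∫ t, ‖ψ t * inner ℂ (p.1.2 n) (S t (p.1.1 n))‖ ∂μ :=
      Summable.of_nonneg_of_le (fun n => integral_nonneg fun t => norm_nonneg _)
        (fun n => hnorm _ _) (p.summable _)
    have h1 := hasSum_integral_of_summable_integral_norm (fun n => hint (p.1.1 n) (p.1.2 n)) hs
    constructor
    · refine (hψ.mul_bdd (c := ∑' n, C * (‖p.1.1 n‖ ^ 2 + ‖p.1.2 n‖ ^ 2)) ?_
        (Eventually.of_forall fun t => ?_))
      · refine aestronglyMeasurable_of_tendsto_ae atTop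
          (f := fun N t => ∑ n ∈ Finset.range N, inner ℂ (p.1.2 n) (S t (p.1.1 n)))
          (fun N => Finset.aestronglyMeasurable_fun_sum _ fun n _ => hm _ _)
          (Eventually.of_forall fun t => (summable_normalFun p (S t)).hasSum.tendsto_sum_nat)
      · exact tsum_of_norm_bounded (p.summable C).hasSum
          fun n => norm_inner_apply_le _ (hC t) _ _
    · rw [normalFun]
      simp only [hT]
      rw [h1.tsum_eq]
      simp only [tsum_mul_left, normalFun]
  calc ∑ p ∈ I, c p * normalFun p T
      = ∫ t, ∑ p ∈ I, c p * (ψ t * normalFun p (S t)) ∂μ := by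
        rw [integral_finsetSum _ fun p _ => (key p).1.const_mul _]
        refine Finset.sum_congr rfl fun p _ => ?_
        rw [integral_const_mul, (key p).2]
    _ = ∫ t, (0 : ℂ) ∂μ := by
        refine integral_congr_ae ?_
        filter_upwards [hS] with t ht
        have := hc _ ht
        calc ∑ p ∈ I, c p * (ψ t * normalFun p (S t))
            = ψ t * ∑ p ∈ I, c p * normalFun p (S t) := by
              rw [Finset.mul_sum]; exact Finset.sum_congr rfl fun p _ => by ring
          _ = 0 := by rw [this, mul_zero]
    _ = 0 := integral_zero _ _

/-- The normal functional `T ↦ ⟨g, T f⟩`. -/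
lemma exists_normalFun_eq_inner (f g : L2R) :
    ∃ p : SqSumPairs, ∀ T, normalFun p T = inner ℂ g (T f) := by
  refine ⟨⟨(Pi.single 0 f, Pi.single 0 g), ?_, ?_⟩, fun T => ?_⟩
  · refine summable_of_ne_finset_zero (s := {0}) fun n hn => ?_
    simp [Pi.single_eq_of_ne (Finset.notMem_singleton.1 hn)]
  · refine summable_of_ne_finset_zero (s := {0}) fun n hn => ?_
    simp [Pi.single_eq_of_ne (Finset.notMem_singleton.1 hn)]
  · rw [normalFun, tsum_eq_single 0 fun n hn => ?_]
    · simp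
    · simp [Pi.single_eq_of_ne hn]

lemma isClosed_weakStar_inner_eq_zero (f g : L2R) :
    IsClosed[weakStar] {T : L2R →L[ℂ] L2R | inner ℂ g (T f) = 0} := by
  obtain ⟨p, hp⟩ := exists_normalFun_eq_inner f g
  refine isClosed_induced_iff.2 ⟨{φ | φ p = 0},
    isClosed_singleton.preimage (continuous_apply p), ?_⟩
  ext T
  change normalFun p T = 0 ↔ inner ℂ g (T f) = 0
  rw [hp]

/-- The operators leaving each of a family of closed subspaces invariant form a weak-star closed
set. -/
lemma isClosed_weakStar_Alg {L : Set (Submodule ℂ L2R)}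
    (hL : ∀ K ∈ L, IsClosed (K : Set L2R)) :
    IsClosed[weakStar] (Alg L : Set (L2R →L[ℂ] L2R)) := by
  -- A closed `K` equals its double orthogonal complement, so invariance is a family of equations
  -- `⟨g, T f⟩ = 0`, each of them weak-star closed.
  have : (Alg L : Set (L2R →L[ℂ] L2R))
      = ⋂ K ∈ L, ⋂ f ∈ K, ⋂ g ∈ Kᗮ, {T : L2R →L[ℂ] L2R | inner ℂ g (T f) = 0} := by
    ext T
    simp only [Set.mem_iInter, Set.mem_ofPred_eq]
    constructor
    · intro hT K hK f hf g hg
      exact Submodule.inner_left_of_mem_orthogonal (hT K hK f hf) hg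
    · intro hT K hK f hf
      have hc : CompleteSpace K := (hL K hK).completeSpace_coe
      rw [← Submodule.orthogonal_orthogonal K]
      exact (Submodule.mem_orthogonal _ _).2 fun g hg => hT K hK f hf g hg
  rw [this]
  refine @isClosed_biInter _ _ weakStar _ _ fun K _ => @isClosed_biInter _ _ weakStar _ _ fun f _ =>
    @isClosed_biInter _ _ weakStar _ _ fun g _ => isClosed_weakStar_inner_eq_zero f g

lemma M_mem_algH {lam : ℝ} (h : 0 ≤ lam) : M lam ∈ algH :=
  Algebra.mem_sInf.2 fun _ hA => hA.1 lam h

lemma dil_mem_algH {t : ℝ} (h : 0 ≤ t) : dil t ∈ algH :=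
  Algebra.mem_sInf.2 fun _ hA => hA.2.1 t h

lemma isClosed_algH : IsClosed[weakStar] (Subalgebra.toSubmodule algH : Set (L2R →L[ℂ] L2R)) := by
  rw [Subalgebra.coe_toSubmodule, algH, Algebra.coe_sInf]
  exact @isClosed_biInter _ _ weakStar _ _ fun A hA => hA.2.2

lemma algH_le {A : Subalgebra ℂ (L2R →L[ℂ] L2R)} (h1 : ∀ lam : ℝ, 0 ≤ lam → M lam ∈ A)
    (h2 : ∀ t : ℝ, 0 ≤ t → dil t ∈ A) (h3 : IsClosed[weakStar] (A : Set (L2R →L[ℂ] L2R))) :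
    algH ≤ A :=
  sInf_le ⟨h1, h2, h3⟩

/-! ### Multiplication operators -/

lemma memLp_bdd_mul {m : ℝ → ℂ} (hm : Measurable m) {C : ℝ} (hC : ∀ x, ‖m x‖ ≤ C) (f : L2R) :
    MemLp (fun x : ℝ => m x * f x) 2 volume :=
  (Lp.memLp f).of_le_mul (c := C) (hm.aestronglyMeasurable.mul (Lp.aestronglyMeasurable f))
    (Eventually.of_forall fun x => by
      rw [norm_mul]; exact mul_le_mul_of_nonneg_right (hC x) (norm_nonneg _))

/-- Multiplication by a bounded measurable function. -/
noncomputable def mulOp (m : ℝ → ℂ) (hm : Measurable m) (C : ℝ) (hC : ∀ x, ‖m x‖ ≤ C) :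
    L2R →L[ℂ] L2R :=
  LinearMap.mkContinuous
    { toFun := fun f => (memLp_bdd_mul hm hC f).toLp _
      map_add' := fun f g => by
        rw [← MemLp.toLp_add]
        refine MemLp.toLp_congr _ _ ?_
        filter_upwards [Lp.coeFn_add f g] with x hx
        simp only [hx, Pi.add_apply, mul_add]
      map_smul' := fun c f => by
        rw [RingHom.id_apply, ← MemLp.toLp_const_smul]
        refine MemLp.toLp_congr _ _ ?_
        filter_upwards [Lp.coeFn_smul c f] with x hx
        simp [hx, mul_left_comm] }
    C (fun f => by
      refine Lp.norm_le_mul_norm_of_ae_le_mul ?_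
      filter_upwards [(memLp_bdd_mul hm hC f).coeFn_toLp] with x hx
      simp only [LinearMap.coe_mk, AddHom.coe_mk]
      rw [hx, norm_mul]
      exact mul_le_mul_of_nonneg_right (hC x) (norm_nonneg _))

section mulOp

variable {m : ℝ → ℂ} (hm : Measurable m) {C : ℝ} (hC : ∀ x, ‖m x‖ ≤ C)

lemma mulOp_apply (f : L2R) : mulOp m hm C hC f =ᵐ[volume] fun x => m x * f x :=
  (memLp_bdd_mul hm hC f).coeFn_toLp

lemma norm_mulOp_le : ‖mulOp m hm C hC‖ ≤ C :=
  LinearMap.mkContinuous_norm_le _ ((norm_nonneg _).trans (hC 0)) _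

end mulOp

lemma inner_eq_integral (g f : L2R) : inner ℂ g f = ∫ x, starRingEnd ℂ (g x) * f x := by
  rw [L2.inner_def]
  refine integral_congr_ae (Eventually.of_forall fun x => ?_)
  simp [mul_comm]

lemma integrable_conj_mul (g f : L2R) : Integrable fun x => starRingEnd ℂ (g x) * f x := by
  have := L2.integrable_inner (𝕜 := ℂ) g f
  refine this.congr (Eventually.of_forall fun x => ?_)
  simp [mul_comm]

/-! ### Cauchy kernels -/

lemma sub_ne_zero_of_im_ne_zero {v : ℂ} (hv : v.im ≠ 0) (x : ℝ) : (x : ℂ) - v ≠ 0 := fun h => by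
  have := congrArg Complex.im h
  simp at this
  exact hv this

lemma abs_im_le_norm_sub (v : ℂ) (x : ℝ) : |v.im| ≤ ‖(x : ℂ) - v‖ := by
  have := Complex.abs_im_le_norm ((x : ℂ) - v)
  simpa using this

lemma norm_inv_sub_le (v : ℂ) (hv : v.im ≠ 0) (x : ℝ) : ‖((x : ℂ) - v)⁻¹‖ ≤ |v.im|⁻¹ := by
  rw [norm_inv]
  exact inv_anti₀ (abs_pos.2 hv) (abs_im_le_norm_sub v x)

lemma measurable_cauchy (v : ℂ) : Measurable fun x : ℝ => ((x : ℂ) - v)⁻¹ := by fun_prop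

lemma memLp_cauchy {v : ℂ} (hv : v.im ≠ 0) :
    MemLp (fun x : ℝ => ((x : ℂ) - v)⁻¹) 2 volume := by
  rw [memLp_two_iff_integrable_sq_norm (measurable_cauchy v).aestronglyMeasurable]
  have h : ∀ w : ℂ, (fun x : ℝ => ‖((x : ℂ) - w)⁻¹‖ ^ 2)
      = fun x : ℝ => (Complex.normSq ((x : ℂ) - w))⁻¹ := fun w => by
    ext x; rw [norm_inv, inv_pow, Complex.sq_norm]
  rcases lt_or_gt_of_ne hv with h1 | h1
  · rw [h]; exact integrable_normSq_inv h1
  -- For real `x` the distances to `v` and to its conjugate agree, which reduces the upper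
  -- half-plane to the lower one.
  · have h2 : (fun x : ℝ => ‖((x : ℂ) - v)⁻¹‖ ^ 2)
        = fun x : ℝ => (Complex.normSq ((x : ℂ) - starRingEnd ℂ v))⁻¹ := by
      rw [h]; ext x
      rw [← Complex.normSq_conj, map_sub, Complex.conj_ofReal]
    rw [h2]
    exact integrable_normSq_inv (by simpa using h1)

/-- The Cauchy kernel `x ↦ 1 / (x - v)` as an element of `L²(ℝ)`. -/
noncomputable def cauchy (v : ℂ) (hv : v.im ≠ 0) : L2R := (memLp_cauchy hv).toLp _

lemma cauchy_apply {v : ℂ} (hv : v.im ≠ 0) :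
    cauchy v hv =ᵐ[volume] fun x : ℝ => ((x : ℂ) - v)⁻¹ :=
  (memLp_cauchy hv).coeFn_toLp

lemma integrable_mul_cauchy {f : ℝ → ℂ} (hf : MemLp f 2 volume) {v : ℂ} (hv : v.im ≠ 0) :
    Integrable fun x : ℝ => f x * ((x : ℂ) - v)⁻¹ :=
  hf.integrable_mul (memLp_cauchy hv)

/-- Integration against the Cauchy kernels with poles in the lower half-plane gives zero. -/
def CauchyAnn (f : ℝ → ℂ) : Prop := ∀ v : ℂ, v.im < 0 → ∫ x : ℝ, f x * ((x : ℂ) - v)⁻¹ = 0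

lemma enorm_integral_mul_le {φ f : ℝ → ℂ} (hφ : AEStronglyMeasurable φ volume)
    (hf : AEStronglyMeasurable f volume) :
    ‖∫ x, φ x * f x‖ₑ ≤ eLpNorm φ 2 volume * eLpNorm f 2 volume := by
  refine (enorm_integral_le_lintegral_enorm _).trans ?_
  rw [← eLpNorm_one_eq_lintegral_enorm]
  exact eLpNorm_mul_two_le hφ hf

lemma norm_sub_le_norm_add_I {v : ℂ} (hv : v.im < 0) {y : ℝ} (hy : 0 ≤ y) (x : ℝ) :
    ‖(x : ℂ) - v‖ ≤ ‖(x : ℂ) + y * Complex.I - v‖ := by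
  rw [Complex.norm_def, Complex.norm_def]
  refine Real.sqrt_le_sqrt ?_
  simp [Complex.normSq_apply]
  nlinarith

lemma eLpNorm_cauchy_shift_le {v : ℂ} (hv : v.im < 0) {y : ℝ} (hy : 0 ≤ y) :
    eLpNorm (fun x : ℝ => ((x : ℂ) + y * Complex.I - v)⁻¹) 2 volume
      ≤ eLpNorm (fun x : ℝ => ((x : ℂ) - v)⁻¹) 2 volume := by
  refine eLpNorm_mono fun x => ?_
  rw [norm_inv, norm_inv]
  exact inv_anti₀ (norm_pos_iff.2 (sub_ne_zero_of_im_ne_zero hv.ne x)) (norm_sub_le_norm_add_I hv hy x)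

lemma eLpNorm_cauchy_shift_sub_le {v : ℂ} (hv : v.im < 0) {y : ℝ} (hy : 0 ≤ y) :
    eLpNorm (fun x : ℝ => ((x : ℂ) + y * Complex.I - v)⁻¹ - ((x : ℂ) - v)⁻¹) 2 volume
      ≤ ENNReal.ofReal (y * |v.im|⁻¹) * eLpNorm (fun x : ℝ => ((x : ℂ) - v)⁻¹) 2 volume := by
  refine eLpNorm_le_mul_eLpNorm_of_ae_le_mul (Eventually.of_forall fun x => ?_) 2
  have h0 := sub_ne_zero_of_im_ne_zero hv.ne x
  have h1 := norm_sub_le_norm_add_I hv hy x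
  have h0' := norm_pos_iff.2 h0
  have h2 : (x : ℂ) + y * Complex.I - v ≠ 0 := norm_pos_iff.1 (h0'.trans_le h1)
  have h3 : ((x : ℂ) + y * Complex.I - v)⁻¹ - ((x : ℂ) - v)⁻¹
      = -(y * Complex.I) * ((x : ℂ) + y * Complex.I - v)⁻¹ * ((x : ℂ) - v)⁻¹ := by
    field_simp
    ring
  rw [h3, norm_mul, norm_mul]
  gcongr
  · simp [abs_of_nonneg hy]
  · rw [norm_inv]
    exact inv_anti₀ (abs_pos.2 hv.ne) ((abs_im_le_norm_sub v x).trans h1)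

/-! ### Norms of Cauchy kernels and contour shifts -/

lemma integral_normSq_inv {v : ℂ} (hv : v.im < 0) :
    ∫ x : ℝ, (Complex.normSq ((x : ℂ) - v))⁻¹ = Real.pi / -v.im := by
  have h := ProbabilityTheory.integral_cauchyPDFReal_eq_one v.re (γ := (-v.im).toNNReal)
    (by simpa using hv)
  simp only [ProbabilityTheory.cauchyPDFReal_def, integral_const_mul] at h
  rw [Real.coe_toNNReal _ (by linarith)] at h
  have h2 : ∀ x : ℝ, Complex.normSq ((x : ℂ) - v) = (x - v.re) ^ 2 + (-v.im) ^ 2 := fun x => by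
    simp [Complex.normSq_apply]; ring
  simp only [h2]
  have hv' : -v.im ≠ 0 := by linarith
  rw [eq_div_iff hv']
  have := congrArg (Real.pi * ·) h
  simp only [← mul_assoc, mul_inv_cancel₀ Real.pi_ne_zero] at this
  linarith

lemma eLpNorm_cauchy_sq {v : ℂ} (hv : v.im < 0) :
    eLpNorm (fun x : ℝ => ((x : ℂ) - v)⁻¹) 2 volume ^ 2 = ENNReal.ofReal (Real.pi / -v.im) := by
  rw [eLpNorm_two_sq, ← integral_normSq_inv hv, ofReal_integral_eq_lintegral_ofReal
    (integrable_normSq_inv hv) (Eventually.of_forall fun x => inv_nonneg.2 (Complex.normSq_nonneg _))]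
  refine lintegral_congr fun x => ?_
  rw [← ofReal_norm, ← ENNReal.ofReal_pow (norm_nonneg _), norm_inv, inv_pow, Complex.sq_norm]

/-- A function eventually at least `ε` has infinite integral. This supplies arbitrarily large
rectangles with small vertical sides where no pointwise decay is known. -/
lemma frequently_lt_of_integrable {φ : ℝ → ℝ} (hφ : Integrable φ) {ε : ℝ}
    (hε : 0 < ε) : ∃ᶠ R in atTop, φ R < ε := by
  intro h
  obtain ⟨N, hN⟩ := eventually_atTop.1 h
  have h1 : (volume.restrict (Set.Ici N)) {x | ε ≤ ‖φ x‖} < ⊤ :=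
    hφ.restrict.measure_norm_ge_lt_top hε
  have h2 : (volume.restrict (Set.Ici N)) (Set.Ici N) ≤
      (volume.restrict (Set.Ici N)) {x | ε ≤ ‖φ x‖} :=
    measure_mono fun x hx => (not_lt.1 (hN x hx)).trans (Real.le_norm_self _)
  rw [Measure.restrict_apply_self, Real.volume_Ici] at h2
  exact absurd (h2.trans_lt h1) (lt_irrefl _)

/-- Integrals of a holomorphic function along two horizontal lines agree if the function is
integrable on the strip between them. -/
lemma integral_horizontal_eq {H : ℂ → ℂ} {y₁ y₂ : ℝ} (h0 : 0 < y₁) (h12 : y₁ ≤ y₂)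
    (hH : DifferentiableOn ℂ H {z : ℂ | 0 < z.im})
    (hline : ∀ y : ℝ, 0 < y → Integrable fun x : ℝ => H (x + y * Complex.I))
    {C : ℝ} (hC : ∀ y : ℝ, 0 < y → ∫ x : ℝ, ‖H (x + y * Complex.I)‖ ≤ C) :
    ∫ x : ℝ, H (x + y₁ * Complex.I) = ∫ x : ℝ, H (x + y₂ * Complex.I) := by
  have hcont : ContinuousOn (fun p : ℝ × ℝ => H (p.1 + p.2 * Complex.I))
      (Set.univ ×ˢ Set.Ioc y₁ y₂) :=
    hH.continuousOn.comp (by fun_prop) fun p hp => by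
      simpa using h0.trans hp.2.1
  have hmeas : AEStronglyMeasurable (fun p : ℝ × ℝ => H (p.1 + p.2 * Complex.I))
      ((volume : Measure ℝ).prod (volume.restrict (Set.Ioc y₁ y₂))) := by
    have := hcont.aestronglyMeasurable (μ := (volume : Measure ℝ).prod (volume : Measure ℝ))
      (MeasurableSet.univ.prod measurableSet_Ioc)
    rwa [← Measure.prod_restrict, Measure.restrict_univ] at this
  have hint : Integrable (fun p : ℝ × ℝ => H (p.1 + p.2 * Complex.I))
      ((volume : Measure ℝ).prod (volume.restrict (Set.Ioc y₁ y₂))) := by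
    rw [integrable_prod_iff' hmeas]
    have hpos : ∀ᵐ y ∂(volume.restrict (Set.Ioc y₁ y₂)), 0 < y :=
      (ae_restrict_mem measurableSet_Ioc).mono fun y hy => h0.trans hy.1
    refine ⟨hpos.mono fun y hy => hline y hy, ?_⟩
    refine (integrable_const C).mono' hmeas.norm.prod_swap.integral_prod_right' ?_
    filter_upwards [hpos] with y hy
    rw [Real.norm_of_nonneg (integral_nonneg fun x => norm_nonneg _)]
    exact hC y hy
  have hV := hint.norm.integral_prod_left
  -- Adding the reflected function lets a single choice of `R` make both vertical sides, at `R` and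
  -- at `-R`, small.
  have hW := hV.add hV.comp_neg
  set W : ℝ → ℝ := fun x => ∫ y in Set.Ioc y₁ y₂, ‖H (x + y * Complex.I)‖ with hWdef
  have hlim : ∀ y : ℝ, 0 < y → Tendsto (fun R : ℝ => ∫ x in (-R)..R, H (x + y * Complex.I))
      atTop (𝓝 (∫ x : ℝ, H (x + y * Complex.I))) := fun y hy =>
    intervalIntegral_tendsto_integral (hline y hy) tendsto_neg_atTop_atBot tendsto_id
  have hdiff := (hlim y₁ h0).sub (hlim y₂ (h0.trans_le h12))
  rw [← sub_eq_zero, ← norm_eq_zero]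
  refine le_antisymm (le_of_forall_pos_le_add fun ε hε => ?_) (norm_nonneg _)
  have h1 := hdiff.norm.eventually (lt_mem_nhds (sub_lt_self _ (half_pos hε)))
  obtain ⟨R, hR1, hR2⟩ := ((frequently_lt_of_integrable hW (half_pos hε)).and_eventually h1).exists
  have hrect := Complex.integral_boundary_rect_eq_zero_of_differentiableOn H
    (⟨-R, y₁⟩ : ℂ) (⟨R, y₂⟩ : ℂ) (hH.mono fun z hz => by
      have := (Complex.mem_reProdIm.1 hz).2
      simp only [Set.uIcc_of_le h12] at this
      exact h0.trans_le this.1)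
  simp only at hrect
  have hvert : ∀ x : ℝ, ‖Complex.I • ∫ y in y₁..y₂, H (x + y * Complex.I)‖ ≤ W x := fun x => by
    rw [norm_smul, Complex.norm_I, one_mul]
    rw [hWdef]
    simp only
    rw [← intervalIntegral.integral_of_le h12]
    exact intervalIntegral.norm_integral_le_integral_norm h12
  have heq : (∫ x in (-R)..R, H (x + y₁ * Complex.I)) - ∫ x in (-R)..R, H (x + y₂ * Complex.I)
      = Complex.I • (∫ y in y₁..y₂, H ((-R : ℝ) + y * Complex.I))
        - Complex.I • ∫ y in y₁..y₂, H (R + y * Complex.I) := by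
    linear_combination hrect
  rw [heq] at hR2
  have h3 := norm_sub_le (Complex.I • (∫ y in y₁..y₂, H ((-R : ℝ) + y * Complex.I)))
    (Complex.I • ∫ y in y₁..y₂, H (R + y * Complex.I))
  have h4 := hvert (-R)
  have h5 := hvert R
  simp only [Pi.add_apply] at hR1
  have h6 : W R + W (-R) < ε / 2 := hR1
  linarith

lemma memLp_line {G : ℂ → ℂ} {f : L2R} (h : IsHardyExtension G f) {y : ℝ} (hy : 0 < y) :
    MemLp (fun x : ℝ => G (x + y * Complex.I)) 2 volume := by
  obtain ⟨C, hC⟩ := h.bounded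
  exact ⟨h.aesm hy, (hC y hy).trans_lt ENNReal.coe_lt_top⟩

lemma memLp_cauchy_shift {v : ℂ} (hv : v.im < 0) {y : ℝ} (hy : 0 ≤ y) :
    MemLp (fun x : ℝ => ((x : ℂ) + y * Complex.I - v)⁻¹) 2 volume :=
  ⟨(by fun_prop : Measurable _).aestronglyMeasurable,
    (eLpNorm_cauchy_shift_le hv hy).trans_lt (memLp_cauchy hv.ne).2⟩

/-- For `Im v < 0` the function `G(z) / (z - v)` is holomorphic in the upper half-plane, and its
integral over a horizontal line does not depend on the height. At great height it tends to zero by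
Cauchy–Schwarz, since the Cauchy factor has norm `√(π / (y - Im v))`; so it is zero at every height,
and the boundary limit gives the claim. -/
lemma cauchyAnn_of_mem_H2 {f : L2R} (hf : f ∈ H2) : CauchyAnn f := by
  obtain ⟨G, hG⟩ := hf
  intro v hv
  obtain ⟨C, hC⟩ := hG.bounded
  set H : ℂ → ℂ := fun z => G z * (z - v)⁻¹ with hH
  set K := eLpNorm (fun x : ℝ => ((x : ℂ) - v)⁻¹) 2 volume with hK
  have hKtop : K ≠ ⊤ := (memLp_cauchy hv.ne).2.ne
  have hHd : DifferentiableOn ℂ H {z : ℂ | 0 < z.im} := by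
    refine hG.differentiableOn.mul (DifferentiableOn.inv (by fun_prop) fun z hz h => ?_)
    have := congrArg Complex.im h
    have hz' : 0 < z.im := hz
    simp at this
    linarith
  have hline : ∀ y : ℝ, 0 < y → Integrable fun x : ℝ => H (x + y * Complex.I) := fun y hy =>
    (memLp_line hG hy).integrable_mul (memLp_cauchy_shift hv hy.le)
  have hnorm : ∀ y : ℝ, 0 < y → ∫ x : ℝ, ‖H (x + y * Complex.I)‖ ≤ (C * K).toReal := fun y hy => by
    rw [integral_norm_eq_lintegral_enorm (hline y hy).1, ← eLpNorm_one_eq_lintegral_enorm]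
    refine ENNReal.toReal_mono (ENNReal.mul_ne_top ENNReal.coe_ne_top hKtop) ?_
    refine (eLpNorm_mul_two_le (hG.aesm hy) (memLp_cauchy_shift hv hy.le).1).trans ?_
    exact mul_le_mul' (hC y hy) (eLpNorm_cauchy_shift_le hv hy.le)
  -- the integral over a line far up is small
  have htop : Tendsto (fun y : ℝ => ∫ x : ℝ, H (x + y * Complex.I)) atTop (𝓝 0) := by
    rw [tendsto_zero_iff_norm_tendsto_zero]
    have hle : ∀ᶠ y : ℝ in atTop, ‖∫ x : ℝ, H (x + y * Complex.I)‖ ≤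
        C * √(Real.pi / (y - v.im)) := by
      filter_upwards [eventually_gt_atTop 0] with y hy
      have h1 := enorm_integral_mul_le (hG.aesm hy) (memLp_cauchy_shift hv hy.le).1
      have h2 : eLpNorm (fun x : ℝ => ((x : ℂ) + y * Complex.I - v)⁻¹) 2 volume
          = ENNReal.ofReal √(Real.pi / (y - v.im)) := by
        have h3 := eLpNorm_cauchy_sq (v := v - y * Complex.I) (by simp; linarith)
        have h4 : (fun x : ℝ => ((x : ℂ) - (v - y * Complex.I))⁻¹)
            = fun x : ℝ => ((x : ℂ) + y * Complex.I - v)⁻¹ := by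
          ext x; congr 1; ring
        rw [h4] at h3
        have h5 : -(v - y * Complex.I).im = y - v.im := by simp
        rw [h5] at h3
        refine (ENNReal.pow_right_strictMono two_ne_zero).injective ?_
        rw [h3, ← ENNReal.ofReal_pow (Real.sqrt_nonneg _), Real.sq_sqrt]
        have := Real.pi_pos
        exact div_nonneg this.le (by linarith)
      rw [h2] at h1
      have h6 := h1.trans (mul_le_mul' (hC y hy) le_rfl)
      rw [← ofReal_norm, ← ENNReal.ofReal_coe_nnreal, ← ENNReal.ofReal_mul C.coe_nonneg] at h6
      exact (ENNReal.ofReal_le_ofReal_iff (by positivity)).1 h6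
    refine squeeze_zero' (Eventually.of_forall fun _ => norm_nonneg _) hle ?_
    have h7 : Tendsto (fun y : ℝ => Real.pi / (y - v.im)) atTop (𝓝 0) :=
      tendsto_const_nhds.div_atTop (tendsto_atTop_add_const_right _ _ tendsto_id)
    have h8 := (h7.sqrt).const_mul (C : ℝ)
    simpa using h8
  have hzero : ∀ y : ℝ, 0 < y → ∫ x : ℝ, H (x + y * Complex.I) = 0 := fun y hy => by
    refine tendsto_nhds_unique ?_ htop
    refine tendsto_const_nhds.congr' ?_
    filter_upwards [eventually_ge_atTop y] with y' hy'
    exact integral_horizontal_eq hy hy' hHd hline hnorm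
  have hbd : ∀ y : ℝ, 0 < y → ‖∫ x : ℝ, f x * ((x : ℂ) - v)⁻¹‖ₑ ≤
      eLpNorm (fun x : ℝ => G (x + y * Complex.I) - f x) 2 volume * K
        + eLpNorm f 2 volume * (ENNReal.ofReal (y * |v.im|⁻¹) * K) := fun y hy => by
    have hs := memLp_cauchy_shift hv hy.le
    have hd := hs.sub (memLp_cauchy hv.ne)
    have hGf := (memLp_line hG hy).sub (Lp.memLp f)
    have i1 : Integrable fun x : ℝ =>
        (G (x + y * Complex.I) - f x) * ((x : ℂ) + y * Complex.I - v)⁻¹ := hGf.integrable_mul hs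
    have i2 : Integrable fun x : ℝ =>
        f x * (((x : ℂ) + y * Complex.I - v)⁻¹ - ((x : ℂ) - v)⁻¹) := (Lp.memLp f).integrable_mul hd
    have i3 : Integrable fun x : ℝ =>
        (G (x + y * Complex.I) - f x) * ((x : ℂ) + y * Complex.I - v)⁻¹ +
        f x * (((x : ℂ) + y * Complex.I - v)⁻¹ - ((x : ℂ) - v)⁻¹) := i1.add i2
    have e1 : ∫ x : ℝ, f x * ((x : ℂ) - v)⁻¹
        = -((∫ x : ℝ, (G (x + y * Complex.I) - f x) * ((x : ℂ) + y * Complex.I - v)⁻¹)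
          + ∫ x : ℝ, f x * (((x : ℂ) + y * Complex.I - v)⁻¹ - ((x : ℂ) - v)⁻¹)) := by
      rw [← integral_add i1 i2, eq_neg_iff_add_eq_zero,
        ← integral_add (integrable_mul_cauchy (Lp.memLp f) hv.ne) i3, ← hzero y hy]
      refine integral_congr_ae (Eventually.of_forall fun x => ?_)
      simp only [hH]
      ring
    rw [e1, enorm_neg]
    refine (enorm_add_le _ _).trans (add_le_add ?_ ?_)
    · exact (enorm_integral_mul_le hGf.1 hs.1).trans
        (mul_le_mul' le_rfl (eLpNorm_cauchy_shift_le hv hy.le))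
    · exact (enorm_integral_mul_le (Lp.aestronglyMeasurable f) hd.1).trans
        (mul_le_mul' le_rfl (eLpNorm_cauchy_shift_sub_le hv hy.le))
  have hlim : Tendsto (fun y : ℝ => eLpNorm (fun x : ℝ => G (x + y * Complex.I) - f x) 2 volume * K
        + eLpNorm f 2 volume * (ENNReal.ofReal (y * |v.im|⁻¹) * K)) (𝓝[>] 0) (𝓝 0) := by
    have a1 := ENNReal.Tendsto.mul_const (b := K) hG.boundary (Or.inr hKtop)
    have a2 : Tendsto (fun y : ℝ => ENNReal.ofReal (y * |v.im|⁻¹)) (𝓝[>] 0) (𝓝 0) := by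
      have : Tendsto (fun y : ℝ => ENNReal.ofReal (y * |v.im|⁻¹)) (𝓝 0)
          (𝓝 (ENNReal.ofReal (0 * |v.im|⁻¹))) :=
        (ENNReal.continuous_ofReal.comp (by fun_prop)).tendsto 0
      rw [zero_mul, ENNReal.ofReal_zero] at this
      exact this.mono_left nhdsWithin_le_nhds
    have a3 := ENNReal.Tendsto.const_mul (a := eLpNorm f 2 volume)
      (ENNReal.Tendsto.mul_const (b := K) a2 (Or.inr hKtop)) (Or.inr (Lp.memLp f).2.ne)
    simpa using a1.add a3
  have h0 : ‖∫ x : ℝ, f x * ((x : ℂ) - v)⁻¹‖ₑ ≤ 0 :=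
    ge_of_tendsto hlim (by filter_upwards [self_mem_nhdsWithin] with y hy using hbd y hy)
  simpa using h0

lemma cauchy_mem_H2 {v : ℂ} (hv : v.im < 0) : cauchy v hv.ne ∈ H2 := by
  have hK := (memLp_cauchy hv.ne).2.ne
  refine ⟨fun z => (z - v)⁻¹, ?_, ⟨(eLpNorm (fun x : ℝ => ((x : ℂ) - v)⁻¹) 2 volume).toNNReal, fun y hy => ?_⟩, ?_⟩
  · refine DifferentiableOn.inv (by fun_prop) fun z hz h => ?_
    have := congrArg Complex.im h
    have hz' : 0 < z.im := hz
    simp at this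
    linarith
  · rw [ENNReal.coe_toNNReal hK]
    exact eLpNorm_cauchy_shift_le hv hy.le
  · have h : Tendsto (fun y : ℝ => ENNReal.ofReal (y * |v.im|⁻¹) *
        eLpNorm (fun x : ℝ => ((x : ℂ) - v)⁻¹) 2 volume) (𝓝[>] 0) (𝓝 0) := by
      have : Tendsto (fun y : ℝ => ENNReal.ofReal (y * |v.im|⁻¹)) (𝓝 0)
          (𝓝 (ENNReal.ofReal (0 * |v.im|⁻¹))) :=
        (ENNReal.continuous_ofReal.comp (by fun_prop)).tendsto 0
      rw [zero_mul, ENNReal.ofReal_zero] at this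
      simpa using ENNReal.Tendsto.mul_const (this.mono_left nhdsWithin_le_nhds) (Or.inr hK)
    refine tendsto_of_tendsto_of_tendsto_of_le_of_le' tendsto_const_nhds h
      (Eventually.of_forall fun _ => zero_le) ?_
    filter_upwards [self_mem_nhdsWithin] with y hy
    refine le_trans (le_of_eq (eLpNorm_congr_ae ?_)) (eLpNorm_cauchy_shift_sub_le hv (le_of_lt hy))
    filter_upwards [cauchy_apply hv.ne] with x hx
    rw [hx]

/-! ### Poisson integrals and the characterisation of the Hardy space -/

lemma differentiableAt_cauchyIntegral {f : ℝ → ℂ} (hf : MemLp f 2 volume) {z₀ : ℂ}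
    (hz₀ : z₀.im ≠ 0) :
    DifferentiableAt ℂ (fun z : ℂ => ∫ t : ℝ, f t * ((t : ℂ) - z)⁻¹) z₀ := by
  have hpos : 0 < |z₀.im| / 2 := by positivity
  have hlow : ∀ z ∈ Metric.ball z₀ (|z₀.im| / 2), ∀ t : ℝ,
      ‖(t : ℂ) - z₀‖ / 2 ≤ ‖(t : ℂ) - z‖ := fun z hz t => by
    have h1 := abs_im_le_norm_sub z₀ t
    have h2 : ‖z - z₀‖ < |z₀.im| / 2 := by simpa [dist_eq_norm] using hz
    have h3 : ‖(t : ℂ) - z₀‖ ≤ ‖(t : ℂ) - z‖ + ‖z - z₀‖ := by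
      refine le_trans (le_of_eq ?_) (norm_add_le _ _)
      congr 1; ring
    linarith
  have hne : ∀ t : ℝ, 0 < ‖(t : ℂ) - z₀‖ := fun t =>
    norm_pos_iff.2 (sub_ne_zero_of_im_ne_zero hz₀ t)
  refine (hasDerivAt_integral_of_dominated_loc_of_deriv_le (μ := volume)
    (F := fun z (t : ℝ) => f t * ((t : ℂ) - z)⁻¹)
    (F' := fun z (t : ℝ) => f t * (((t : ℂ) - z) ^ 2)⁻¹)
    (bound := fun t : ℝ => 4 * |z₀.im|⁻¹ * ‖f t * ((t : ℂ) - z₀)⁻¹‖)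
    (Metric.ball_mem_nhds z₀ hpos)
    (Eventually.of_forall fun z =>
      hf.1.mul (by fun_prop : Measurable fun t : ℝ => ((t : ℂ) - z)⁻¹).aestronglyMeasurable)
    (integrable_mul_cauchy hf hz₀)
    (hf.1.mul (by fun_prop : Measurable fun t : ℝ => (((t : ℂ) - z₀) ^ 2)⁻¹).aestronglyMeasurable)
    (Eventually.of_forall fun t z hz => ?_)
    ((integrable_mul_cauchy hf hz₀).norm.const_mul _)
    (Eventually.of_forall fun t z hz => ?_)).2.differentiableAt
  · have h1 := hlow z hz t
    have h2 := hne t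
    have h3 := abs_im_le_norm_sub z₀ t
    have h4 : 0 < |z₀.im| := abs_pos.2 hz₀
    rw [norm_mul, norm_mul, norm_inv, norm_inv, norm_pow, mul_left_comm]
    refine mul_le_mul_of_nonneg_left ?_ (norm_nonneg _)
    -- The `4` is the square of the factor `2` lost on the ball of radius `|Im z₀| / 2`; one of the
    -- two factors `|t - z₀|` is then bounded below by `|Im z₀|`.
    have h5 : |z₀.im| * ‖(t : ℂ) - z₀‖ / 4 ≤ ‖(t : ℂ) - z‖ ^ 2 := by nlinarith
    calc (‖(t : ℂ) - z‖ ^ 2)⁻¹ ≤ (|z₀.im| * ‖(t : ℂ) - z₀‖ / 4)⁻¹ := inv_anti₀ (by positivity) h5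
      _ = 4 * |z₀.im|⁻¹ * ‖(t : ℂ) - z₀‖⁻¹ := by field_simp
  · have h2 : (t : ℂ) - z ≠ 0 := norm_pos_iff.1 (lt_of_lt_of_le (half_pos (hne t)) (hlow z hz t))
    have h := ((hasDerivAt_id z).const_sub (t : ℂ)).inv h2
    simpa using h.const_mul (f t)

/-! ### Translations and Poisson averages -/

lemma eLpNorm_translate (f : L2R) (a : ℝ) :
    eLpNorm (fun x : ℝ => f (x + a)) 2 volume = eLpNorm f 2 volume :=
  eLpNorm_comp_measurePreserving (Lp.aestronglyMeasurable f) (measurePreserving_add_right volume a)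

lemma aesm_translate (f : L2R) (a : ℝ) :
    AEStronglyMeasurable (fun x : ℝ => f (x + a)) volume :=
  (Lp.aestronglyMeasurable f).comp_measurePreserving (measurePreserving_add_right volume a)

instance : Fact ((2 : ℝ≥0∞) ≠ ⊤) := ⟨by simp⟩

/-- Strong continuity of translation on `L²`, read off from the continuous action of the additive
group on `Lp`. -/
lemma tendsto_translate_sub (f : L2R) :
    Tendsto (fun a : ℝ => eLpNorm (fun x : ℝ => f (x + a) - f x) 2 volume) (𝓝 0) (𝓝 0) := by
  have hc : Continuous fun a : ℝ => DomAddAct.mk a +ᵥ f :=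
    (continuous_id.vadd continuous_const).comp (by fun_prop : Continuous fun a : ℝ => DomAddAct.mk a)
  have h := (hc.sub (continuous_const (y := f))).enorm.tendsto 0
  have h0 : (DomAddAct.mk (0 : ℝ) +ᵥ f) - f = 0 := by
    rw [sub_eq_zero]
    refine Lp.ext ?_
    filter_upwards [DomAddAct.vadd_Lp_ae_eq (DomAddAct.mk (0 : ℝ)) f] with x hx
    rw [hx]; simp
  simp only [Pi.sub_apply, h0, enorm_zero] at h
  refine h.congr fun a => ?_
  rw [Lp.enorm_def]
  refine eLpNorm_congr_ae ?_
  filter_upwards [DomAddAct.vadd_Lp_ae_eq (DomAddAct.mk a) f,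
    Lp.coeFn_sub (DomAddAct.mk a +ᵥ f) f] with x hx hx'
  rw [hx', Pi.sub_apply, hx]
  simp [add_comm]

/-- The standard Cauchy distribution, the Poisson kernel at height `1`. -/
noncomputable abbrev poissonMeasure₁ : Measure ℝ := ProbabilityTheory.cauchyMeasure 0 1

/-- The Poisson integral of `f` at the point `x + iy`. -/
noncomputable def poissonInt (f : ℝ → ℂ) (y x : ℝ) : ℂ := ∫ s, f (x + y * s) ∂poissonMeasure₁

/-- The Poisson integral averages the translates of `f` over a probability measure, so the square of
the averaged difference is at most the average of the squares; Tonelli exchanges the two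
integrations. -/
lemma eLpNorm_poissonInt_sub_sq_le (f : L2R) (y : ℝ) :
    eLpNorm (fun x => poissonInt f y x - f x) 2 volume ^ 2 ≤
      ∫⁻ s, eLpNorm (fun x : ℝ => f (x + y * s) - f x) 2 volume ^ 2 ∂poissonMeasure₁ := by
  have hfm : Measurable f := (Lp.stronglyMeasurable f).measurable
  simp_rw [eLpNorm_two_sq]
  rw [lintegral_lintegral_swap]
  · refine lintegral_mono fun x => ?_
    rw [← eLpNorm_two_sq poissonMeasure₁ fun s => f (x + y * s) - f x]
    refine pow_le_pow_left' ?_ 2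
    have hm : AEStronglyMeasurable (fun s => f (x + y * s) - f x) poissonMeasure₁ :=
      (by fun_prop : Measurable _).aestronglyMeasurable
    -- Where the right-hand side is infinite there is nothing to prove; elsewhere its finiteness
    -- supplies the integrability needed to subtract under the integral.
    by_cases htop : eLpNorm (fun s => f (x + y * s) - f x) 2 poissonMeasure₁ = ⊤
    · rw [htop]; exact le_top
    have hmem : MemLp (fun s => f (x + y * s) - f x) 2 poissonMeasure₁ :=
      ⟨hm, lt_top_iff_ne_top.2 htop⟩
    have hint := hmem.integrable (by norm_num)
    have heq : poissonInt f y x - f x = ∫ s, (f (x + y * s) - f x) ∂poissonMeasure₁ := by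
      have h1 : Integrable (fun s => f (x + y * s)) poissonMeasure₁ := by
        refine (hint.add (integrable_const (f x))).congr (Eventually.of_forall fun s => ?_)
        simp
      rw [integral_sub h1 (integrable_const _), poissonInt]
      simp
    rw [heq]
    refine (enorm_integral_le_lintegral_enorm _).trans ?_
    rw [← eLpNorm_one_eq_lintegral_enorm]
    exact eLpNorm_le_eLpNorm_of_exponent_le (by norm_num) hm
  · exact (by fun_prop : Measurable _).aemeasurable

lemma eLpNorm_translate_sub_le (f : L2R) (a : ℝ) :
    eLpNorm (fun x : ℝ => f (x + a) - f x) 2 volume ≤ 2 * eLpNorm f 2 volume := by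
  refine (eLpNorm_sub_le (aesm_translate f a) (Lp.aestronglyMeasurable f) (by norm_num)).trans ?_
  rw [eLpNorm_translate, two_mul]

lemma eLpNorm_poissonInt_sub_le (f : L2R) (y : ℝ) :
    eLpNorm (fun x => poissonInt f y x - f x) 2 volume ≤ 2 * eLpNorm f 2 volume := by
  refine (ENNReal.pow_le_pow_left_iff two_ne_zero).1 ((eLpNorm_poissonInt_sub_sq_le f y).trans ?_)
  refine (lintegral_mono fun s => pow_le_pow_left' (eLpNorm_translate_sub_le f _) 2).trans ?_
  simp

/-- Each translate by `y s` tends to `f` as `y → 0`, and the crude bound by `2 ‖f‖` dominates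
because the averaging measure is finite. -/
lemma tendsto_poissonInt_sub (f : L2R) :
    Tendsto (fun y => eLpNorm (fun x => poissonInt f y x - f x) 2 volume) (𝓝 0) (𝓝 0) := by
  have hfm : Measurable f := (Lp.stronglyMeasurable f).measurable
  have h1 : Tendsto (fun y : ℝ => ∫⁻ s, eLpNorm (fun x : ℝ => f (x + y * s) - f x) 2 volume ^ 2
      ∂poissonMeasure₁) (𝓝 0) (𝓝 (∫⁻ _, 0 ∂poissonMeasure₁)) := by
    refine tendsto_lintegral_filter_of_dominated_convergence
      (fun _ => (2 * eLpNorm f 2 volume) ^ 2) (Eventually.of_forall fun y => ?_)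
      (Eventually.of_forall fun y => Eventually.of_forall fun s =>
        pow_le_pow_left' (eLpNorm_translate_sub_le f _) 2) ?_ (Eventually.of_forall fun s => ?_)
    · simp_rw [eLpNorm_two_sq]
      exact Measurable.lintegral_prod_right' (f := fun p : ℝ × ℝ =>
        ‖f (p.2 + y * p.1) - f p.2‖ₑ ^ 2) (by fun_prop)
    · simp only [lintegral_const, measure_univ, mul_one]
      exact ENNReal.pow_ne_top (ENNReal.mul_ne_top (by simp) (Lp.memLp f).2.ne)
    · have h2 : Tendsto (fun y : ℝ => y * s) (𝓝 0) (𝓝 0) := by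
        simpa using (continuous_mul_const s).tendsto 0
      have h3 := (ENNReal.continuous_pow 2).tendsto _ |>.comp ((tendsto_translate_sub f).comp h2)
      rw [zero_pow two_ne_zero] at h3
      exact h3
  rw [lintegral_zero] at h1
  have h2 := tendsto_of_tendsto_of_tendsto_of_le_of_le tendsto_const_nhds h1
    (fun _ => zero_le) (fun y => eLpNorm_poissonInt_sub_sq_le f y)
  have h3 := (ENNReal.continuous_rpow_const (y := 1 / 2)).tendsto _ |>.comp h2
  rw [ENNReal.zero_rpow_of_pos (by norm_num)] at h3
  refine h3.congr fun y => ?_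
  simp only [Function.comp]
  rw [← ENNReal.rpow_natCast, ← ENNReal.rpow_mul]
  norm_num

/-- The difference of the Cauchy kernels at conjugate points `x ± iy` is `2πi` times the Poisson
kernel, which the substitution `t = x + y s` turns into the standard Cauchy density. -/
lemma poissonInt_eq (f : ℝ → ℂ) {y : ℝ} (hy : 0 < y) (x : ℝ) :
    ∫ t : ℝ, f t * (((t : ℂ) - (x + y * Complex.I))⁻¹ - ((t : ℂ) - (x - y * Complex.I))⁻¹)
      = 2 * Real.pi * Complex.I * poissonInt f y x := by
  set g : ℝ → ℂ := fun t =>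
    f t * (((t : ℂ) - (x + y * Complex.I))⁻¹ - ((t : ℂ) - (x - y * Complex.I))⁻¹) with hg
  have h1 : ∫ t, g t = y * ∫ s, g (x + y * s) := by
    rw [Measure.integral_comp_mul_left (fun t => g (x + t)) y, integral_add_left_eq_self g x,
      abs_of_pos (inv_pos.2 hy), Complex.real_smul, ← mul_assoc, ← Complex.ofReal_mul,
      mul_inv_cancel₀ hy.ne', Complex.ofReal_one, one_mul]
  rw [h1, poissonInt, poissonMeasure₁,
    ProbabilityTheory.cauchyMeasure_of_scale_ne_zero _ one_ne_zero,
    integral_withDensity_eq_integral_toReal_smul (by fun_prop)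
      (Eventually.of_forall fun s => by simp [ProbabilityTheory.cauchyPDF]),
    ← integral_const_mul, ← integral_const_mul]
  refine integral_congr_ae (Eventually.of_forall fun s => ?_)
  have hs : 0 < s ^ 2 + 1 := by positivity
  simp only [hg, ProbabilityTheory.cauchyPDF, ProbabilityTheory.cauchyPDFReal_def, Complex.real_smul]
  rw [ENNReal.toReal_ofReal (by positivity)]
  have hy' : (y : ℂ) ≠ 0 := Complex.ofReal_ne_zero.2 hy.ne'
  have hpi : (Real.pi : ℂ) ≠ 0 := Complex.ofReal_ne_zero.2 Real.pi_ne_zero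
  have ha : (s : ℂ) - Complex.I ≠ 0 := by
    have := sub_ne_zero_of_im_ne_zero (v := Complex.I) (by simp) s
    exact this
  have hb : (s : ℂ) + Complex.I ≠ 0 := by
    have := sub_ne_zero_of_im_ne_zero (v := -Complex.I) (by simp) s
    simpa using this
  have hs' : (s : ℂ) ^ 2 + 1 ≠ 0 := by exact_mod_cast hs.ne'
  have hab : ((s : ℂ) - Complex.I) * (s + Complex.I) = s ^ 2 + 1 := by
    linear_combination -Complex.I_sq
  have e1 : (((x + y * s : ℝ) : ℂ) - (x + y * Complex.I))⁻¹ = (y : ℂ)⁻¹ * ((s : ℂ) - Complex.I)⁻¹ := by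
    rw [← mul_inv]; congr 1; push_cast; ring
  have e2 : (((x + y * s : ℝ) : ℂ) - (x - y * Complex.I))⁻¹ = (y : ℂ)⁻¹ * ((s : ℂ) + Complex.I)⁻¹ := by
    rw [← mul_inv]; congr 1; push_cast; ring
  have e3 : ((s : ℂ) - Complex.I)⁻¹ - ((s : ℂ) + Complex.I)⁻¹ = 2 * Complex.I * ((s : ℂ) ^ 2 + 1)⁻¹ := by
    rw [← hab]; field_simp; ring
  rw [e1, e2, ← mul_sub, e3]
  push_cast
  simp only [sub_zero, one_pow, mul_one]
  field_simp

lemma integrable_mul_cauchy_sub {f : ℝ → ℂ} (hf : MemLp f 2 volume) {z w : ℂ} (hz : z.im ≠ 0)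
    (hw : w.im ≠ 0) : ∫ t : ℝ, f t * (((t : ℂ) - z)⁻¹ - ((t : ℂ) - w)⁻¹)
      = (∫ t : ℝ, f t * ((t : ℂ) - z)⁻¹) - ∫ t : ℝ, f t * ((t : ℂ) - w)⁻¹ := by
  rw [← integral_sub (integrable_mul_cauchy hf hz) (integrable_mul_cauchy hf hw)]
  simp only [mul_sub]

lemma poissonInt_eq_sub (f : L2R) {y : ℝ} (hy : 0 < y) (x : ℝ) :
    (∫ t : ℝ, f t * ((t : ℂ) - (x + y * Complex.I))⁻¹)
      - ∫ t : ℝ, f t * ((t : ℂ) - (x - y * Complex.I))⁻¹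
      = 2 * Real.pi * Complex.I * poissonInt f y x := by
  rw [← poissonInt_eq f hy x, integrable_mul_cauchy_sub (Lp.memLp f) (by simpa using hy.ne')
    (by simpa using hy.ne')]

/-- An `L²` function is determined by its Poisson integral. -/
lemma eq_zero_of_cauchyAnn {f : L2R} (h : ∀ v : ℂ, v.im ≠ 0 → ∫ x : ℝ, f x * ((x : ℂ) - v)⁻¹ = 0) :
    f = 0 := by
  have h0 : ∀ y : ℝ, 0 < y → ∀ x, poissonInt f y x = 0 := fun y hy x => by
    have := poissonInt_eq_sub f hy x
    rw [h _ (by simpa using hy.ne'), h _ (by simpa using hy.ne'), sub_zero] at this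
    have hpi : (2 * Real.pi * Complex.I : ℂ) ≠ 0 := by simp [Real.pi_ne_zero]
    exact (mul_eq_zero.1 this.symm).resolve_left hpi
  have h1 : Tendsto (fun y => eLpNorm (fun x => poissonInt f y x - f x) 2 volume) (𝓝[>] 0) (𝓝 0) :=
    (tendsto_poissonInt_sub f).mono_left nhdsWithin_le_nhds
  have h2 : Tendsto (fun y => eLpNorm (fun x => poissonInt f y x - f x) 2 volume) (𝓝[>] 0)
      (𝓝 (eLpNorm f 2 volume)) := by
    refine tendsto_const_nhds.congr' ?_
    filter_upwards [self_mem_nhdsWithin] with y hy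
    simp only [h0 y hy, zero_sub]
    exact (eLpNorm_neg f 2 volume).symm
  have h3 := tendsto_nhds_unique h2 h1
  rw [← norm_eq_zero, Lp.norm_def, h3, ENNReal.toReal_zero]

/-- The extension is the Cauchy integral of `f`. The hypothesis removes the term with the conjugate
pole, so on horizontal lines the Cauchy integral equals the Poisson integral, which is bounded in
`L²` and converges to `f`. -/
lemma mem_H2_of_cauchyAnn {f : L2R} (hf : CauchyAnn f) : f ∈ H2 := by
  set G : ℂ → ℂ := fun z => (2 * Real.pi * Complex.I)⁻¹ * ∫ t : ℝ, f t * ((t : ℂ) - z)⁻¹ with hG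
  have hpi : (2 * Real.pi * Complex.I : ℂ) ≠ 0 := by simp [Real.pi_ne_zero]
  have hGP : ∀ y : ℝ, 0 < y → ∀ x : ℝ, G (x + y * Complex.I) = poissonInt f y x := fun y hy x => by
    have := poissonInt_eq_sub f hy x
    rw [hf (x - y * Complex.I) (by simpa using hy), sub_zero] at this
    rw [hG]; simp only; rw [this, inv_mul_cancel_left₀ hpi]
  have hd : DifferentiableOn ℂ G {z : ℂ | 0 < z.im} := fun z hz =>
    ((differentiableAt_cauchyIntegral (Lp.memLp f) (ne_of_gt hz)).const_mul _).differentiableWithinAt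
  have hm : ∀ y : ℝ, 0 < y → AEStronglyMeasurable (poissonInt f y) volume := fun y hy => by
    have : poissonInt f y = fun x : ℝ => G (x + y * Complex.I) := by
      ext x; rw [hGP y hy]
    rw [this]
    refine (hd.continuousOn.comp_continuous (by fun_prop) fun x => ?_).aestronglyMeasurable
    simpa using hy
  refine ⟨G, hd, ⟨(3 * eLpNorm f 2 volume).toNNReal, fun y hy => ?_⟩, ?_⟩
  · rw [ENNReal.coe_toNNReal (ENNReal.mul_ne_top (by simp) (Lp.memLp f).2.ne)]
    simp only [hGP y hy]
    have h1 : poissonInt f y = (fun x => poissonInt f y x - f x) + f := by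
      ext x; simp
    have h2 := eLpNorm_add_le ((hm y hy).sub (Lp.aestronglyMeasurable f))
      (Lp.aestronglyMeasurable f) (p := 2) (by norm_num)
    rw [sub_add_cancel] at h2
    refine h2.trans ((add_le_add (eLpNorm_poissonInt_sub_le f y) le_rfl).trans (le_of_eq ?_))
    ring
  · refine ((tendsto_poissonInt_sub f).mono_left nhdsWithin_le_nhds).congr' ?_
    filter_upwards [self_mem_nhdsWithin] with y hy
    simp only [hGP y hy]

/-! ### Closedness, total sets and duality in the Hardy space -/

lemma mem_H2_iff {f : L2R} : f ∈ H2 ↔ CauchyAnn f :=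
  ⟨cauchyAnn_of_mem_H2, mem_H2_of_cauchyAnn⟩

lemma inner_cauchy_conj (f : L2R) {v : ℂ} (hv : v.im ≠ 0) :
    inner ℂ (cauchy v hv) f = ∫ x : ℝ, f x * ((x : ℂ) - starRingEnd ℂ v)⁻¹ := by
  rw [inner_eq_integral]
  refine integral_congr_ae ?_
  filter_upwards [cauchy_apply hv] with x hx
  rw [hx, map_inv₀, map_sub, Complex.conj_ofReal, mul_comm]

lemma cauchyAnn_iff_inner {f : L2R} :
    CauchyAnn f ↔ ∀ (v : ℂ) (hv : 0 < v.im), inner ℂ (cauchy v hv.ne') f = 0 := by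
  constructor
  · intro h v hv
    rw [inner_cauchy_conj]
    exact h _ (by simpa using hv)
  · intro h v hv
    have := h (starRingEnd ℂ v) (by simpa using hv)
    rwa [inner_cauchy_conj, Complex.conj_conj] at this

lemma isClosed_H2 : IsClosed (H2 : Set L2R) := by
  have : (H2 : Set L2R) = ⋂ (v : ℂ) (hv : 0 < v.im), {f | inner ℂ (cauchy v hv.ne') f = 0} := by
    ext f
    simp only [Set.mem_iInter, Set.mem_ofPred_eq, SetLike.mem_coe]
    rw [mem_H2_iff, cauchyAnn_iff_inner]
  rw [this]
  exact isClosed_iInter fun v => isClosed_iInter fun hv =>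
    isClosed_eq (by fun_prop) continuous_const

/-- The Cauchy kernels with poles in the lower half-plane span a dense subspace of `H²`. -/
lemma H2_le_closure_span :
    H2 ≤ (Submodule.span ℂ {k | ∃ (v : ℂ) (hv : v.im < 0), k = cauchy v hv.ne}).topologicalClosure := by
  set K := (Submodule.span ℂ {k | ∃ (v : ℂ) (hv : v.im < 0), k = cauchy v hv.ne}).topologicalClosure
    with hK
  have hKc : IsClosed (K : Set L2R) := Submodule.isClosed_topologicalClosure _
  have : CompleteSpace K := hKc.completeSpace_coe
  have hKH : K ≤ H2 := by
    refine Submodule.topologicalClosure_minimal _ (Submodule.span_le.2 ?_) isClosed_H2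
    rintro _ ⟨v, hv, rfl⟩
    exact cauchy_mem_H2 hv
  intro f hf
  obtain ⟨k, hk, l, hl, rfl⟩ := K.exists_add_mem_mem_orthogonal f
  have hlH : l ∈ H2 := by simpa using H2.sub_mem hf (hKH hk)
  -- Poles in the lower half-plane are killed by `l ∈ H2`, poles in the upper half-plane by
  -- orthogonality to the kernel at the conjugate point.
  have hl0 : l = 0 := by
    refine eq_zero_of_cauchyAnn fun v hv => ?_
    rcases lt_or_gt_of_ne hv with h | h
    · exact cauchyAnn_of_mem_H2 hlH v h
    · have hv' : (starRingEnd ℂ v).im < 0 := by simpa using h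
      have h1 := Submodule.inner_right_of_mem_orthogonal
        (Submodule.le_topologicalClosure _ (Submodule.subset_span
          ⟨starRingEnd ℂ v, hv', rfl⟩) : cauchy (starRingEnd ℂ v) hv'.ne ∈ K) hl
      rwa [inner_cauchy_conj, Complex.conj_conj] at h1
  rw [hl0, add_zero]
  exact hk

lemma integral_mul_eq_inner_star (f g : L2R) : ∫ x, f x * g x = inner ℂ (star f) g := by
  rw [inner_eq_integral]
  refine integral_congr_ae ?_
  filter_upwards [Lp.coeFn_star f] with x hx
  rw [hx]; simp

/-- The pairing is bilinear, without conjugation. It vanishes when `g` is a Cauchy kernel, and these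
span a dense subspace of `H²`. -/
lemma integral_mul_eq_zero_of_mem_H2 {f g : L2R} (hf : f ∈ H2) (hg : g ∈ H2) :
    ∫ x, f x * g x = 0 := by
  rw [integral_mul_eq_inner_star]
  have hcl : IsClosed ((LinearMap.ker (innerSL ℂ (star f)).toLinearMap : Submodule ℂ L2R) : Set L2R) :=
    (innerSL ℂ (star f)).isClosed_ker
  have := Submodule.topologicalClosure_minimal _ (Submodule.span_le.2 ?_) hcl
    (H2_le_closure_span hg)
  · exact this
  · rintro _ ⟨v, hv, rfl⟩
    change inner ℂ (star f) (cauchy v hv.ne) = 0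
    rw [← integral_mul_eq_inner_star, ← cauchyAnn_of_mem_H2 hf v hv]
    refine integral_congr_ae ?_
    filter_upwards [cauchy_apply hv.ne] with x hx
    rw [hx]

/-- It suffices to test the Cauchy kernels whose poles are dense in the lower half-plane. -/
lemma cauchyAnn_of_dense {f : ℝ → ℂ} (hf : MemLp f 2 volume) {D : Set ℂ}
    (hD : {v : ℂ | v.im < 0} ⊆ closure (D ∩ {v : ℂ | v.im < 0}))
    (h : ∀ v ∈ D, v.im < 0 → ∫ x : ℝ, f x * ((x : ℂ) - v)⁻¹ = 0) : CauchyAnn f := by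
  intro v hv
  have hc : ContinuousWithinAt (fun z : ℂ => ∫ t : ℝ, f t * ((t : ℂ) - z)⁻¹)
      (D ∩ {v : ℂ | v.im < 0}) v :=
    (differentiableAt_cauchyIntegral hf hv.ne).continuousAt.continuousWithinAt
  have := hc.mem_closure (hD hv) (t := {0}) fun z hz => h z hz.1 hz.2
  simpa using this

/-! ### The hyperbolic algebra leaves the lattices invariant -/

lemma absPow_neg_apply_absPow (s : ℝ) (f : L2R) : absPow (-s) (absPow s f) = f := by
  refine Lp.ext ?_
  filter_upwards [phaseMul_apply (fun x => -s * Real.log |x|) (by fun_prop) (absPow s f),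
    phaseMul_apply (fun x => s * Real.log |x|) (by fun_prop) f] with x h1 h2
  rw [absPow, h1, absPow, h2, ← mul_assoc, ← Complex.exp_add]
  push_cast
  rw [show Complex.I * (-s * Real.log |x|) + Complex.I * (s * Real.log |x|) = (0 : ℂ) by ring,
    Complex.exp_zero, one_mul]

lemma mem_map_absPow {s : ℝ} {K : Submodule ℂ L2R} {f : L2R} :
    f ∈ K.map (absPow s).toLinearMap ↔ absPow (-s) f ∈ K := by
  constructor
  · rintro ⟨g, hg, rfl⟩
    have : absPow (-s) ((absPow s).toLinearMap g) = g := absPow_neg_apply_absPow s g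
    rwa [this]
  · intro h
    refine ⟨_, h, ?_⟩
    have := absPow_neg_apply_absPow (-s) f
    rwa [neg_neg] at this

lemma M_absPow (lam s : ℝ) (f : L2R) : M lam (absPow s f) = absPow s (M lam f) := by
  refine Lp.ext ?_
  filter_upwards [phaseMul_apply (fun x => lam * x) (by fun_prop) (absPow s f),
    phaseMul_apply (fun x => s * Real.log |x|) (by fun_prop) f,
    phaseMul_apply (fun x => lam * x) (by fun_prop) f,
    phaseMul_apply (fun x => s * Real.log |x|) (by fun_prop) (M lam f)] with x h1 h2 h3 h4
  have h4' : absPow s (M lam f) x = _ := h4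
  have h3' : M lam f x = _ := h3
  have h2' : absPow s f x = _ := h2
  rw [h4', h3', M, h1, h2']
  ring

lemma ae_ne_zero : ∀ᵐ x : ℝ, x ≠ 0 := by simp [ae_iff]

/-- Since `|e^t x|^{is} = e^{ist} |x|^{is}`, the two operators commute up to a unimodular scalar,
which invariant subspaces do not see. -/
lemma dil_absPow (t s : ℝ) (f : L2R) :
    dil t (absPow s f) = Complex.exp (Complex.I * (s * t : ℝ)) • absPow s (dil t f) := by
  refine Lp.ext ?_
  filter_upwards [dil_apply t (absPow s f), dil_apply t f, ae_ne_zero,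
    (qmp_dilate t).ae (phaseMul_apply (fun x => s * Real.log |x|) (by fun_prop) f),
    phaseMul_apply (fun x => s * Real.log |x|) (by fun_prop) (dil t f),
    Lp.coeFn_smul (Complex.exp (Complex.I * (s * t : ℝ))) (absPow s (dil t f))]
    with x h1 h2 hx h3 h4 h5
  rw [h5, h1, absPow, h3, Pi.smul_apply, h4, h2, abs_mul, abs_of_pos (Real.exp_pos t),
    Real.log_mul (Real.exp_ne_zero t) (abs_ne_zero.2 hx), Real.log_exp, smul_eq_mul]
  have : Complex.exp (Complex.I * ((s * (t + Real.log |x|) : ℝ) : ℂ))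
      = Complex.exp (Complex.I * (s * t : ℝ)) * Complex.exp (Complex.I * (s * Real.log |x| : ℝ)) := by
    rw [← Complex.exp_add]; push_cast; ring_nf
  rw [this]
  ring

/-- For `lam ≥ 0` the function `e^{i lam z}` is bounded by `1` in the upper half-plane, so it
multiplies the holomorphic extension. -/
lemma M_mem_H2 {lam : ℝ} (hl : 0 ≤ lam) {f : L2R} (hf : f ∈ H2) : M lam f ∈ H2 := by
  obtain ⟨G, hG⟩ := hf
  have hexp : ∀ x y : ℝ, Complex.exp (Complex.I * lam * (x + y * Complex.I))
      = Real.exp (-(lam * y)) * Complex.exp (Complex.I * (lam * x : ℝ)) := fun x y => by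
    rw [Complex.ofReal_exp, ← Complex.exp_add]
    congr 1
    push_cast
    linear_combination (lam * y : ℂ) * Complex.I_sq
  have hph : ∀ x : ℝ, ‖Complex.exp (Complex.I * (lam * x : ℝ))‖ = 1 := fun x => by
    rw [mul_comm]; exact Complex.norm_exp_ofReal_mul_I _
  have hle : ∀ y : ℝ, 0 < y → Real.exp (-(lam * y)) ≤ 1 := fun y hy =>
    Real.exp_le_one_iff.2 (neg_nonpos.2 (mul_nonneg hl hy.le))
  refine ⟨fun z => Complex.exp (Complex.I * lam * z) * G z,
    (by fun_prop : DifferentiableOn ℂ (fun z => Complex.exp (Complex.I * lam * z)) _).mul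
      hG.differentiableOn, ?_, ?_⟩
  · obtain ⟨C, hC⟩ := hG.bounded
    refine ⟨C, fun y hy => (eLpNorm_mono fun x => ?_).trans (hC y hy)⟩
    rw [hexp, norm_mul, norm_mul, hph, mul_one, Complex.norm_real,
      Real.norm_of_nonneg (Real.exp_pos _).le]
    exact mul_le_of_le_one_left (norm_nonneg _) (hle y hy)
  · have h2 : Tendsto (fun y : ℝ => ENNReal.ofReal (lam * y)) (𝓝[>] 0) (𝓝 0) := by
      have : Tendsto (fun y : ℝ => ENNReal.ofReal (lam * y)) (𝓝 0)
          (𝓝 (ENNReal.ofReal (lam * 0))) :=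
        (ENNReal.continuous_ofReal.comp (by fun_prop)).tendsto 0
      rw [mul_zero, ENNReal.ofReal_zero] at this
      exact this.mono_left nhdsWithin_le_nhds
    have h3 := hG.boundary.add (ENNReal.Tendsto.mul_const (b := eLpNorm f 2 volume) h2
      (Or.inr (Lp.memLp f).2.ne))
    rw [zero_mul, add_zero] at h3
    refine tendsto_of_tendsto_of_tendsto_of_le_of_le' tendsto_const_nhds h3
      (Eventually.of_forall fun _ => zero_le) ?_
    filter_upwards [self_mem_nhdsWithin] with y hy
    have hy' : 0 < y := hy
    have h4 : eLpNorm (fun x : ℝ => (lam * y : ℝ) • f x) 2 volume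
        = ENNReal.ofReal (lam * y) * eLpNorm f 2 volume := by
      have := eLpNorm_const_smul (lam * y) f 2 volume
      rw [Real.enorm_of_nonneg (by positivity)] at this
      exact this
    rw [← h4]
    have h5 : MemLp (fun x : ℝ => (lam * y : ℝ) • f x) 2 volume := (Lp.memLp f).const_smul (lam * y)
    have hd := (memLp_line hG hy').sub (Lp.memLp f)
    refine le_trans (eLpNorm_mono_ae_real (g := fun x : ℝ =>
      ‖G (x + y * Complex.I) - f x‖ + ‖(lam * y : ℝ) • f x‖) ?_) ?_
    · filter_upwards [phaseMul_apply (fun x => lam * x) (by fun_prop) f] with x hx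
      rw [M, hx, hexp]
      -- The error splits into a contraction of `G - f` and the factor `1 - e^{-lam y} ≤ lam y`
      -- times `f`.
      have e1 : (Real.exp (-(lam * y)) : ℂ) * Complex.exp (Complex.I * (lam * x : ℝ)) *
          G (x + y * Complex.I) - Complex.exp (Complex.I * (lam * x : ℝ)) * f x
          = Complex.exp (Complex.I * (lam * x : ℝ)) *
            ((Real.exp (-(lam * y)) : ℂ) * (G (x + y * Complex.I) - f x)
              - ((1 - Real.exp (-(lam * y)) : ℝ) : ℂ) * f x) := by
        push_cast; ring
      rw [e1, norm_mul, hph, one_mul]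
      refine (norm_sub_le _ _).trans (add_le_add ?_ ?_)
      · rw [norm_mul, Complex.norm_real, Real.norm_of_nonneg (Real.exp_pos _).le]
        exact mul_le_of_le_one_left (norm_nonneg _) (hle y hy')
      · rw [norm_mul, Complex.norm_real, norm_smul]
        refine mul_le_mul_of_nonneg_right ?_ (norm_nonneg _)
        rw [Real.norm_of_nonneg (sub_nonneg.2 (hle y hy')), Real.norm_of_nonneg (by positivity)]
        linarith [Real.add_one_le_exp (-(lam * y))]
    · refine (eLpNorm_add_le hd.1.norm h5.1.norm (by norm_num)).trans (add_le_add ?_ ?_)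
      · rw [eLpNorm_norm]; exact le_rfl
      · rw [eLpNorm_norm]

/-- A change of variables moves the pole `v` to `e^t v`, still in the lower half-plane, for either
sign of `t`. -/
lemma dil_mem_H2 (t : ℝ) {f : L2R} (hf : f ∈ H2) : dil t f ∈ H2 := by
  rw [mem_H2_iff] at hf ⊢
  intro v hv
  have het := Real.exp_pos t
  have h1 := hf (Real.exp t * v) (by
    rw [Complex.im_ofReal_mul]; exact mul_neg_of_pos_of_neg het hv)
  have h2 := Measure.integral_comp_mul_left
    (fun u : ℝ => f u * ((u : ℂ) - Real.exp t * v)⁻¹) (Real.exp t)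
  rw [h1, smul_zero] at h2
  have h3 : ∫ x : ℝ, dil t f x * ((x : ℂ) - v)⁻¹
      = ((Real.exp (t / 2) * Real.exp t : ℝ) : ℂ) *
        ∫ x : ℝ, f (Real.exp t * x) * (((Real.exp t * x : ℝ) : ℂ) - Real.exp t * v)⁻¹ := by
    rw [← integral_const_mul]
    refine integral_congr_ae ?_
    filter_upwards [dil_apply t f] with x hx
    rw [hx]
    have e : ((Real.exp t * x : ℝ) : ℂ) - Real.exp t * v = Real.exp t * ((x : ℂ) - v) := by
      push_cast; ring
    have hne : (Real.exp t : ℂ) ≠ 0 := Complex.ofReal_ne_zero.2 het.ne'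
    rw [e, mul_inv]
    push_cast
    rw [Complex.ofReal_exp] at hne
    field_simp
  rw [h3, h2, mul_zero]

/-- The intervals contain `0` and so are stable under shrinking towards it; this is where `t ≥ 0`
matters. -/
lemma mem_interval_of_exp_mul_mem {a b : ℝ≥0∞} {t : ℝ} (ht : 0 ≤ t) {x : ℝ}
    (h : Real.exp t * x ∈ interval a b) : x ∈ interval a b := by
  obtain ⟨h1, h2⟩ := h
  have ha : -(a : EReal) ≤ ((0 : ℝ) : EReal) := by
    rw [EReal.coe_zero, EReal.neg_le, neg_zero]; exact EReal.coe_ennreal_nonneg a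
  have hb : ((0 : ℝ) : EReal) ≤ (b : EReal) := by
    rw [EReal.coe_zero]; exact EReal.coe_ennreal_nonneg b
  have het : 1 ≤ Real.exp t := Real.one_le_exp ht
  rcases le_total 0 x with hx | hx
  · exact ⟨ha.trans (EReal.coe_le_coe_iff.2 hx),
      (EReal.coe_le_coe_iff.2 (by nlinarith)).trans h2⟩
  · exact ⟨h1.trans (EReal.coe_le_coe_iff.2 (by nlinarith)),
      (EReal.coe_le_coe_iff.2 hx).trans hb⟩

lemma measurableSet_interval (a b : ℝ≥0∞) : MeasurableSet (interval a b) :=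
  (measurableSet_le measurable_const measurable_coe_real_ereal).inter
    (measurableSet_le measurable_coe_real_ereal measurable_const)

lemma isClosed_L2interval (a b : ℝ≥0∞) : IsClosed (L2interval a b : Set L2R) := by
  set m : ℝ → ℂ := (interval a b)ᶜ.indicator 1 with hm
  have hmm : Measurable m := measurable_one.indicator (measurableSet_interval a b).compl
  have hC : ∀ x, ‖m x‖ ≤ 1 := fun x => by
    refine (norm_indicator_le_norm_self _ _).trans ?_
    simp
  have : (L2interval a b : Set L2R)
      = ((mulOp m hmm 1 hC).toLinearMap.ker : Submodule ℂ L2R) := by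
    ext f
    change (∀ᵐ x : ℝ, x ∉ interval a b → f x = 0) ↔ mulOp m hmm 1 hC f = 0
    constructor
    · intro h
      refine Lp.ext ?_
      filter_upwards [h, mulOp_apply hmm hC f, Lp.coeFn_zero ℂ 2 (volume : Measure ℝ)] with x h1 h2 h3
      rw [h2, h3, hm]
      by_cases hx : x ∈ interval a b
      · simp [hx]
      · simp [h1 hx]
    · intro h
      filter_upwards [mulOp_apply hmm hC f, Lp.coeFn_zero ℂ 2 (volume : Measure ℝ)] with x h2 h3 hx
      rw [h, h3, hm, Set.indicator_of_mem (by exact hx)] at h2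
      simpa using h2.symm
  rw [this]
  exact (mulOp m hmm 1 hC).isClosed_ker

lemma isClosed_of_mem_lat {K : Submodule ℂ L2R} (hK : K ∈ latM ∪ latS) : IsClosed (K : Set L2R) := by
  rcases hK with ⟨a, b, rfl⟩ | ⟨s, rfl⟩ | rfl | rfl
  · exact isClosed_L2interval a b
  · have : ((H2.map (absPow s).toLinearMap : Submodule ℂ L2R) : Set L2R)
        = absPow (-s) ⁻¹' (H2 : Set L2R) := by
      ext f; exact mem_map_absPow
    rw [this]
    exact isClosed_H2.preimage (absPow (-s)).continuous
  · exact isClosed_singleton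
  · exact isClosed_univ

lemma algH_le_Alg : algH ≤ Alg (latM ∪ latS) := by
  refine algH_le ?_ ?_ (isClosed_weakStar_Alg fun K hK => isClosed_of_mem_lat hK)
  · rintro lam hl K (⟨a, b, rfl⟩ | ⟨s, rfl⟩ | rfl | rfl) f hf
    · have hf' : ∀ᵐ x : ℝ, x ∉ interval a b → f x = 0 := hf
      change ∀ᵐ x : ℝ, x ∉ interval a b → M lam f x = 0
      filter_upwards [hf', phaseMul_apply (fun x => lam * x) (by fun_prop) f] with x h1 h2 hx
      rw [M, h2, h1 hx, mul_zero]
    · rw [mem_map_absPow] at hf ⊢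
      rw [← M_absPow]
      exact M_mem_H2 hl hf
    · rw [Submodule.mem_bot] at hf ⊢
      rw [hf, map_zero]
    · trivial
  · rintro t ht K (⟨a, b, rfl⟩ | ⟨s, rfl⟩ | rfl | rfl) f hf
    · have hf' : ∀ᵐ x : ℝ, x ∉ interval a b → f x = 0 := hf
      change ∀ᵐ x : ℝ, x ∉ interval a b → dil t f x = 0
      filter_upwards [(qmp_dilate t).ae hf', dil_apply t f] with x h1 h2 hx
      rw [h2, h1 fun h => hx (mem_interval_of_exp_mul_mem ht h), mul_zero]
    · rw [mem_map_absPow] at hf ⊢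
      have h1 := dil_absPow t (-s) f
      have h2 : absPow (-s) (dil t f)
          = (Complex.exp (Complex.I * (-s * t : ℝ)))⁻¹ • dil t (absPow (-s) f) := by
        rw [h1, smul_smul, inv_mul_cancel₀ (Complex.exp_ne_zero _), one_smul]
      rw [h2]
      exact H2.smul_mem _ (dil_mem_H2 t hf)
    · rw [Submodule.mem_bot] at hf ⊢
      rw [hf, map_zero]
    · trivial

lemma mem_H2_of_mem_algH {T : L2R →L[ℂ] L2R} (hT : T ∈ algH) {f : L2R} (hf : f ∈ H2) : T f ∈ H2 := by
  refine algH_le_Alg hT H2 (Or.inr (Or.inl ⟨0, ?_⟩)) f hf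
  ext f
  rw [mem_map_absPow]
  have : absPow (-0) f = f := by
    refine Lp.ext ?_
    filter_upwards [phaseMul_apply (fun x => -0 * Real.log |x|) (by fun_prop) f] with x h
    rw [absPow, h]; simp
  rw [this]

/-! ### Multiplication operators in the hyperbolic algebra -/

lemma inner_M (lam : ℝ) (f g : L2R) :
    inner ℂ g (M lam f)
      = ∫ x : ℝ, Complex.exp (Complex.I * (lam * x : ℝ)) * (starRingEnd ℂ (g x) * f x) := by
  rw [inner_eq_integral]
  refine integral_congr_ae ?_
  filter_upwards [phaseMul_apply (fun x => lam * x) (by fun_prop) f] with x hx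
  rw [M, hx]; ring

lemma norm_M_le (lam : ℝ) : ‖M lam‖ ≤ 1 := by
  unfold M phaseMul
  exact LinearMap.mkContinuous_norm_le _ zero_le_one _

lemma inner_mulOp {m : ℝ → ℂ} (hm : Measurable m) {C : ℝ} (hC : ∀ x, ‖m x‖ ≤ C) (f g : L2R) :
    inner ℂ g (mulOp m hm C hC f) = ∫ x : ℝ, m x * (starRingEnd ℂ (g x) * f x) := by
  rw [inner_eq_integral]
  refine integral_congr_ae ?_
  filter_upwards [mulOp_apply hm hC f] with x hx
  rw [hx]; ring

/-- By Fubini, a multiplier that is a superposition of characters with nonnegative frequencies gives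
a weak integral of the operators `M lam`, `lam ≥ 0`. The frequency map `θ` is kept general to allow
`θ t = t²`. -/
lemma mulOp_mem_algH_of_integral {m : ℝ → ℂ} (hm : Measurable m) {C : ℝ} (hC : ∀ x, ‖m x‖ ≤ C)
    {μ : Measure ℝ} [SFinite μ] {θ : ℝ → ℝ} (hθ : Measurable θ) (hθ0 : ∀ᵐ t ∂μ, 0 ≤ θ t)
    {ψ : ℝ → ℂ} (hψ : Integrable ψ μ)
    (h : ∀ x : ℝ, m x = ∫ t, ψ t * Complex.exp (Complex.I * (θ t * x : ℝ)) ∂μ) :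
    mulOp m hm C hC ∈ algH := by
  refine mem_of_inner_eq_integral (A := Subalgebra.toSubmodule algH) isClosed_algH
    (μ := μ) (S := fun t => M (θ t)) (hθ0.mono fun t ht => M_mem_algH ht)
    (fun t => norm_M_le _) hψ (fun f g => ?_) (fun f g => ?_)
  · simp only [inner_M]
    refine AEStronglyMeasurable.integral_prod_right' (μ := μ) (ν := volume)
      (f := fun p : ℝ × ℝ => Complex.exp (Complex.I * (θ p.1 * p.2 : ℝ)) *
        (starRingEnd ℂ (g p.2) * f p.2)) ?_
    exact (by fun_prop : Measurable fun p : ℝ × ℝ =>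
      Complex.exp (Complex.I * (θ p.1 * p.2 : ℝ))).aestronglyMeasurable.mul
        (integrable_conj_mul g f).1.comp_snd
  · have hint : Integrable (fun p : ℝ × ℝ => Complex.exp (Complex.I * (θ p.2 * p.1 : ℝ)) *
        ((starRingEnd ℂ (g p.1) * f p.1) * ψ p.2)) ((volume : Measure ℝ).prod μ) := by
      refine ((integrable_conj_mul g f).mul_prod hψ).bdd_mul (c := 1)
        (by fun_prop : Measurable fun p : ℝ × ℝ =>
          Complex.exp (Complex.I * (θ p.2 * p.1 : ℝ))).aestronglyMeasurable
        (Eventually.of_forall fun p => ?_)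
      rw [mul_comm]; exact (Complex.norm_exp_ofReal_mul_I _).le
    rw [inner_mulOp]
    have h1 := integral_integral_swap (μ := volume) (ν := μ)
      (f := fun (x t : ℝ) => Complex.exp (Complex.I * (θ t * x : ℝ)) *
        ((starRingEnd ℂ (g x) * f x) * ψ t)) hint
    simp only [inner_M]
    calc ∫ x : ℝ, m x * (starRingEnd ℂ (g x) * f x)
        = ∫ x : ℝ, ∫ t, Complex.exp (Complex.I * (θ t * x : ℝ)) *
            ((starRingEnd ℂ (g x) * f x) * ψ t) ∂μ := by
          refine integral_congr_ae (Eventually.of_forall fun x => ?_)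
          simp only
          rw [h, ← integral_mul_const]
          refine integral_congr_ae (Eventually.of_forall fun t => ?_)
          simp only; ring
      _ = ∫ t, (∫ x : ℝ, Complex.exp (Complex.I * (θ t * x : ℝ)) *
            ((starRingEnd ℂ (g x) * f x) * ψ t)) ∂μ := h1
      _ = _ := by
          refine integral_congr_ae (Eventually.of_forall fun t => ?_)
          simp only
          rw [← integral_const_mul]
          refine integral_congr_ae (Eventually.of_forall fun x => ?_)
          simp only; ring

lemma mulOp_mul {m n : ℝ → ℂ} (hm : Measurable m) {C : ℝ} (hC : ∀ x, ‖m x‖ ≤ C)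
    (hn : Measurable n) {D : ℝ} (hD : ∀ x, ‖n x‖ ≤ D) {p : ℝ → ℂ} (hp : Measurable p) {E : ℝ}
    (hE : ∀ x, ‖p x‖ ≤ E) (h : ∀ x, p x = m x * n x) :
    mulOp p hp E hE = mulOp m hm C hC * mulOp n hn D hD := by
  ext1 f
  refine Lp.ext ?_
  filter_upwards [mulOp_apply hp hE f, mulOp_apply hm hC (mulOp n hn D hD f), mulOp_apply hn hD f]
    with x h1 h2 h3
  rw [h1, mul_apply_eq_comp, h2, h3, h, mul_assoc]

lemma mulOp_add_smul {m n : ℝ → ℂ} (hm : Measurable m) {C : ℝ} (hC : ∀ x, ‖m x‖ ≤ C)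
    (hn : Measurable n) {D : ℝ} (hD : ∀ x, ‖n x‖ ≤ D) {p : ℝ → ℂ} (hp : Measurable p) {E : ℝ}
    (hE : ∀ x, ‖p x‖ ≤ E) (c : ℂ) (h : ∀ x, p x = m x + c * n x) :
    mulOp p hp E hE = mulOp m hm C hC + c • mulOp n hn D hD := by
  ext1 f
  refine Lp.ext ?_
  filter_upwards [mulOp_apply hp hE f, mulOp_apply hm hC f, mulOp_apply hn hD f,
    Lp.coeFn_add (mulOp m hm C hC f) (c • mulOp n hn D hD f),
    Lp.coeFn_smul c (mulOp n hn D hD f)] with x h1 h2 h3 h4 h5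
  rw [h1, add_apply, smul_apply, h4, Pi.add_apply, h5,
    Pi.smul_apply, h2, h3, h, smul_eq_mul]
  ring

/-- For `Im v < 0`, `1 / (x - v) = -i ∫₀^∞ e^{i(x - v)t} dt`. -/
lemma mulOp_cauchy_mem_algH {v : ℂ} (hv : v.im < 0) :
    mulOp (fun x : ℝ => ((x : ℂ) - v)⁻¹) (measurable_cauchy v) _ (norm_inv_sub_le v hv.ne) ∈ algH := by
  have hre : 0 > (-(Complex.I * v)).re := by simpa using hv
  have hψ : Integrable (fun t : ℝ => -Complex.I * Complex.exp (-(Complex.I * v) * t))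
      (volume.restrict (Set.Ioi 0)) :=
    (integrableOn_exp_mul_complex_Ioi hre 0).const_mul _
  refine mulOp_mem_algH_of_integral _ _ (μ := volume.restrict (Set.Ioi 0)) (θ := id) measurable_id
    ((ae_restrict_mem measurableSet_Ioi).mono fun t ht => le_of_lt ht) hψ fun x => ?_
  have h1 := integral_exp_mul_complex_Ioi (a := Complex.I * x - Complex.I * v) (by simpa using hv) 0
  have hne := sub_ne_zero_of_im_ne_zero hv.ne x
  calc ((x : ℂ) - v)⁻¹
      = -Complex.I * ∫ t : ℝ in Set.Ioi 0, Complex.exp ((Complex.I * x - Complex.I * v) * t) := by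
        rw [h1, ← mul_sub]
        simp only [Complex.ofReal_zero, mul_zero, Complex.exp_zero]
        field_simp
    _ = _ := by
        rw [← integral_const_mul]
        refine integral_congr_ae (Eventually.of_forall fun t => ?_)
        simp only [id]
        rw [mul_assoc, ← Complex.exp_add]
        congr 2
        push_cast; ring

/-- `(π / (ε - ix))^{1/2}`, up to a constant the boundary values of `(z + iε)^{-1/2}`. -/
noncomputable def halfPow (ε x : ℝ) : ℂ := (Real.pi / ((ε : ℂ) - Complex.I * x)) ^ (1 / 2 : ℂ)

lemma measurable_halfPow (ε : ℝ) : Measurable (halfPow ε) := by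
  unfold halfPow; fun_prop

lemma norm_halfPow (ε x : ℝ) : ‖halfPow ε x‖ = √(Real.pi / ‖(ε : ℂ) - Complex.I * x‖) := by
  have h : (1 / 2 : ℂ) = ((1 / 2 : ℝ) : ℂ) := by push_cast; rfl
  rw [halfPow, h, Complex.norm_cpow_real, Real.sqrt_eq_rpow, norm_div, Complex.norm_real,
    Real.norm_of_nonneg Real.pi_pos.le]

lemma le_norm_sub_I_mul (ε x : ℝ) : ε ≤ ‖(ε : ℂ) - Complex.I * x‖ := by
  have := Complex.re_le_norm ((ε : ℂ) - Complex.I * x)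
  simpa using this

lemma abs_le_norm_sub_I_mul (ε x : ℝ) : |x| ≤ ‖(ε : ℂ) - Complex.I * x‖ := by
  have := Complex.abs_im_le_norm ((ε : ℂ) - Complex.I * x)
  simpa using this

lemma norm_halfPow_le {ε : ℝ} (hε : 0 < ε) (x : ℝ) : ‖halfPow ε x‖ ≤ √(Real.pi / ε) := by
  rw [norm_halfPow]
  exact Real.sqrt_le_sqrt (div_le_div_of_nonneg_left Real.pi_pos.le hε (le_norm_sub_I_mul ε x))

lemma norm_halfPow_le_of_ne {x : ℝ} (hx : x ≠ 0) (ε : ℝ) : ‖halfPow ε x‖ ≤ √(Real.pi / |x|) := by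
  rw [norm_halfPow]
  exact Real.sqrt_le_sqrt
    (div_le_div_of_nonneg_left Real.pi_pos.le (abs_pos.2 hx) (abs_le_norm_sub_I_mul ε x))

/-- The Gaussian integral `∫ e^{-(ε - ix) t²} dt` displays the half power as a superposition of
characters with frequencies `t² ≥ 0`. -/
lemma mulOp_halfPow_mem_algH {ε : ℝ} (hε : 0 < ε) :
    mulOp (halfPow ε) (measurable_halfPow ε) _ (norm_halfPow_le hε) ∈ algH := by
  have hψ : Integrable (fun t : ℝ => Complex.exp (-(ε : ℂ) * t ^ 2)) volume :=
    integrable_cexp_neg_mul_sq (by simpa using hε)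
  refine mulOp_mem_algH_of_integral _ _ (μ := volume) (θ := fun t => t ^ 2) (by fun_prop)
    (Eventually.of_forall fun t => sq_nonneg t) hψ fun x => ?_
  rw [halfPow, ← integral_gaussian_complex (by simpa using hε)]
  refine integral_congr_ae (Eventually.of_forall fun t => ?_)
  simp only
  rw [← Complex.exp_add]
  congr 1
  push_cast; ring

/-- The constant relating `q` to the limit of `halfPow`. -/
noncomputable def halfConst : ℂ := Complex.exp (1 / 2 * Real.log Real.pi + Real.pi / 4 * Complex.I)

/-- At `ε = 0` the base is `iπ / x`, whose principal argument is `π/2 - Arg x` for both signs of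
`x`; so the branch agrees with the one defining `q`. -/
lemma halfPow_zero {x : ℝ} (hx : x ≠ 0) : halfPow 0 x = halfConst * q x := by
  have hpi := Real.pi_pos
  have hb : (Real.pi / (((0 : ℝ) : ℂ) - Complex.I * x)) ≠ 0 := by
    refine div_ne_zero (Complex.ofReal_ne_zero.2 hpi.ne') ?_
    simp [hx]
  rw [halfPow, Complex.cpow_def_of_ne_zero hb, halfConst, q, ← Complex.exp_add]
  congr 1
  rcases lt_or_gt_of_ne hx with h | h
  · have hx' : (x : ℂ) ≠ 0 := Complex.ofReal_ne_zero.2 hx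
    have hnx : 0 < -x := by linarith
    have e1 : (Real.pi / (((0 : ℝ) : ℂ) - Complex.I * x)) = ((Real.pi / (-x) : ℝ) : ℂ) * -Complex.I := by
      push_cast; field_simp
      linear_combination (x : ℂ) * Complex.I_sq
    have e2 : (x : ℂ) = ((-x : ℝ) : ℂ) * -1 := by push_cast; ring
    rw [e1, Complex.log_ofReal_mul (by positivity) (by simp), Complex.log_neg_I,
      Real.log_div hpi.ne' hnx.ne']
    conv_rhs => rw [e2, Complex.log_ofReal_mul hnx (by simp), Complex.log_neg_one]
    push_cast
    ring
  · have hx' : (x : ℂ) ≠ 0 := Complex.ofReal_ne_zero.2 hx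
    have e1 : (Real.pi / (((0 : ℝ) : ℂ) - Complex.I * x)) = ((Real.pi / x : ℝ) : ℂ) * Complex.I := by
      push_cast; field_simp
      linear_combination (x : ℂ) * Complex.I_sq
    rw [e1, Complex.log_ofReal_mul (by positivity) (by simp), Complex.log_I,
      Real.log_div hpi.ne' h.ne', ← Complex.ofReal_log h.le]
    push_cast
    ring

lemma tendsto_halfPow {x : ℝ} (hx : x ≠ 0) :
    Tendsto (fun ε => halfPow ε x) (𝓝 0) (𝓝 (halfConst * q x)) := by
  rw [← halfPow_zero hx]
  have hne : ((0 : ℝ) : ℂ) - Complex.I * x ≠ 0 := by simp [hx]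
  have h1 : ContinuousAt (fun ε : ℝ => Real.pi / ((ε : ℂ) - Complex.I * x)) 0 :=
    ContinuousAt.div (by fun_prop) (by fun_prop) hne
  refine (h1.cpow continuousAt_const ?_).tendsto
  -- The base `iπ / x` has nonzero imaginary part, so it lies off the branch cut of the power.
  right
  have e : (Real.pi / (((0 : ℝ) : ℂ) - Complex.I * x)) = ((Real.pi / x : ℝ) : ℂ) * Complex.I := by
    have hx' : (x : ℂ) ≠ 0 := Complex.ofReal_ne_zero.2 hx
    push_cast; field_simp
    linear_combination (x : ℂ) * Complex.I_sq
  rw [e]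
  simp [Real.pi_ne_zero, hx]

/-! ### The function `q` and the multipliers `q x r` -/

lemma measurable_q : Measurable q := by unfold q; fun_prop

lemma norm_q {x : ℝ} (hx : x ≠ 0) : ‖q x‖ = (√|x|)⁻¹ := by
  have h := norm_q_sq hx
  have hx' := abs_pos.2 hx
  refine eq_inv_of_mul_eq_one_left ?_
  have h2 : (‖q x‖ * √|x|) ^ 2 = 1 := by rw [mul_pow, Real.sq_sqrt hx'.le, h]
  exact (pow_eq_one_iff_of_nonneg (by positivity) two_ne_zero).1 h2

lemma norm_q_mul_abs {x : ℝ} (hx : x ≠ 0) : ‖q x‖ * |x| = √|x| := by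
  have hx' := Real.sqrt_pos.2 (abs_pos.2 hx)
  rw [norm_q hx]
  nth_rewrite 2 [← Real.mul_self_sqrt (abs_nonneg x)]
  rw [inv_mul_cancel_left₀ hx'.ne']

lemma q_sq_mul {x : ℝ} (hx : x ≠ 0) : q x * q x * x = 1 := by
  have hx' : (x : ℂ) ≠ 0 := Complex.ofReal_ne_zero.2 hx
  rw [q, ← Complex.exp_add]
  nth_rewrite 3 [← Complex.exp_log hx']
  rw [← Complex.exp_add, show -(1 / 2) * Complex.log x + -(1 / 2) * Complex.log x + Complex.log x = 0
    by ring, Complex.exp_zero]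

lemma conj_q_mul_q {x : ℝ} (hx : x ≠ 0) : starRingEnd ℂ (q x) * q x * |x| = 1 := by
  rw [mul_comm (starRingEnd ℂ (q x)), Complex.mul_conj, Complex.normSq_eq_norm_sq]
  exact_mod_cast norm_q_sq hx

/-- Both sides become `1` after multiplication by `q x`. This identity explains the `q̄` in the
definition of `V`: with the weight `|x|`, `q̄ r` becomes the analytic multiplier `q x r`. -/
lemma conj_q_mul_abs {x : ℝ} (hx : x ≠ 0) : starRingEnd ℂ (q x) * |x| = q x * x := by
  have h1 := q_sq_mul hx
  have h2 := conj_q_mul_q hx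
  have h3 : q x ≠ 0 := Complex.exp_ne_zero _
  refine mul_right_cancel₀ h3 ?_
  linear_combination h2 - h1

lemma sqrt_abs_le (x : ℝ) : √|x| ≤ 1 + |x| := by
  rw [Real.sqrt_le_left (by positivity)]
  nlinarith [abs_nonneg x]

lemma norm_mul_inv_sub_le {w : ℂ} (hw : w.im ≠ 0) (x : ℝ) :
    (1 + |x|) * ‖((x : ℂ) - w)⁻¹‖ ≤ 1 + (1 + ‖w‖) * |w.im|⁻¹ := by
  have h1 := norm_inv_sub_le w hw x
  have hne := sub_ne_zero_of_im_ne_zero hw x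
  have h2 : |x| ≤ ‖(x : ℂ) - w‖ + ‖w‖ := by
    have := norm_add_le ((x : ℂ) - w) w
    rwa [sub_add_cancel, Complex.norm_real, Real.norm_eq_abs] at this
  have h3 : ‖(x : ℂ) - w‖ * ‖((x : ℂ) - w)⁻¹‖ = 1 := by
    rw [← norm_mul, mul_inv_cancel₀ hne, norm_one]
  calc (1 + |x|) * ‖((x : ℂ) - w)⁻¹‖
      ≤ (1 + (‖(x : ℂ) - w‖ + ‖w‖)) * ‖((x : ℂ) - w)⁻¹‖ := by gcongr
    _ = 1 + (1 + ‖w‖) * ‖((x : ℂ) - w)⁻¹‖ := by linear_combination h3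
    _ ≤ _ := by gcongr

lemma norm_q_mul_inv_sub_le {w : ℂ} (hw : w.im ≠ 0) (x : ℝ) :
    ‖q x * x * ((x : ℂ) - w)⁻¹‖ ≤ 1 + (1 + ‖w‖) * |w.im|⁻¹ := by
  refine le_trans ?_ (norm_mul_inv_sub_le hw x)
  rw [norm_mul]
  refine mul_le_mul_of_nonneg_right ?_ (norm_nonneg _)
  rcases eq_or_ne x 0 with rfl | hx
  · simp
  · rw [norm_mul, Complex.norm_real, Real.norm_eq_abs, norm_q_mul_abs hx]
    exact sqrt_abs_le x

lemma r_eq (v w : ℂ) (x : ℝ) : r v w x = ((x : ℂ) - v)⁻¹ * ((x : ℂ) - w)⁻¹ := by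
  rw [r, one_div, mul_inv]

/-- A bound for the multipliers `q x r_{v,w}`. -/
noncomputable def rBound (v w : ℂ) : ℝ := |v.im|⁻¹ * (1 + (1 + ‖w‖) * |w.im|⁻¹)

lemma one_add_abs_mul_norm_r_le {v w : ℂ} (hv : v.im ≠ 0) (hw : w.im ≠ 0) (x : ℝ) :
    (1 + |x|) * ‖r v w x‖ ≤ rBound v w := by
  rw [r_eq, norm_mul, mul_left_comm, rBound]
  exact mul_le_mul (norm_inv_sub_le v hv x) (norm_mul_inv_sub_le hw x) (by positivity) (by positivity)

lemma norm_qxr_le {v w : ℂ} (hv : v.im ≠ 0) (hw : w.im ≠ 0) (x : ℝ) :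
    ‖q x * x * r v w x‖ ≤ rBound v w := by
  refine le_trans ?_ (one_add_abs_mul_norm_r_le hv hw x)
  rw [norm_mul]
  refine mul_le_mul_of_nonneg_right ?_ (norm_nonneg _)
  rcases eq_or_ne x 0 with rfl | hx
  · simp
  · rw [norm_mul, Complex.norm_real, Real.norm_eq_abs, norm_q_mul_abs hx]
    exact sqrt_abs_le x

lemma measurable_r (v w : ℂ) : Measurable (r v w) := by unfold r; fun_prop

lemma measurable_qxr (v w : ℂ) : Measurable fun x : ℝ => q x * x * r v w x :=
  (measurable_q.mul (by fun_prop)).mul (measurable_r v w)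

lemma norm_halfPow_mul_le {x : ℝ} (hx : x ≠ 0) (ε : ℝ) : ‖halfPow ε x‖ * |x| ≤ √Real.pi * √|x| := by
  have h0 := Real.sqrt_pos.2 (abs_pos.2 hx)
  calc ‖halfPow ε x‖ * |x| ≤ √(Real.pi / |x|) * |x| :=
        mul_le_mul_of_nonneg_right (norm_halfPow_le_of_ne hx ε) (abs_nonneg x)
    _ = √Real.pi * √|x| := by
        rw [Real.sqrt_div Real.pi_pos.le]
        nth_rewrite 2 [← Real.mul_self_sqrt (abs_nonneg x)]
        field_simp

/-- The bound is uniform in `ε`, although the half power alone blows up near `0` as `ε → 0`: the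
factor `x` absorbs the singularity, and `r` the growth at infinity. -/
lemma norm_halfPow_r_le {v w : ℂ} (hv : v.im ≠ 0) (hw : w.im ≠ 0) (ε x : ℝ) :
    ‖halfPow ε x * (x * r v w x)‖ ≤ √Real.pi * rBound v w := by
  rcases eq_or_ne x 0 with rfl | hx
  · have : 0 ≤ rBound v w := le_trans (by positivity) (one_add_abs_mul_norm_r_le hv hw 0)
    simp only [Complex.ofReal_zero, zero_mul, mul_zero, norm_zero]
    positivity
  · rw [norm_mul, norm_mul, Complex.norm_real, Real.norm_eq_abs, ← mul_assoc]
    calc ‖halfPow ε x‖ * |x| * ‖r v w x‖ ≤ √Real.pi * √|x| * ‖r v w x‖ :=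
          mul_le_mul_of_nonneg_right (norm_halfPow_mul_le hx ε) (norm_nonneg _)
      _ ≤ √Real.pi * (1 + |x|) * ‖r v w x‖ := by gcongr; exact sqrt_abs_le x
      _ ≤ _ := by rw [mul_assoc]; gcongr; exact one_add_abs_mul_norm_r_le hv hw x

lemma halfConst_ne_zero : halfConst ≠ 0 := Complex.exp_ne_zero _

lemma norm_mul_r_le {v w : ℂ} (hv : v.im ≠ 0) (hw : w.im ≠ 0) (x : ℝ) :
    ‖(x : ℂ) * r v w x‖ ≤ rBound v w := by
  refine le_trans ?_ (one_add_abs_mul_norm_r_le hv hw x)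
  rw [norm_mul, Complex.norm_real, Real.norm_eq_abs]
  gcongr
  linarith

lemma norm_r_le {v w : ℂ} (hv : v.im ≠ 0) (hw : w.im ≠ 0) (x : ℝ) : ‖r v w x‖ ≤ rBound v w := by
  refine le_trans ?_ (one_add_abs_mul_norm_r_le hv hw x)
  exact le_mul_of_one_le_left (norm_nonneg _) (by linarith [abs_nonneg x])

lemma measurable_mul_r (v w : ℂ) : Measurable fun x : ℝ => (x : ℂ) * r v w x := by
  unfold r; fun_prop

lemma mulOp_r_mem_algH {v w : ℂ} (hv : v.im < 0) (hw : w.im < 0) :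
    mulOp (r v w) (measurable_r v w) _ (norm_r_le hv.ne hw.ne) ∈ algH := by
  rw [mulOp_mul (measurable_cauchy v) (norm_inv_sub_le v hv.ne) (measurable_cauchy w)
    (norm_inv_sub_le w hw.ne) (measurable_r v w) (norm_r_le hv.ne hw.ne) (r_eq v w)]
  exact algH.mul_mem (mulOp_cauchy_mem_algH hv) (mulOp_cauchy_mem_algH hw)

lemma mulOp_mul_r_mem_algH {v w : ℂ} (hv : v.im < 0) (hw : w.im < 0) :
    mulOp (fun x : ℝ => (x : ℂ) * r v w x) (measurable_mul_r v w) _ (norm_mul_r_le hv.ne hw.ne)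
      ∈ algH := by
  -- Partial fractions: `x r_{v,w} = 1 / (x - w) + v r_{v,w}`.
  rw [mulOp_add_smul (measurable_cauchy w) (norm_inv_sub_le w hw.ne) (measurable_r v w)
    (norm_r_le hv.ne hw.ne) (measurable_mul_r v w) (norm_mul_r_le hv.ne hw.ne) v fun x => ?_]
  · exact algH.add_mem (mulOp_cauchy_mem_algH hw) (algH.smul_mem (mulOp_r_mem_algH hv hw) v)
  · have h1 := sub_ne_zero_of_im_ne_zero hv.ne x
    rw [r_eq]
    field_simp
    ring

lemma tendsto_halfPow_seq {x : ℝ} (hx : x ≠ 0) :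
    Tendsto (fun n : ℕ => halfPow (1 / ((n : ℝ) + 1)) x) atTop (𝓝 (halfConst * q x)) :=
  (tendsto_halfPow hx).comp tendsto_one_div_add_atTop_nhds_zero_nat

/-- Up to the constant `halfConst`, this is the bounded weak limit, as `ε → 0`, of products of the
half power with `x r_{v,w}`. -/
lemma mulOp_qxr_mem_algH {v w : ℂ} (hv : v.im < 0) (hw : w.im < 0) :
    mulOp (fun x : ℝ => q x * x * r v w x) (measurable_qxr v w) _ (norm_qxr_le hv.ne hw.ne)
      ∈ algH := by
  set T := mulOp (fun x : ℝ => q x * x * r v w x) (measurable_qxr v w) _ (norm_qxr_le hv.ne hw.ne)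
  have hT : halfConst • T ∈ Subalgebra.toSubmodule algH := by
    refine mem_of_tendsto_inner isClosed_algH
      (S := fun n : ℕ => mulOp (fun x : ℝ => halfPow (1 / ((n : ℝ) + 1)) x * (x * r v w x))
        ((measurable_halfPow _).mul (measurable_mul_r v w)) _ (norm_halfPow_r_le hv.ne hw.ne _))
      (C := √Real.pi * rBound v w) (fun n => ?_) (fun n => norm_mulOp_le _ _) fun f g => ?_
    · rw [mulOp_mul (measurable_halfPow _) (norm_halfPow_le (by positivity : 0 < 1 / ((n : ℝ) + 1)))
        (measurable_mul_r v w) (norm_mul_r_le hv.ne hw.ne) _ _ fun x => rfl]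
      exact algH.mul_mem (mulOp_halfPow_mem_algH (by positivity)) (mulOp_mul_r_mem_algH hv hw)
    · rw [smul_apply, inner_smul_right, inner_mulOp, ← integral_const_mul]
      simp only [inner_mulOp]
      refine tendsto_integral_of_dominated_convergence
        (fun x => (√Real.pi * rBound v w) * ‖starRingEnd ℂ (g x) * f x‖)
        (fun n => ((measurable_halfPow _).mul (measurable_mul_r v w)).aestronglyMeasurable.mul
          (integrable_conj_mul g f).1) ((integrable_conj_mul g f).norm.const_mul _)
        (fun n => Eventually.of_forall fun x => ?_) ?_
      · rw [norm_mul]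
        exact mul_le_mul_of_nonneg_right (norm_halfPow_r_le hv.ne hw.ne _ x) (norm_nonneg _)
      · filter_upwards [ae_ne_zero] with x hx
        have := ((tendsto_halfPow_seq hx).mul_const ((x : ℂ) * r v w x)).mul_const
          (starRingEnd ℂ (g x) * f x)
        rwa [show halfConst * q x * (x * r v w x) * (starRingEnd ℂ (g x) * f x)
          = halfConst * (q x * x * r v w x * (starRingEnd ℂ (g x) * f x)) by ring] at this
  have := algH.smul_mem hT halfConst⁻¹
  rwa [smul_smul, inv_mul_cancel₀ halfConst_ne_zero, one_smul] at this

/-! ### Annihilators of the functions `r` -/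

/-- Continuity in the pole is used once in each variable, the symmetry of the two Cauchy factors
exchanging their roles. Each step needs only one factor to bring `φ` into `L²`. -/
lemma integral_cauchy_mul_eq_zero_of_dense {φ : ℝ → ℂ} {D₁ D₂ : Set ℂ}
    (hφ : ∀ w : ℂ, w.im < 0 → MemLp (fun x : ℝ => φ x * ((x : ℂ) - w)⁻¹) 2 volume)
    (h₁ : {v : ℂ | v.im < 0} ⊆ closure (D₁ ∩ {v : ℂ | v.im < 0}))
    (h₂ : {v : ℂ | v.im < 0} ⊆ closure (D₂ ∩ {v : ℂ | v.im < 0}))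
    (h : ∀ v ∈ D₁, v.im < 0 → ∀ w ∈ D₂, w.im < 0 → ∫ x : ℝ, φ x * r v w x = 0)
    {w : ℂ} (hw : w.im < 0) : CauchyAnn fun x : ℝ => φ x * ((x : ℂ) - w)⁻¹ := by
  have h3 : ∀ w ∈ D₂, w.im < 0 → CauchyAnn fun x : ℝ => φ x * ((x : ℂ) - w)⁻¹ := fun w hw hw' =>
    cauchyAnn_of_dense (hφ w hw') h₁ fun v hv hv' => by
      rw [← h v hv hv' w hw hw']
      exact integral_congr_ae (Eventually.of_forall fun x => by simp only [r_eq]; ring)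
  refine cauchyAnn_of_dense (hφ w hw) h₂ fun w' hw' hw'' => ?_
  rw [← h3 w' hw' hw'' w hw]
  exact integral_congr_ae (Eventually.of_forall fun x => by simp only; ring)

/-- An `L²` function annihilating all products of two Cauchy kernels annihilates all Cauchy
kernels. -/
lemma cauchyAnn_of_integral_r {u : ℝ → ℂ} (hu : MemLp u 2 volume)
    (h : ∀ v : ℂ, v.im < 0 → ∀ w : ℂ, w.im < 0 → ∫ x : ℝ, u x * r v w x = 0) : CauchyAnn u := by
  intro v hv
  -- The second pole is sent to `-i∞`: the normalised factors `i(n+1) / (x + i(n+1))` have modulus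
  -- at most `1` and tend to `1`.
  have hw : ∀ n : ℕ, (-(((n : ℝ) + 1 : ℝ) * Complex.I)).im < 0 := fun n => by
    rw [Complex.neg_im, Complex.im_ofReal_mul, Complex.I_im, mul_one, neg_lt_zero]; positivity
  have h1 : Tendsto (fun n : ℕ => ∫ x : ℝ, (u x * ((x : ℂ) - v)⁻¹) *
      ((((n : ℝ) + 1 : ℝ) * Complex.I) * ((x : ℂ) - -(((n : ℝ) + 1 : ℝ) * Complex.I))⁻¹)) atTop
      (𝓝 (∫ x : ℝ, u x * ((x : ℂ) - v)⁻¹)) := by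
    refine tendsto_integral_of_dominated_convergence (fun x : ℝ => ‖u x * ((x : ℂ) - v)⁻¹‖)
      (fun n => (integrable_mul_cauchy hu hv.ne).1.mul
        (by fun_prop : Measurable _).aestronglyMeasurable)
      (integrable_mul_cauchy hu hv.ne).norm (fun n => Eventually.of_forall fun x => ?_)
      (Eventually.of_forall fun x => ?_)
    · rw [norm_mul]
      refine mul_le_of_le_one_right (norm_nonneg _) ?_
      have h2 := norm_inv_sub_le _ (hw n).ne x
      have h3 : 0 < (n : ℝ) + 1 := by positivity
      rw [norm_mul, norm_mul, Complex.norm_I, Complex.norm_real, mul_one, Real.norm_of_nonneg h3.le]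
      have h4 : |(-(((n : ℝ) + 1 : ℝ) * Complex.I)).im| = (n : ℝ) + 1 := by
        simp only [Complex.neg_im, Complex.im_ofReal_mul, Complex.I_im, mul_one, abs_neg]
        exact abs_of_pos h3
      rw [h4] at h2
      calc ((n : ℝ) + 1) * _ ≤ ((n : ℝ) + 1) * ((n : ℝ) + 1)⁻¹ := by gcongr
        _ = 1 := mul_inv_cancel₀ h3.ne'
    · have h2 : Tendsto (fun n : ℕ => (x : ℂ) / ((((n : ℝ) + 1 : ℝ) : ℂ) * Complex.I)) atTop (𝓝 0) := by
        have := (tendsto_one_div_add_atTop_nhds_zero_nat (𝕜 := ℝ))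
        have h3 := ((Complex.continuous_ofReal.tendsto 0).comp this).const_mul
          ((x : ℂ) * Complex.I⁻¹)
        rw [Complex.ofReal_zero, mul_zero] at h3
        refine h3.congr fun n => ?_
        simp only [Function.comp]
        have : (((n : ℝ) + 1 : ℝ) : ℂ) ≠ 0 := Complex.ofReal_ne_zero.2 (by positivity)
        push_cast at this ⊢
        field_simp
      have h3 := (((h2.add_const 1).inv₀ (by simp)).const_mul (u x * ((x : ℂ) - v)⁻¹))
      simp only [zero_add, inv_one, mul_one] at h3
      refine h3.congr fun n => ?_
      have h4 : (((n : ℝ) + 1 : ℝ) : ℂ) ≠ 0 := Complex.ofReal_ne_zero.2 (by positivity)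
      congr 1
      have h5 : (((n : ℝ) + 1 : ℝ) : ℂ) * Complex.I ≠ 0 := mul_ne_zero h4 Complex.I_ne_zero
      rw [div_add_one h5, inv_div, sub_neg_eq_add, div_eq_mul_inv]
  refine tendsto_nhds_unique h1 ?_
  have h2 : ∀ n : ℕ, ∫ x : ℝ, (u x * ((x : ℂ) - v)⁻¹) *
      ((((n : ℝ) + 1 : ℝ) * Complex.I) * ((x : ℂ) - -(((n : ℝ) + 1 : ℝ) * Complex.I))⁻¹) = 0 := by
    intro n
    have h3 := h v hv _ (hw n)
    have h4 := congrArg ((((n : ℝ) + 1 : ℝ) * Complex.I) * ·) h3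
    simp only [mul_zero] at h4
    rw [← integral_const_mul] at h4
    rw [← h4]
    refine integral_congr_ae (Eventually.of_forall fun x => ?_)
    simp only [r_eq]; ring
  simp only [h2]
  exact tendsto_const_nhds

lemma memLp_q_mul_cauchy {u : ℝ → ℂ} (hu : MemLp u 2 volume) {w : ℂ} (hw : w.im < 0) :
    MemLp (fun x : ℝ => u x * (q x * x) * ((x : ℂ) - w)⁻¹) 2 volume := by
  refine hu.of_le_mul (c := 1 + (1 + ‖w‖) * |w.im|⁻¹)
    ((hu.1.mul (measurable_q.mul (by fun_prop)).aestronglyMeasurable).mul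
      (measurable_cauchy w).aestronglyMeasurable) (Eventually.of_forall fun x => ?_)
  rw [mul_assoc, norm_mul, mul_comm]
  exact mul_le_mul_of_nonneg_right (norm_q_mul_inv_sub_le hw.ne x) (norm_nonneg _)

/-- The functions `z^{1/2} r_{v,w}` are total in `H²`. -/
lemma cauchyAnn_of_integral_qxr {u : ℝ → ℂ} (hu : MemLp u 2 volume) {D₁ D₂ : Set ℂ}
    (h₁ : {v : ℂ | v.im < 0} ⊆ closure (D₁ ∩ {v : ℂ | v.im < 0}))
    (h₂ : {v : ℂ | v.im < 0} ⊆ closure (D₂ ∩ {v : ℂ | v.im < 0}))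
    (h : ∀ v ∈ D₁, v.im < 0 → ∀ w ∈ D₂, w.im < 0 → ∫ x : ℝ, u x * (q x * x) * r v w x = 0) :
    CauchyAnn u := by
  refine cauchyAnn_of_integral_r hu fun v hv w hw => ?_
  have hm := memLp_q_mul_cauchy hu hw
  -- The function `u q x / (x - w)` is in `H²`. The half powers act on `H²` and converge to a
  -- multiple of `q`; as `q · q x = 1`, the limit removes the factor `q x`.
  have hH : hm.toLp _ ∈ H2 := by
    rw [mem_H2_iff]
    intro v' hv'
    rw [← integral_cauchy_mul_eq_zero_of_dense (fun w hw => memLp_q_mul_cauchy hu hw) h₁ h₂ h hw v' hv']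
    refine integral_congr_ae ?_
    filter_upwards [hm.coeFn_toLp] with x hx
    rw [hx]
  have hzero : ∀ n : ℕ, ∫ x : ℝ, halfPow (1 / ((n : ℝ) + 1)) x * (u x * (q x * x) * r v w x) = 0 := by
    intro n
    have hε : 0 < 1 / ((n : ℝ) + 1) := by positivity
    rw [← cauchyAnn_of_mem_H2 (mem_H2_of_mem_algH (mulOp_halfPow_mem_algH hε) hH) v hv]
    refine integral_congr_ae ?_
    filter_upwards [hm.coeFn_toLp, mulOp_apply (measurable_halfPow _) (norm_halfPow_le hε)
      (hm.toLp _)] with x h1 h2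
    rw [h2, h1, r_eq]; ring
  have hur : Integrable fun x : ℝ => u x * r v w x := by
    have h1 := (integrable_mul_cauchy hu hv.ne).mul_bdd (c := |w.im|⁻¹)
      (measurable_cauchy w).aestronglyMeasurable
      (Eventually.of_forall fun x => norm_inv_sub_le w hw.ne x)
    refine h1.congr (Eventually.of_forall fun x => ?_)
    simp only [r_eq]; ring
  have hlim : Tendsto (fun n : ℕ =>
      ∫ x : ℝ, halfPow (1 / ((n : ℝ) + 1)) x * (u x * (q x * x) * r v w x)) atTop
      (𝓝 (∫ x : ℝ, halfConst * (u x * r v w x))) := by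
    refine tendsto_integral_of_dominated_convergence (fun x : ℝ => √Real.pi * ‖u x * r v w x‖)
      (fun n => (measurable_halfPow _).aestronglyMeasurable.mul
        ((hu.1.mul (measurable_q.mul (by fun_prop)).aestronglyMeasurable).mul
          (measurable_r v w).aestronglyMeasurable))
      (hur.norm.const_mul _) (fun n => ?_) ?_
    · filter_upwards [ae_ne_zero] with x hx
      have h1 := norm_halfPow_mul_le hx (1 / ((n : ℝ) + 1))
      have h2 := norm_q hx
      have h3 := Real.sqrt_pos.2 (abs_pos.2 hx)
      have e : halfPow (1 / ((n : ℝ) + 1)) x * (u x * (q x * x) * r v w x)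
          = (halfPow (1 / ((n : ℝ) + 1)) x * x) * q x * (u x * r v w x) := by ring
      rw [e, norm_mul]
      refine mul_le_mul_of_nonneg_right ?_ (norm_nonneg _)
      rw [norm_mul, norm_mul, Complex.norm_real, Real.norm_eq_abs, h2]
      rw [← div_eq_mul_inv, div_le_iff₀ h3]
      exact h1
    · filter_upwards [ae_ne_zero] with x hx
      have h1 := (tendsto_halfPow_seq hx).mul_const (u x * (q x * x) * r v w x)
      have e : halfConst * q x * (u x * (q x * x) * r v w x) = halfConst * (u x * r v w x) := by
        linear_combination (halfConst * u x * r v w x) * q_sq_mul hx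
      rwa [e] at h1
  simp only [hzero] at hlim
  have h1 := tendsto_nhds_unique tendsto_const_nhds hlim
  rw [integral_const_mul] at h1
  exact (mul_eq_zero.1 h1.symm).resolve_left halfConst_ne_zero

/-! ### Orthogonality in the weighted space -/

lemma integral_muV (f : ℝ → ℂ) : ∫ x, f x ∂muV = ∫ x : ℝ, ((|x| : ℝ) : ℂ) * f x := by
  rw [muV, integral_withDensity_eq_integral_toReal_smul (by fun_prop)
    (Eventually.of_forall fun _ => ENNReal.ofReal_lt_top)]
  refine integral_congr_ae (Eventually.of_forall fun x => ?_)
  simp only [ENNReal.toReal_ofReal (abs_nonneg x), Complex.real_smul]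

lemma memLp_of_memLp_muV {f g : ℝ → ℂ} (hf : MemLp f 2 muV) (hg : Measurable g)
    (h : ∀ x : ℝ, x ≠ 0 → ‖g x‖ ^ 2 = |x| * ‖f x‖ ^ 2) : MemLp g 2 volume := by
  rw [memLp_two_iff_integrable_sq_norm hg.aestronglyMeasurable]
  have h1 := (memLp_two_iff_integrable_sq_norm hf.1).1 hf
  rw [muV, integrable_withDensity_iff (by fun_prop)
    (Eventually.of_forall fun _ => ENNReal.ofReal_lt_top)] at h1
  refine h1.congr ?_
  filter_upwards [ae_ne_zero] with x hx
  rw [h x hx, ENNReal.toReal_ofReal (abs_nonneg x), mul_comm]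

lemma lowerHalfQ_dense : {v : ℂ | v.im < 0} ⊆ closure (lowerHalfQ ∩ {v : ℂ | v.im < 0}) := by
  intro v hv
  rw [Metric.mem_closure_iff]
  intro ε hε
  have hv' : v.im < 0 := hv
  obtain ⟨a, ha1, ha2⟩ := exists_rat_btwn (show v.re < v.re + ε / 2 by linarith)
  obtain ⟨b, hb1, hb2⟩ := exists_rat_btwn (show v.im < min 0 (v.im + ε / 2) by
    exact lt_min hv' (by linarith))
  have hb3 := hb2.trans_le (min_le_left _ _)
  have hb4 := hb2.trans_le (min_le_right _ _)
  refine ⟨⟨a, b⟩, ⟨⟨hb3, ⟨a, rfl⟩, ⟨b, rfl⟩⟩, hb3⟩, ?_⟩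
  rw [dist_eq_norm]
  refine (Complex.norm_le_abs_re_add_abs_im _).trans_lt ?_
  simp only [Complex.sub_re, Complex.sub_im]
  rw [abs_sub_comm, abs_of_pos (by linarith), abs_sub_comm, abs_of_pos (by linarith)]
  linarith

lemma countable_lowerHalfQ : lowerHalfQ.Countable := by
  refine (Set.countable_range fun p : ℚ × ℚ => (⟨p.1, p.2⟩ : ℂ)).mono ?_
  rintro v ⟨_, ⟨a, ha⟩, ⟨b, hb⟩⟩
  exact ⟨(a, b), Complex.ext ha.symm hb.symm⟩

/-- A function annihilating all `r_{v,w}` lies in `V`, in the sense that it is orthogonal to every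
function that is orthogonal to `V`. -/
lemma integral_conj_mul_muV_eq_zero {F E : ℝ → ℂ} (hF : Measurable F) (hE : Measurable E)
    (hF2 : MemLp F 2 muV) (hE2 : MemLp E 2 muV) {D₁ D₂ : Set ℂ}
    (h₁ : {v : ℂ | v.im < 0} ⊆ closure (D₁ ∩ {v : ℂ | v.im < 0}))
    (h₂ : {v : ℂ | v.im < 0} ⊆ closure (D₂ ∩ {v : ℂ | v.im < 0}))
    (hFr : ∀ v ∈ D₁, v.im < 0 → ∀ w ∈ D₂, w.im < 0 → ∫ x, F x * r v w x ∂muV = 0)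
    (hEr : ∀ v ∈ lowerHalfQ, ∀ w ∈ lowerHalfQ, ∫ x, starRingEnd ℂ (E x) * qr v w x ∂muV = 0) :
    ∫ x, starRingEnd ℂ (E x) * F x ∂muV = 0 := by
  -- The factors have modulus `√|x|`, so both functions are in unweighted `L²`. Testing `u` against
  -- `q x r` tests `F` against `r` in the weight `|x|`, testing `e` against `r` tests `conj E`
  -- against `q̄ r`, and `e u = conj(E) F |x|`.
  set u : ℝ → ℂ := fun x => F x * (q x * |x|) with hu
  set e : ℝ → ℂ := fun x => starRingEnd ℂ (E x) * (starRingEnd ℂ (q x) * |x|) with he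
  have hq := measurable_q
  have hum : Measurable u := by fun_prop
  have hconj : Measurable (starRingEnd ℂ) := Complex.continuous_conj.measurable
  have hem : Measurable e := by
    exact (hconj.comp hE).mul ((hconj.comp hq).mul (by fun_prop))
  have hnorm : ∀ x : ℝ, x ≠ 0 → ‖q x‖ ^ 2 * |x| ^ 2 = |x| := fun x hx => by
    rw [pow_two |x|, ← mul_assoc, norm_q_sq hx, one_mul]
  have hu2 : MemLp u 2 volume := memLp_of_memLp_muV hF2 hum fun x hx => by
    rw [hu]
    simp only [norm_mul, mul_pow, Complex.norm_real, Real.norm_eq_abs, abs_abs]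
    rw [hnorm x hx, mul_comm]
  have he2 : MemLp e 2 volume := memLp_of_memLp_muV hE2 hem fun x hx => by
    rw [he]
    simp only [norm_mul, mul_pow, Complex.norm_real, Real.norm_eq_abs, abs_abs, RCLike.norm_conj]
    rw [hnorm x hx, mul_comm]
  have huA : CauchyAnn u := cauchyAnn_of_integral_qxr hu2 h₁ h₂ fun v hv hv' w hw hw' => by
    rw [← hFr v hv hv' w hw hw', integral_muV]
    refine integral_congr_ae ?_
    filter_upwards [ae_ne_zero] with x hx
    rw [hu]
    simp only
    linear_combination (F x * (|x| : ℝ) * r v w x) * q_sq_mul hx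
  have heA : CauchyAnn e := by
    refine cauchyAnn_of_integral_r he2 fun v hv w hw => ?_
    have h3 : ∀ w : ℂ, w.im < 0 → MemLp (fun x : ℝ => e x * ((x : ℂ) - w)⁻¹) 2 volume := fun w hw =>
      he2.of_le_mul (c := |w.im|⁻¹) (he2.1.mul (measurable_cauchy w).aestronglyMeasurable)
        (Eventually.of_forall fun x => by
          rw [norm_mul, mul_comm]
          exact mul_le_mul_of_nonneg_right (norm_inv_sub_le w hw.ne x) (norm_nonneg _))
    have h4 := integral_cauchy_mul_eq_zero_of_dense (w := w) h3 lowerHalfQ_dense lowerHalfQ_dense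
      (fun v hv _ w hw _ => by
        rw [← hEr v hv w hw, integral_muV]
        refine integral_congr_ae (Eventually.of_forall fun x => ?_)
        simp only [he, qr]; ring) hw v hv
    rw [← h4]
    refine integral_congr_ae (Eventually.of_forall fun x => ?_)
    simp only [r_eq]; ring
  have heH : he2.toLp e ∈ H2 := by
    rw [mem_H2_iff]
    intro v hv
    rw [← heA v hv]
    refine integral_congr_ae ?_
    filter_upwards [he2.coeFn_toLp] with x hx
    rw [hx]
  have huH : hu2.toLp u ∈ H2 := by
    rw [mem_H2_iff]
    intro v hv
    rw [← huA v hv]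
    refine integral_congr_ae ?_
    filter_upwards [hu2.coeFn_toLp] with x hx
    rw [hx]
  rw [← integral_mul_eq_zero_of_mem_H2 heH huH, integral_muV]
  refine integral_congr_ae ?_
  filter_upwards [ae_ne_zero, hu2.coeFn_toLp, he2.coeFn_toLp] with x hx h3 h4
  rw [h3, h4, hu, he]
  simp only
  linear_combination -(starRingEnd ℂ (E x) * F x * (|x| : ℝ)) * conj_q_mul_q hx

/-! ### Kernels and Hilbert–Schmidt operators -/

lemma memLp_prod_mul {α β : Type} [MeasurableSpace α] [MeasurableSpace β] {μ : Measure α}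
    {ν : Measure β} [SFinite μ] [SFinite ν] {g : α → ℂ} {f : β → ℂ} (hg : MemLp g 2 μ)
    (hf : MemLp f 2 ν) : MemLp (fun p : α × β => g p.1 * f p.2) 2 (μ.prod ν) := by
  have hm : AEStronglyMeasurable (fun p : α × β => g p.1 * f p.2) (μ.prod ν) :=
    hg.1.comp_fst.mul hf.1.comp_snd
  rw [memLp_two_iff_integrable_sq_norm hm]
  simp_rw [norm_mul, mul_pow]
  exact ((memLp_two_iff_integrable_sq_norm hg.1).1 hg).mul_prod
    ((memLp_two_iff_integrable_sq_norm hf.1).1 hf)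

lemma memLp_conj {α : Type} [MeasurableSpace α] {μ : Measure α} {f : α → ℂ} (hf : MemLp f 2 μ) :
    MemLp (fun x => starRingEnd ℂ (f x)) 2 μ :=
  hf.star

/-- The kernel `g(x) conj (f(y))` of the rank one operator `h ↦ ⟨f, h⟩ g`. -/
noncomputable def rankOneKer (g f : L2R) : L2R2 :=
  (memLp_prod_mul (Lp.memLp g) (memLp_conj (Lp.memLp f))).toLp _

lemma rankOneKer_apply (g f : L2R) :
    rankOneKer g f =ᵐ[volume] fun p : ℝ × ℝ => g p.1 * starRingEnd ℂ (f p.2) :=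
  (memLp_prod_mul (Lp.memLp g) (memLp_conj (Lp.memLp f))).coeFn_toLp

lemma conj_rankOneKer_mul (g f : L2R) (k : L2R2) :
    (fun p : ℝ × ℝ => inner ℂ (rankOneKer g f p) (k p))
      =ᵐ[volume] fun p => starRingEnd ℂ (g p.1) * (k p * f p.2) := by
  filter_upwards [rankOneKer_apply g f] with p hp
  rw [hp]
  simp
  ring

/-- Fubini turns matrix coefficients of `Int k` into inner products of `k` with rank one kernels,
which transfers the Hilbert–Schmidt theory to `L²(ℝ²)`. -/
lemma inner_intOp (k : L2R2) (f g : L2R) :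
    inner ℂ g (intOp k f) = inner ℂ (rankOneKer g f) k := by
  have hint : Integrable (fun p : ℝ × ℝ => starRingEnd ℂ (g p.1) * (k p * f p.2))
      ((volume : Measure ℝ).prod volume) :=
    (L2.integrable_inner (rankOneKer g f) k).congr (conj_rankOneKer_mul g f k)
  rw [inner_eq_integral, L2.inner_def, integral_congr_ae (conj_rankOneKer_mul g f k)]
  refine Eq.trans ?_ (integral_prod _ hint).symm
  refine integral_congr_ae ?_
  filter_upwards [intOp_apply k f] with x hx
  rw [hx, ← integral_const_mul]

lemma inner_rankOneKer (g f g' f' : L2R) :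
    inner ℂ (rankOneKer g f) (rankOneKer g' f') = inner ℂ g g' * inner ℂ f' f := by
  rw [L2.inner_def, integral_congr_ae (conj_rankOneKer_mul g f _), inner_eq_integral,
    inner_eq_integral, ← integral_prod_mul]
  refine integral_congr_ae ?_
  filter_upwards [rankOneKer_apply g' f'] with p hp
  rw [hp]; ring

lemma eq_of_forall_inner {S T : L2R →L[ℂ] L2R} (h : ∀ f g : L2R, inner ℂ g (S f) = inner ℂ g (T f)) :
    S = T := by
  ext1 f
  exact ext_inner_left ℂ fun g => h f g

lemma norm_rankOneKer_sq (g f : L2R) : ‖rankOneKer g f‖ ^ 2 = ‖g‖ ^ 2 * ‖f‖ ^ 2 := by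
  have := inner_rankOneKer g f g f
  simp only [inner_self_eq_norm_sq_to_K] at this
  exact_mod_cast this

lemma orthogonalFamily_rankOneKer {ι : Type} {e : ι → L2R} (he : Orthonormal ℂ e) (g : ι → L2R) :
    OrthogonalFamily ℂ (fun i => (ℂ ∙ rankOneKer (g i) (e i) : Submodule ℂ L2R2))
      fun i => (ℂ ∙ rankOneKer (g i) (e i)).subtypeₗᵢ := by
  intro i j hij x y
  obtain ⟨a, ha⟩ := Submodule.mem_span_singleton.1 x.2
  obtain ⟨b, hb⟩ := Submodule.mem_span_singleton.1 y.2
  change inner ℂ (x : L2R2) (y : L2R2) = 0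
  rw [← ha, ← hb, inner_smul_left, inner_smul_right, inner_rankOneKer, he.2 hij.symm, mul_zero,
    mul_zero, mul_zero]

lemma norm_rankOneKer_sq_of_orthonormal {ι : Type} {e : ι → L2R} (he : Orthonormal ℂ e) (g : L2R)
    (i : ι) : ‖rankOneKer g (e i)‖ ^ 2 = ‖g‖ ^ 2 := by
  rw [norm_rankOneKer_sq, he.1 i, one_pow, mul_one]

lemma norm_sum_rankOneKer_sq {ι : Type} {e : ι → L2R} (he : Orthonormal ℂ e) (g : ι → L2R)
    (s : Finset ι) : ‖∑ i ∈ s, rankOneKer (g i) (e i)‖ ^ 2 = ∑ i ∈ s, ‖g i‖ ^ 2 := by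
  classical
  have h : inner ℂ (∑ i ∈ s, rankOneKer (g i) (e i)) (∑ i ∈ s, rankOneKer (g i) (e i))
      = ((∑ i ∈ s, ‖g i‖ ^ 2 : ℝ) : ℂ) := by
    rw [sum_inner, Complex.ofReal_sum]
    refine Finset.sum_congr rfl fun i hi => ?_
    rw [inner_sum, Finset.sum_eq_single i]
    · rw [inner_self_eq_norm_sq_to_K, ← norm_rankOneKer_sq_of_orthonormal he (g i) i]
      push_cast; rfl
    · intro j _ hj
      rw [inner_rankOneKer, he.2 hj, mul_zero]
    · exact fun h => absurd hi h
  rw [inner_self_eq_norm_sq_to_K] at h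
  exact Complex.ofReal_injective ((Complex.ofReal_pow _ _).trans h)

/-- Hilbert–Schmidt operators are integral operators. -/
lemma exists_intOp_of_mem_C2 {T : L2R →L[ℂ] L2R} (hT : T ∈ C2) : ∃ k : L2R2, T = intOp k := by
  obtain ⟨ι, e, hs⟩ := hT
  set k : ι → L2R2 := fun i => rankOneKer (T (e i)) (e i) with hk
  -- The kernels of the rank one pieces `h ↦ ⟨eᵢ, h⟩ T eᵢ` are mutually orthogonal with norms `‖T
  -- eᵢ‖`, so square summability suffices.
  have hsum : Summable k := by
    refine ((orthogonalFamily_rankOneKer e.orthonormal fun i => T (e i)).summable_iff_norm_sq_summable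
      fun i => ⟨k i, Submodule.mem_span_singleton_self _⟩).2 ?_
    refine hs.congr fun i => ?_
    exact (norm_rankOneKer_sq_of_orthonormal e.orthonormal _ i).symm
  refine ⟨∑' i, k i, eq_of_forall_inner fun f g => ?_⟩
  rw [inner_intOp]
  have h1 : HasSum (fun i => inner ℂ (rankOneKer g f) (k i)) (inner ℂ (rankOneKer g f) (∑' i, k i)) :=
    hsum.hasSum.mapL (innerSL ℂ (rankOneKer g f))
  have h2 : HasSum (fun i => inner ℂ g (T (e.repr f i • e i))) (inner ℂ g (T f)) :=
    ((e.hasSum_repr f).mapL T).mapL (innerSL ℂ g)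
  have h3 : (fun i => inner ℂ g (T (e.repr f i • e i))) = fun i => inner ℂ (rankOneKer g f) (k i) := by
    funext i
    rw [map_smul, inner_smul_right, hk]
    simp only
    rw [inner_rankOneKer, e.repr_apply_apply, mul_comm]
  rw [h3] at h2
  exact h2.unique h1

/-- If `S` is the sum on the left, the finite-rank kernel built from the vectors `Int k bᵢ` has
squared norm `S` and inner product `S` with `k`; Cauchy–Schwarz gives `S² ≤ S ‖k‖²`. -/
lemma sum_norm_intOp_sq_le (k : L2R2) {ι : Type} {b : ι → L2R} (hb : Orthonormal ℂ b)
    (s : Finset ι) : ∑ i ∈ s, ‖intOp k (b i)‖ ^ 2 ≤ ‖k‖ ^ 2 := by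
  set S := ∑ i ∈ s, ‖intOp k (b i)‖ ^ 2 with hS
  have h1 : ‖∑ i ∈ s, rankOneKer (intOp k (b i)) (b i)‖ ^ 2 = S := by
    exact norm_sum_rankOneKer_sq hb _ s
  have h2 : inner ℂ (∑ i ∈ s, rankOneKer (intOp k (b i)) (b i)) k = (S : ℂ) := by
    rw [sum_inner, hS, Complex.ofReal_sum]
    refine Finset.sum_congr rfl fun i _ => ?_
    rw [← inner_intOp, inner_self_eq_norm_sq_to_K]
    exact (Complex.ofReal_pow _ _).symm
  have h3 := norm_inner_le_norm (𝕜 := ℂ) (∑ i ∈ s, rankOneKer (intOp k (b i)) (b i)) k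
  have hS0 : 0 ≤ S := Finset.sum_nonneg fun i _ => sq_nonneg _
  rw [h2, Complex.norm_real, Real.norm_of_nonneg hS0] at h3
  have h4 : S ^ 2 ≤ S * ‖k‖ ^ 2 := by
    calc S ^ 2 ≤ (‖∑ i ∈ s, rankOneKer (intOp k (b i)) (b i)‖ * ‖k‖) ^ 2 := pow_le_pow_left₀ hS0 h3 2
      _ = S * ‖k‖ ^ 2 := by rw [mul_pow, h1]
  rcases hS0.eq_or_lt with h | h
  · rw [← h]; positivity
  · rw [pow_two] at h4
    exact le_of_mul_le_mul_left h4 h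

lemma intOp_mem_C2 (k : L2R2) : intOp k ∈ C2 := by
  obtain ⟨w, b, -⟩ := exists_hilbertBasis ℂ L2R
  exact ⟨w, b, summable_of_sum_le (fun i => sq_nonneg _) (sum_norm_intOp_sq_le k b.orthonormal)⟩

lemma norm_intOp_le (k : L2R2) : ‖intOp k‖ ≤ ‖k‖ := by
  unfold intOp
  exact LinearMap.mkContinuous_norm_le _ (norm_nonneg _) _

/-! ### The operators `Int k_F` -/

lemma kerFun_eq_indicator (F : ℝ × ℝ → ℂ) :
    (fun p : ℝ × ℝ => kerFun F p.1 p.2) =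
      cone.indicator (F ∘ fun p : ℝ × ℝ => (p.1, Real.log (p.2 / p.1))) := by
  ext p
  by_cases hp : 0 < p.1 * p.2 ∧ 0 ≤ Real.log (p.2 / p.1)
  · rw [kerFun, if_pos hp, Set.indicator_of_mem (show p ∈ cone from hp)]
    rfl
  · rw [kerFun, if_neg hp, Set.indicator_of_notMem (show p ∉ cone from hp)]

lemma ker_apply (F : Lp ℂ 2 (muV.prod muW)) :
    ker F =ᵐ[volume] cone.indicator (F ∘ fun p : ℝ × ℝ => (p.1, Real.log (p.2 / p.1))) := by
  rw [← kerFun_eq_indicator]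
  exact (memLp_kerFun F).coeFn_toLp

lemma norm_ker (F : Lp ℂ 2 (muV.prod muW)) : ‖ker F‖ = ‖F‖ := by
  rw [Lp.norm_def, Lp.norm_def, eLpNorm_congr_ae (ker_apply F),
    eLpNorm_indicator_eq_eLpNorm_restrict measurableSet_cone,
    eLpNorm_comp_measurePreserving (Lp.aestronglyMeasurable F) measurePreserving_cone]

lemma mul_exp_log_div {p : ℝ × ℝ} (hp : p ∈ cone) : p.1 * Real.exp (Real.log (p.2 / p.1)) = p.2 := by
  have h1 : p.1 ≠ 0 := fun h => by have := hp.1; simp [h] at this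
  have h2 : 0 < p.2 / p.1 := by
    have : p.2 / p.1 = p.1 * p.2 / p.1 ^ 2 := by field_simp
    rw [this]
    have := hp.1
    positivity
  rw [Real.exp_log h2]
  field_simp

/-- The sesquilinear form of `Int k_F` in the coordinates `(x, t)` with `y = e^t x`. -/
lemma inner_intOp_ker (F : Lp ℂ 2 (muV.prod muW)) {f g : L2R} {f' g' : ℝ → ℂ}
    (hf : f =ᵐ[volume] f') (hf' : Measurable f') (hg : g =ᵐ[volume] g') (hg' : Measurable g') :
    Integrable (fun p : ℝ × ℝ => starRingEnd ℂ (g' p.1) * (F p * f' (p.1 * Real.exp p.2)))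
        (muV.prod muW) ∧
      inner ℂ g (intOp (ker F) f)
        = ∫ p : ℝ × ℝ, starRingEnd ℂ (g' p.1) * (F p * f' (p.1 * Real.exp p.2)) ∂(muV.prod muW) := by
  set H : ℝ × ℝ → ℂ := fun p => starRingEnd ℂ (g' p.1) * (F p * f' (p.1 * Real.exp p.2)) with hH
  have hFm : Measurable F := (Lp.stronglyMeasurable F).measurable
  have hconj : Measurable (starRingEnd ℂ) := Complex.continuous_conj.measurable
  have hHm : Measurable H := by
    exact (hconj.comp (hg'.comp measurable_fst)).mul
      (hFm.mul (hf'.comp (by fun_prop)))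
  have hfst : ∀ᵐ p : ℝ × ℝ, g p.1 = g' p.1 :=
    Measure.quasiMeasurePreserving_fst.ae hg
  have hsnd : ∀ᵐ p : ℝ × ℝ, f p.2 = f' p.2 :=
    Measure.quasiMeasurePreserving_snd.ae hf
  have h1 : (fun p : ℝ × ℝ => inner ℂ (rankOneKer g f p) (ker F p)) =ᵐ[volume]
      cone.indicator (H ∘ fun p : ℝ × ℝ => (p.1, Real.log (p.2 / p.1))) := by
    filter_upwards [conj_rankOneKer_mul g f (ker F), ker_apply F, hfst, hsnd] with p h1 h2 h3 h4
    rw [h1, h2, h3, h4]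
    by_cases hp : p ∈ cone
    · rw [Set.indicator_of_mem hp, Set.indicator_of_mem hp]
      simp only [Function.comp, hH, mul_exp_log_div hp]
    · rw [Set.indicator_of_notMem hp, Set.indicator_of_notMem hp, zero_mul, mul_zero]
  constructor
  · have h2 := (L2.integrable_inner (𝕜 := ℂ) (rankOneKer g f) (ker F)).congr h1
    rw [integrable_indicator_iff measurableSet_cone] at h2
    exact (measurePreserving_cone.integrable_comp hHm.aestronglyMeasurable).1 h2
  · rw [inner_intOp, L2.inner_def, integral_congr_ae h1, integral_indicator measurableSet_cone,
      ← measurePreserving_cone.map_eq, integral_map measurePreserving_cone.measurable.aemeasurable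
        hHm.aestronglyMeasurable]
    rfl

/-- `F ↦ Int k_F` as a continuous linear map. -/
noncomputable def intKer : Lp ℂ 2 (muV.prod muW) →L[ℂ] (L2R →L[ℂ] L2R) :=
  LinearMap.mkContinuous
    { toFun := fun F => intOp (ker F)
      map_add' := fun F G => eq_of_forall_inner fun f g => by
        have hf : Measurable f := (Lp.stronglyMeasurable f).measurable
        have hg : Measurable g := (Lp.stronglyMeasurable g).measurable
        have h1 := inner_intOp_ker F (f := f) (g := g) EventuallyEq.rfl hf EventuallyEq.rfl hg
        have h2 := inner_intOp_ker G (f := f) (g := g) EventuallyEq.rfl hf EventuallyEq.rfl hg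
        rw [add_apply, inner_add_right, h1.2, h2.2, ← integral_add h1.1 h2.1,
          (inner_intOp_ker (F + G) EventuallyEq.rfl hf EventuallyEq.rfl hg).2]
        refine integral_congr_ae ?_
        filter_upwards [Lp.coeFn_add F G] with p hp
        rw [hp, Pi.add_apply]; ring
      map_smul' := fun c F => eq_of_forall_inner fun f g => by
        have hf : Measurable f := (Lp.stronglyMeasurable f).measurable
        have hg : Measurable g := (Lp.stronglyMeasurable g).measurable
        rw [RingHom.id_apply, smul_apply, inner_smul_right,
          (inner_intOp_ker F EventuallyEq.rfl hf EventuallyEq.rfl hg).2, ← integral_const_mul,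
          (inner_intOp_ker (c • F) EventuallyEq.rfl hf EventuallyEq.rfl hg).2]
        refine integral_congr_ae ?_
        filter_upwards [Lp.coeFn_smul c F] with p hp
        rw [hp, Pi.smul_apply, smul_eq_mul]; ring }
    1 (fun F => by
      rw [one_mul]
      exact (norm_intOp_le _).trans (norm_ker F).le)

lemma isClosed_coe_algH : IsClosed (algH : Set (L2R →L[ℂ] L2R)) := by
  refine IsSeqClosed.isClosed fun S T hS hT => ?_
  obtain ⟨C, hC⟩ := hT.norm.bddAbove_range
  refine mem_of_tendsto_inner (A := Subalgebra.toSubmodule algH) isClosed_algH hS (C := C)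
    (fun n => hC ⟨n, rfl⟩) fun f g => ?_
  have h : Continuous fun R : L2R →L[ℂ] L2R => inner ℂ g (R f) := by fun_prop
  exact (h.tendsto T).comp hT

/-! ### The operators `Int k_F`, `F ∈ V ⊗ W`, belong to the hyperbolic algebra -/

lemma norm_dil_le (t : ℝ) : ‖dil t‖ ≤ 1 := by
  have h : ‖dil t‖ ≤ Real.exp (t / 2) *
      ((ENNReal.ofReal |(Real.exp t)⁻¹|) ^ (1 / (2 : ℝ≥0∞)).toReal).toReal := by
    unfold dil
    exact LinearMap.mkContinuous_norm_le _ (by positivity) _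
  refine h.trans (le_of_eq ?_)
  rw [← ENNReal.toReal_rpow, ENNReal.toReal_ofReal (abs_nonneg _), abs_of_pos (by positivity),
    ← Real.exp_neg, ← Real.exp_mul, ← Real.exp_add]
  simp
  ring

lemma ae_muW_nonneg : ∀ᵐ t ∂muW, 0 ≤ t := by
  have h : ∀ᵐ t ∂(volume.restrict (Set.Ici (0 : ℝ))), 0 ≤ t :=
    (ae_restrict_mem measurableSet_Ici).mono fun t ht => ht
  exact (withDensity_absolutelyContinuous _ _).ae_le h

lemma inner_mulOp_dil {m : ℝ → ℂ} (hm : Measurable m) {C : ℝ} (hC : ∀ x, ‖m x‖ ≤ C) (t : ℝ)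
    (f g : L2R) : inner ℂ g ((mulOp m hm C hC * dil t) f)
      = Real.exp (t / 2) * ∫ x : ℝ, m x * (starRingEnd ℂ (g x) * f (x * Real.exp t)) := by
  rw [mul_apply_eq_comp, inner_mulOp, ← integral_const_mul]
  refine integral_congr_ae ?_
  filter_upwards [dil_apply t f] with x hx
  rw [hx, mul_comm x]
  ring

/-- The tensor `h ⊗ φ`. -/
noncomputable def tens (h : Lp ℂ 2 muV) (φ : W) : Lp ℂ 2 (muV.prod muW) :=
  (memLp_tens h φ).toLp fun p : ℝ × ℝ => h p.1 * φ p.2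

lemma tens_apply (h : Lp ℂ 2 muV) (φ : W) :
    tens h φ =ᵐ[muV.prod muW] fun p : ℝ × ℝ => h p.1 * φ p.2 :=
  (memLp_tens h φ).coeFn_toLp

lemma norm_tens (h : Lp ℂ 2 muV) (φ : W) : ‖tens h φ‖ = ‖h‖ * ‖φ‖ := by
  rw [Lp.norm_def, Lp.norm_def, Lp.norm_def, ← ENNReal.toReal_mul, eLpNorm_congr_ae (tens_apply h φ)]
  congr 1
  refine (ENNReal.pow_right_strictMono two_ne_zero).injective ?_
  simp only [mul_pow, eLpNorm_two_sq, enorm_mul]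
  exact lintegral_prod_mul ((Lp.aestronglyMeasurable h).enorm.pow_const 2)
    ((Lp.aestronglyMeasurable φ).enorm.pow_const 2)

/-- `h ↦ h ⊗ φ` as a continuous linear map. -/
noncomputable def tensL (φ : W) : Lp ℂ 2 muV →L[ℂ] Lp ℂ 2 (muV.prod muW) :=
  LinearMap.mkContinuous
    { toFun := fun h => tens h φ
      map_add' := fun h h' => by
        refine Lp.ext ?_
        filter_upwards [tens_apply (h + h') φ, tens_apply h φ, tens_apply h' φ,
          Lp.coeFn_add (tens h φ) (tens h' φ),
          Measure.quasiMeasurePreserving_fst.ae (Lp.coeFn_add h h')] with p h1 h2 h3 h4 h5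
        rw [h4, h1, Pi.add_apply, h2, h3, h5, Pi.add_apply, add_mul]
      map_smul' := fun c h => by
        refine Lp.ext ?_
        filter_upwards [tens_apply (c • h) φ, tens_apply h φ, Lp.coeFn_smul c (tens h φ),
          Measure.quasiMeasurePreserving_fst.ae (Lp.coeFn_smul c h)] with p h1 h2 h3 h4
        rw [RingHom.id_apply, h3, h1, Pi.smul_apply, h2, h4, Pi.smul_apply, smul_eq_mul,
          smul_eq_mul, mul_assoc] }
    ‖φ‖ fun h => by
      rw [mul_comm]; exact (norm_tens h φ).le

/-- `φ ↦ h ⊗ φ` as a continuous linear map. -/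
noncomputable def tensR (h : Lp ℂ 2 muV) : W →L[ℂ] Lp ℂ 2 (muV.prod muW) :=
  LinearMap.mkContinuous
    { toFun := fun φ => tens h φ
      map_add' := fun φ φ' => by
        refine Lp.ext ?_
        filter_upwards [tens_apply h (φ + φ'), tens_apply h φ, tens_apply h φ',
          Lp.coeFn_add (tens h φ) (tens h φ'),
          Measure.quasiMeasurePreserving_snd.ae (Lp.coeFn_add φ φ')] with p h1 h2 h3 h4 h5
        rw [h4, h1, Pi.add_apply, h2, h3, h5, Pi.add_apply, mul_add]
      map_smul' := fun c φ => by
        refine Lp.ext ?_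
        filter_upwards [tens_apply h (c • φ), tens_apply h φ, Lp.coeFn_smul c (tens h φ),
          Measure.quasiMeasurePreserving_snd.ae (Lp.coeFn_smul c φ)] with p h1 h2 h3 h4
        rw [RingHom.id_apply, h3, h1, Pi.smul_apply, h2, h4, Pi.smul_apply, smul_eq_mul,
          smul_eq_mul, mul_left_comm] }
    ‖h‖ fun φ => (norm_tens h φ).le

/-- The closed subspace of those `F` for which `Int k_F` is in the hyperbolic algebra. -/
noncomputable def goodKernels : Submodule ℂ (Lp ℂ 2 (muV.prod muW)) :=
  (Subalgebra.toSubmodule algH).comap intKer.toLinearMap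

lemma mem_goodKernels {F : Lp ℂ 2 (muV.prod muW)} : F ∈ goodKernels ↔ intOp (ker F) ∈ algH :=
  Iff.rfl

lemma isClosed_goodKernels : IsClosed (goodKernels : Set (Lp ℂ 2 (muV.prod muW))) :=
  isClosed_coe_algH.preimage intKer.continuous

/-- Fubini and `q̄ |x| = q x` identify the operator with `∫ e^{-t/2} φ(t) M_{q x r} V_t dμ_W(t)`;
the factor `e^{-t/2}` cancels the normalisation of `V_t`. Integrability of `φ` is an extra
assumption because `μ_W` is infinite. -/
lemma tens_qr_mem_goodKernels {v w : ℂ} (hv : v.im < 0) (hw : w.im < 0) {φ : W}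
    (hφ : Integrable φ muW) : tens ((memLp_qr hv hw).toLp (qr v w)) φ ∈ goodKernels := by
  rw [mem_goodKernels]
  set F := tens ((memLp_qr hv hw).toLp (qr v w)) φ with hF
  have hFae : F =ᵐ[muV.prod muW] fun p : ℝ × ℝ => qr v w p.1 * φ p.2 := by
    filter_upwards [tens_apply ((memLp_qr hv hw).toLp (qr v w)) φ,
      Measure.quasiMeasurePreserving_fst.ae (memLp_qr hv hw).coeFn_toLp] with p h1 h2
    rw [hF, h1, h2]
  refine mem_of_inner_eq_integral (A := Subalgebra.toSubmodule algH) isClosed_algH (μ := muW)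
    (S := fun t => mulOp (fun x : ℝ => q x * x * r v w x) (measurable_qxr v w) _
      (norm_qxr_le hv.ne hw.ne) * dil t)
    (ae_muW_nonneg.mono fun t ht => algH.mul_mem (mulOp_qxr_mem_algH hv hw) (dil_mem_algH ht))
    (C := rBound v w * 1) (fun t => ?_)
    (ψ := fun t => ((Real.exp (-(t / 2)) : ℝ) : ℂ) * φ t) ?_ (fun f g => ?_) fun f g => ?_
  · have h0 := norm_mulOp_le (measurable_qxr v w) (norm_qxr_le hv.ne hw.ne)
    exact (norm_mul_le _ _).trans
      (mul_le_mul h0 (norm_dil_le t) (norm_nonneg _) ((norm_nonneg _).trans h0))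
  · refine hφ.bdd_mul (c := 1) (by fun_prop : Measurable fun t : ℝ =>
      ((Real.exp (-(t / 2)) : ℝ) : ℂ)).aestronglyMeasurable ?_
    filter_upwards [ae_muW_nonneg] with t ht
    rw [Complex.norm_real, Real.norm_of_nonneg (Real.exp_pos _).le]
    exact Real.exp_le_one_iff.2 (by linarith)
  · simp only [inner_mulOp_dil]
    have hf : Measurable f := (Lp.stronglyMeasurable f).measurable
    have hg : Measurable g := (Lp.stronglyMeasurable g).measurable
    have hm : Measurable fun p : ℝ × ℝ => q p.2 * p.2 * r v w p.2 *
        (starRingEnd ℂ (g p.2) * f (p.2 * Real.exp p.1)) := by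
      refine ((measurable_qxr v w).comp measurable_snd).mul (Measurable.mul ?_ ?_)
      · exact Complex.continuous_conj.measurable.comp (hg.comp measurable_snd)
      · exact hf.comp (by fun_prop)
    have h1 := hm.stronglyMeasurable.integral_prod_right' (ν := volume)
    have h2 : Measurable fun t : ℝ => ((Real.exp (t / 2) : ℝ) : ℂ) := by fun_prop
    exact (h2.mul h1.measurable).aestronglyMeasurable
  · have hf : Measurable f := (Lp.stronglyMeasurable f).measurable
    have hg : Measurable g := (Lp.stronglyMeasurable g).measurable
    obtain ⟨h1, h2⟩ := inner_intOp_ker F (f := f) (g := g) EventuallyEq.rfl hf EventuallyEq.rfl hg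
    have h3 : (fun p : ℝ × ℝ => starRingEnd ℂ (g p.1) * (F p * f (p.1 * Real.exp p.2)))
        =ᵐ[muV.prod muW] fun p : ℝ × ℝ =>
          starRingEnd ℂ (g p.1) * (qr v w p.1 * φ p.2 * f (p.1 * Real.exp p.2)) := by
      filter_upwards [hFae] with p hp
      rw [hp]
    rw [h2, integral_congr_ae h3, integral_prod_symm _ (h1.congr h3)]
    refine integral_congr_ae (Eventually.of_forall fun t => ?_)
    simp only
    rw [inner_mulOp_dil, integral_muV, ← integral_const_mul, ← integral_const_mul]
    refine integral_congr_ae ?_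
    filter_upwards [ae_ne_zero] with x hx
    have e1 : ((Real.exp (-(t / 2)) : ℝ) : ℂ) * ((Real.exp (t / 2) : ℝ) : ℂ) = 1 := by
      rw [← Complex.ofReal_mul, ← Real.exp_add, neg_add_cancel, Real.exp_zero, Complex.ofReal_one]
    rw [qr]
    linear_combination (starRingEnd ℂ (g x) * r v w x * φ t * f (x * Real.exp t)) * conj_q_mul_abs hx
      - (φ t * (q x * x * r v w x) * starRingEnd ℂ (g x) * f (x * Real.exp t)) * e1

lemma VtensorW_le_goodKernels : VtensorW ≤ goodKernels := by
  refine Submodule.topologicalClosure_minimal _ (Submodule.span_le.2 ?_) isClosed_goodKernels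
  rintro _ ⟨h, hh, φ, rfl⟩
  change tens h φ ∈ goodKernels
  have hV : V ≤ goodKernels.comap (tensL φ).toLinearMap := by
    refine Submodule.topologicalClosure_minimal _ (Submodule.span_le.2 ?_)
      (isClosed_goodKernels.preimage (tensL φ).continuous)
    rintro _ ⟨v, w, hv, hw, rfl⟩
    change tens _ φ ∈ goodKernels
    -- Indicators of sets of finite measure are integrable, so the previous lemma applies to them;
    -- linearity and closedness reach all of `W`.
    refine Lp.induction (p := 2) (by simp)
      (fun φ : W => tens ((memLp_qr hv.1 hw.1).toLp (qr v w)) φ ∈ goodKernels) ?_ ?_ ?_ φ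
    · intro c s hs hμs
      refine tens_qr_mem_goodKernels hv.1 hw.1 ?_
      rw [Lp.simpleFunc.coe_indicatorConst]
      exact integrable_indicatorConstLp hs hμs.ne c
    · intro f g hf hg _ h1 h2
      have := goodKernels.add_mem h1 h2
      rwa [show tens ((memLp_qr hv.1 hw.1).toLp (qr v w)) (hf.toLp f)
        + tens ((memLp_qr hv.1 hw.1).toLp (qr v w)) (hg.toLp g)
        = tens ((memLp_qr hv.1 hw.1).toLp (qr v w)) (hf.toLp f + hg.toLp g) from
          ((tensR ((memLp_qr hv.1 hw.1).toLp (qr v w))).map_add _ _).symm] at this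
    · exact isClosed_goodKernels.preimage (tensR ((memLp_qr hv.1 hw.1).toLp (qr v w))).continuous
  exact hV hh

/-! ### Uniqueness of Fourier transforms -/

/-- The positive and negative parts of `ρ` are densities of two finite measures with the same
characteristic function; the measures coincide, and so do the two parts. -/
lemma ae_eq_zero_of_fourier_real {μ : Measure ℝ} {ρ : ℝ → ℝ} (hρ : Integrable ρ μ)
    (h : ∀ s : ℝ, ∫ t, Complex.exp (Complex.I * (s * t : ℝ)) * ρ t ∂μ = 0) : ρ =ᵐ[μ] 0 := by
  have hfin : ∀ σ : ℝ → ℝ, Integrable σ μ →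
      IsFiniteMeasure (μ.withDensity fun t => ENNReal.ofReal (σ t)) := fun σ hσ =>
    isFiniteMeasure_withDensity_ofReal hσ.2
  have hchar : ∀ σ : ℝ → ℝ, Integrable σ μ → ∀ s : ℝ,
      charFun (μ.withDensity fun t => ENNReal.ofReal (σ t)) s
        = ∫ t, Complex.exp (Complex.I * (s * t : ℝ)) * ((max (σ t) 0 : ℝ) : ℂ) ∂μ := by
    intro σ hσ s
    rw [charFun_apply_real, integral_withDensity_eq_integral_toReal_smul₀
      hσ.1.aemeasurable.ennreal_ofReal (Eventually.of_forall fun _ => ENNReal.ofReal_lt_top)]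
    refine integral_congr_ae (Eventually.of_forall fun t => ?_)
    simp only [ENNReal.toReal_ofReal', Complex.real_smul]
    rw [mul_comm]
    congr 2
    push_cast
    ring
  have hint : ∀ σ : ℝ → ℝ, Integrable σ μ → ∀ s : ℝ,
      Integrable (fun t => Complex.exp (Complex.I * (s * t : ℝ)) * ((max (σ t) 0 : ℝ) : ℂ)) μ := by
    intro σ hσ s
    refine hσ.pos_part.ofReal.bdd_mul (c := 1)
      (by fun_prop : Measurable fun t : ℝ => Complex.exp (Complex.I * (s * t : ℝ))).aestronglyMeasurable
      (Eventually.of_forall fun t => ?_)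
    rw [mul_comm]; exact (Complex.norm_exp_ofReal_mul_I _).le
  have h1 := hfin ρ hρ
  have h2 := hfin (fun t => -ρ t) hρ.neg
  have heq : (μ.withDensity fun t => ENNReal.ofReal (ρ t))
      = μ.withDensity fun t => ENNReal.ofReal (-ρ t) := by
    refine Measure.ext_of_charFun ?_
    ext s
    rw [hchar ρ hρ, hchar (fun t => -ρ t) hρ.neg, ← sub_eq_zero,
      ← integral_sub (hint ρ hρ s) (hint (fun t => -ρ t) hρ.neg s), ← h s]
    refine integral_congr_ae (Eventually.of_forall fun t => ?_)
    simp only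
    rw [← mul_sub, ← Complex.ofReal_sub, max_zero_sub_max_neg_zero_eq_self]
  have hneg : Integrable (fun t => -ρ t) μ := hρ.neg
  filter_upwards [(withDensity_eq_iff hρ.1.aemeasurable.ennreal_ofReal
    hneg.1.aemeasurable.ennreal_ofReal hρ.lintegral_lt_top.ne).1 heq] with t ht
  rcases le_total 0 (ρ t) with h0 | h0
  · rw [ENNReal.ofReal_of_nonpos (neg_nonpos.2 h0), ENNReal.ofReal_eq_zero] at ht
    exact le_antisymm ht h0
  · rw [ENNReal.ofReal_of_nonpos h0, eq_comm, ENNReal.ofReal_eq_zero] at ht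
    exact le_antisymm h0 (neg_nonpos.1 ht)

/-- Conjugation at frequency `-s` shows that the conjugate of `Φ` also has zero transform, hence so
do the real and imaginary parts. -/
lemma ae_eq_zero_of_fourier {μ : Measure ℝ} {Φ : ℝ → ℂ} (hΦ : Integrable Φ μ)
    (h : ∀ s : ℝ, ∫ t, Complex.exp (Complex.I * (s * t : ℝ)) * Φ t ∂μ = 0) : Φ =ᵐ[μ] 0 := by
  have hconj : ∀ s : ℝ, ∫ t, Complex.exp (Complex.I * (s * t : ℝ)) * starRingEnd ℂ (Φ t) ∂μ = 0 := by
    intro s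
    have h1 := congrArg (starRingEnd ℂ) (h (-s))
    rw [← integral_conj, map_zero] at h1
    rw [← h1]
    refine integral_congr_ae (Eventually.of_forall fun t => ?_)
    simp only [map_mul, ← Complex.exp_conj, Complex.conj_I, Complex.conj_ofReal]
    congr 2
    push_cast; ring
  have hb : ∀ (s : ℝ) {Ψ : ℝ → ℂ}, Integrable Ψ μ →
      Integrable (fun t => Complex.exp (Complex.I * (s * t : ℝ)) * Ψ t) μ := fun s Ψ hΨ =>
    hΨ.bdd_mul (c := 1)
      (by fun_prop : Measurable fun t : ℝ => Complex.exp (Complex.I * (s * t : ℝ))).aestronglyMeasurable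
      (Eventually.of_forall fun t => by rw [mul_comm]; exact (Complex.norm_exp_ofReal_mul_I _).le)
  have hΦc : Integrable (fun t => starRingEnd ℂ (Φ t)) μ := by
    refine hΦ.congr' ?_ (Eventually.of_forall fun t => by simp)
    exact Complex.continuous_conj.comp_aestronglyMeasurable hΦ.1
  have hre := ae_eq_zero_of_fourier_real hΦ.re fun s => by
    have h1 : (∫ t, Complex.exp (Complex.I * (s * t : ℝ)) * Φ t ∂μ) / 2
        + (∫ t, Complex.exp (Complex.I * (s * t : ℝ)) * starRingEnd ℂ (Φ t) ∂μ) / 2 = 0 := by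
      rw [h, hconj]; simp
    rw [← h1, ← integral_div, ← integral_div, ← integral_add ((hb s hΦ).div_const 2)
      ((hb s hΦc).div_const 2)]
    refine integral_congr_ae (Eventually.of_forall fun t => ?_)
    simp only
    have : ((RCLike.re (Φ t) : ℝ) : ℂ) = (Φ t + starRingEnd ℂ (Φ t)) / 2 := by
      rw [Complex.add_conj]; simp
    rw [this]; ring
  have him := ae_eq_zero_of_fourier_real hΦ.im fun s => by
    have h1 : (∫ t, Complex.exp (Complex.I * (s * t : ℝ)) * Φ t ∂μ) / (2 * Complex.I)
        - (∫ t, Complex.exp (Complex.I * (s * t : ℝ)) * starRingEnd ℂ (Φ t) ∂μ) / (2 * Complex.I) = 0 := by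
      rw [h, hconj]; simp
    rw [← h1, ← integral_div, ← integral_div, ← integral_sub ((hb s hΦ).div_const _)
      ((hb s hΦc).div_const _)]
    refine integral_congr_ae (Eventually.of_forall fun t => ?_)
    simp only
    have : ((RCLike.im (Φ t) : ℝ) : ℂ) = (Φ t - starRingEnd ℂ (Φ t)) / (2 * Complex.I) := by
      rw [Complex.sub_conj]
      have := Complex.I_ne_zero
      simp only [RCLike.im_to_complex]
      push_cast
      field_simp
    rw [this]; ring
  filter_upwards [hre, him] with t h1 h2
  exact Complex.ext h1 h2

/-! ### Kernels of the operators in `Alg` -/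

/-- The kernel of an operator leaving `L²(I)` invariant vanishes on `Iᶜ × I`. -/
lemma ker_eq_zero_of_invariant {k : L2R2} {a b : ℝ≥0∞}
    (h : ∀ f ∈ L2interval a b, intOp k f ∈ L2interval a b) :
    ∀ᵐ x : ℝ, x ∉ interval a b → ∀ᵐ y : ℝ, y ∈ interval a b → k (x, y) = 0 := by
  set m : ℝ → ℂ := (interval a b).indicator 1 with hm
  have hmm : Measurable m := measurable_one.indicator (measurableSet_interval a b)
  have hC : ∀ x, ‖m x‖ ≤ 1 := fun x => by
    refine (norm_indicator_le_norm_self _ _).trans ?_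
    simp
  -- A countable dense set of test functions leaves a single exceptional null set of `x`.
  set d : ℕ → L2R := TopologicalSpace.denseSeq L2R
  have hd : DenseRange d := TopologicalSpace.denseRange_denseSeq L2R
  have h1 : ∀ n, ∀ᵐ x : ℝ, x ∉ interval a b → ∫ y : ℝ, k (x, y) * (m y * d n y) = 0 := by
    intro n
    have hmem : mulOp m hmm 1 hC (d n) ∈ L2interval a b := by
      change ∀ᵐ x : ℝ, x ∉ interval a b → mulOp m hmm 1 hC (d n) x = 0
      filter_upwards [mulOp_apply hmm hC (d n)] with x hx hxI
      rw [hx, hm, Set.indicator_of_notMem hxI, zero_mul]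
    have h2 : ∀ᵐ x : ℝ, x ∉ interval a b → intOp k (mulOp m hmm 1 hC (d n)) x = 0 := h _ hmem
    filter_upwards [h2, intOp_apply k (mulOp m hmm 1 hC (d n))] with x h3 h4 hx
    rw [← h3 hx, h4]
    refine integral_congr_ae ?_
    filter_upwards [mulOp_apply hmm hC (d n)] with y hy
    rw [hy]
  filter_upwards [ae_all_iff.2 h1, memLp_slice k] with x hx hk hxI
  have hκ : MemLp (fun y : ℝ => starRingEnd ℂ (m y * k (x, y))) 2 volume := by
    refine memLp_conj (hk.of_le_mul (c := 1) (hmm.aestronglyMeasurable.mul hk.1)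
      (Eventually.of_forall fun y => ?_))
    rw [norm_mul]
    exact mul_le_mul_of_nonneg_right (hC y) (norm_nonneg _)
  have hzero : hκ.toLp _ = 0 := by
    refine hd.eq_zero_of_inner_left ℂ fun n => ?_
    rw [inner_eq_integral, ← hx n hxI]
    refine integral_congr_ae ?_
    filter_upwards [hκ.coeFn_toLp] with y hy
    rw [hy, Complex.conj_conj]; ring
  have h5 := hκ.coeFn_toLp
  rw [hzero] at h5
  filter_upwards [h5, Lp.coeFn_zero ℂ 2 (volume : Measure ℝ)] with y h6 h7 hyI
  rw [h7, hm, Set.indicator_of_mem hyI] at h6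
  simpa using h6.symm

lemma mem_interval_zero_left {b x : ℝ} (hb : 0 ≤ b) :
    x ∈ interval 0 (ENNReal.ofReal b) ↔ 0 ≤ x ∧ x ≤ b := by
  rw [interval, Set.mem_ofPred_eq, EReal.coe_ennreal_ofReal, max_eq_left hb, EReal.coe_le_coe_iff]
  simp

lemma mem_interval_zero_right {a x : ℝ} (ha : 0 ≤ a) :
    x ∈ interval (ENNReal.ofReal a) 0 ↔ -a ≤ x ∧ x ≤ 0 := by
  rw [interval, Set.mem_ofPred_eq, EReal.coe_ennreal_ofReal, max_eq_left ha, ← EReal.coe_neg,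
    EReal.coe_le_coe_iff]
  simp

/-- The cone consists of the pairs of equal sign with `|x| ≤ |y|`; outside it, some interval ending
at `0` contains `y` but not `x`. A rational other endpoint keeps the family countable, as the
almost-everywhere argument requires. -/
lemma exists_interval_of_notMem_cone {x y : ℝ} (hx : x ≠ 0) (hy : y ≠ 0) (h : (x, y) ∉ cone) :
    ∃ c : ℚ, (y ∈ interval 0 (ENNReal.ofReal c) ∧ x ∉ interval 0 (ENNReal.ofReal c)) ∨
      (y ∈ interval (ENNReal.ofReal c) 0 ∧ x ∉ interval (ENNReal.ofReal c) 0) := by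
  rcases lt_or_gt_of_ne hy with hy' | hy' <;> rcases lt_or_gt_of_ne hx with hx' | hx'
  · have hxy : x < y := by
      by_contra hle
      refine h ⟨mul_pos_of_neg_of_neg hx' hy', Real.log_nonneg ?_⟩
      change 1 ≤ y / x
      rw [one_le_div_of_neg hx']
      exact not_lt.1 hle
    obtain ⟨c, h1, h2⟩ := exists_rat_btwn (neg_lt_neg hxy)
    have hc : (0 : ℝ) ≤ c := by linarith
    refine ⟨c, Or.inr ⟨(mem_interval_zero_right hc).2 ⟨by linarith, hy'.le⟩, fun h' => ?_⟩⟩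
    have := ((mem_interval_zero_right hc).1 h').1
    linarith
  · obtain ⟨c, h1, h2⟩ := exists_rat_btwn (show -y < -y + 1 by linarith)
    have hc : (0 : ℝ) ≤ c := by linarith
    refine ⟨c, Or.inr ⟨(mem_interval_zero_right hc).2 ⟨by linarith, hy'.le⟩, fun h' => ?_⟩⟩
    have := ((mem_interval_zero_right hc).1 h').2
    linarith
  · obtain ⟨c, h1, h2⟩ := exists_rat_btwn (show y < y + 1 by linarith)
    have hc : (0 : ℝ) ≤ c := by linarith
    refine ⟨c, Or.inl ⟨(mem_interval_zero_left hc).2 ⟨hy'.le, by linarith⟩, fun h' => ?_⟩⟩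
    have := ((mem_interval_zero_left hc).1 h').1
    linarith
  · have hxy : y < x := by
      by_contra hle
      refine h ⟨mul_pos hx' hy', Real.log_nonneg ?_⟩
      change 1 ≤ y / x
      rw [one_le_div hx']
      exact not_lt.1 hle
    obtain ⟨c, h1, h2⟩ := exists_rat_btwn hxy
    have hc : (0 : ℝ) ≤ c := by linarith
    refine ⟨c, Or.inl ⟨(mem_interval_zero_left hc).2 ⟨hy'.le, by linarith⟩, fun h' => ?_⟩⟩
    have := ((mem_interval_zero_left hc).1 h').2
    linarith

lemma ae_eq_zero_off_cone {k : L2R2}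
    (h : ∀ K ∈ latM, ∀ f ∈ K, intOp k f ∈ K) : ∀ᵐ p : ℝ × ℝ, p ∉ cone → k p = 0 := by
  have hk : Measurable k := (Lp.stronglyMeasurable k).measurable
  have hms : MeasurableSet {p : ℝ × ℝ | p ∉ cone → k p = 0} :=
    measurableSet_cone.compl.imp (hk (measurableSet_singleton 0))
  refine (Measure.ae_prod_iff_ae_ae hms).2 ?_
  have h1 : ∀ᵐ x : ℝ, ∀ c : ℚ, x ∉ interval 0 (ENNReal.ofReal c) →
      ∀ᵐ y : ℝ, y ∈ interval 0 (ENNReal.ofReal c) → k (x, y) = 0 :=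
    ae_all_iff.2 fun c => ker_eq_zero_of_invariant (h _ ⟨_, _, rfl⟩)
  have h2 : ∀ᵐ x : ℝ, ∀ c : ℚ, x ∉ interval (ENNReal.ofReal c) 0 →
      ∀ᵐ y : ℝ, y ∈ interval (ENNReal.ofReal c) 0 → k (x, y) = 0 :=
    ae_all_iff.2 fun c => ker_eq_zero_of_invariant (h _ ⟨_, _, rfl⟩)
  filter_upwards [h1, h2, ae_ne_zero] with x h1 h2 hx
  have h3 : ∀ᵐ y : ℝ, ∀ c : ℚ, x ∉ interval 0 (ENNReal.ofReal c) →
      y ∈ interval 0 (ENNReal.ofReal c) → k (x, y) = 0 :=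
    ae_all_iff.2 fun c => by
      by_cases hc : x ∈ interval 0 (ENNReal.ofReal c)
      · exact Eventually.of_forall fun y h' => absurd hc h'
      · exact (h1 c hc).mono fun y hy _ => hy
  have h4 : ∀ᵐ y : ℝ, ∀ c : ℚ, x ∉ interval (ENNReal.ofReal c) 0 →
      y ∈ interval (ENNReal.ofReal c) 0 → k (x, y) = 0 :=
    ae_all_iff.2 fun c => by
      by_cases hc : x ∈ interval (ENNReal.ofReal c) 0
      · exact Eventually.of_forall fun y h' => absurd hc h'
      · exact (h2 c hc).mono fun y hy _ => hy
  filter_upwards [h3, h4, ae_ne_zero] with y h3 h4 hy hp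
  obtain ⟨c, ⟨h5, h6⟩ | ⟨h5, h6⟩⟩ := exists_interval_of_notMem_cone hx hy hp
  · exact h3 c h6 h5
  · exact h4 c h6 h5

/-- Square-integrable kernels supported in the cone are of the form `k_F`. -/
lemma exists_ker_eq {k : L2R2} (h : ∀ᵐ p : ℝ × ℝ, p ∉ cone → k p = 0) :
    ∃ F : Lp ℂ 2 (muV.prod muW), ker F = k := by
  have hk : Measurable k := (Lp.stronglyMeasurable k).measurable
  set F : ℝ × ℝ → ℂ := fun p => k (p.1, p.1 * Real.exp p.2) with hF
  have hFm : Measurable F := hk.comp (by fun_prop)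
  have hFk : ∀ p ∈ cone, F (p.1, Real.log (p.2 / p.1)) = k p := fun p hp => by
    rw [hF]; simp only; rw [mul_exp_log_div hp]
  have hF2 : MemLp F 2 (muV.prod muW) := by
    rw [← measurePreserving_cone.map_eq, memLp_map_measure_iff hFm.aestronglyMeasurable
      measurePreserving_cone.measurable.aemeasurable]
    refine ((Lp.memLp k).restrict cone).ae_eq ?_
    filter_upwards [ae_restrict_mem measurableSet_cone] with p hp
    exact (hFk p hp).symm
  refine ⟨hF2.toLp F, Lp.ext ?_⟩
  have h1 := (ae_restrict_iff' measurableSet_cone).1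
    (measurePreserving_cone.quasiMeasurePreserving.ae hF2.coeFn_toLp)
  filter_upwards [ker_apply (hF2.toLp F), h, h1] with p h2 h3 h4
  rw [h2]
  by_cases hp : p ∈ cone
  · rw [Set.indicator_of_mem hp, Function.comp, h4 hp, hFk p hp]
  · rw [Set.indicator_of_notMem hp, h3 hp]

/-! ### Slices of the kernel and invariance of `𝓛_S` -/

lemma inner_eq_zero_of_mem_Alg_latS {T : L2R →L[ℂ] L2R} (hT : T ∈ Alg latS) (s : ℝ) {v w : ℂ}
    (hv : v.im < 0) (hw : 0 < w.im) :
    inner ℂ (absPow s (cauchy w hw.ne')) (T (absPow s (cauchy v hv.ne))) = 0 := by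
  have h1 := hT _ (Or.inl ⟨s, rfl⟩) _ (Submodule.mem_map_of_mem (cauchy_mem_H2 hv))
  rw [mem_map_absPow, mem_H2_iff, cauchyAnn_iff_inner] at h1
  have h2 := h1 w hw
  rw [← h2, inner_eq_integral, inner_eq_integral]
  refine integral_congr_ae ?_
  filter_upwards [phaseMul_apply (fun x => s * Real.log |x|) (by fun_prop) (cauchy w hw.ne'),
    phaseMul_apply (fun x => -s * Real.log |x|) (by fun_prop) (T (absPow s (cauchy v hv.ne)))]
    with x h3 h4
  have h3' : absPow s (cauchy w hw.ne') x = _ := h3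
  have h4' : absPow (-s) (T (absPow s (cauchy v hv.ne))) x = _ := h4
  change _ = _ * absPow (-s) (T (absPow s (cauchy v hv.ne))) x
  rw [h3', h4', map_mul, ← Complex.exp_conj, map_mul, Complex.conj_I, Complex.conj_ofReal]
  have : -Complex.I * ((s * Real.log |x| : ℝ) : ℂ) = Complex.I * ((-s * Real.log |x| : ℝ) : ℂ) := by
    push_cast; ring
  rw [this]
  ring

lemma ae_muV_ne_zero : ∀ᵐ x ∂muV, x ≠ 0 := (withDensity_absolutelyContinuous _ _).ae_le ae_ne_zero

lemma absPow_cauchy_apply (s : ℝ) {v : ℂ} (hv : v.im ≠ 0) :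
    absPow s (cauchy v hv) =ᵐ[volume]
      fun x : ℝ => Complex.exp (Complex.I * (s * Real.log |x| : ℝ)) * ((x : ℂ) - v)⁻¹ := by
  filter_upwards [phaseMul_apply (fun x => s * Real.log |x|) (by fun_prop) (cauchy v hv),
    cauchy_apply hv] with x h1 h2
  rw [absPow, h1, h2]

/-- The powers of `|x|` in the two test functions combine to `e^{ist}`, so the invariance relations
for all `s` form the Fourier transform in `t` of the slice integral, and uniqueness makes that
integral vanish almost everywhere. -/
lemma ae_integral_slice_eq_zero {F : Lp ℂ 2 (muV.prod muW)} (hT : intOp (ker F) ∈ Alg latS)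
    {v w : ℂ} (hv : v.im < 0) (hw : w.im < 0) :
    ∀ᵐ t ∂muW, ∫ x, F (x, t) * (((x * Real.exp t : ℝ) : ℂ) - v)⁻¹ * ((x : ℂ) - w)⁻¹ ∂muV = 0 := by
  have hw' : 0 < (starRingEnd ℂ w).im := by simpa using hw
  have hx0 : ∀ᵐ p ∂(muV.prod muW), p.1 ≠ 0 := Measure.quasiMeasurePreserving_fst.ae ae_muV_ne_zero
  have key : ∀ s : ℝ, Integrable (fun p : ℝ × ℝ => Complex.exp (Complex.I * (s * p.2 : ℝ)) *
        (F p * (((p.1 * Real.exp p.2 : ℝ) : ℂ) - v)⁻¹ * ((p.1 : ℂ) - w)⁻¹)) (muV.prod muW) ∧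
      ∫ p : ℝ × ℝ, Complex.exp (Complex.I * (s * p.2 : ℝ)) *
        (F p * (((p.1 * Real.exp p.2 : ℝ) : ℂ) - v)⁻¹ * ((p.1 : ℂ) - w)⁻¹) ∂(muV.prod muW) = 0 := by
    intro s
    obtain ⟨h1, h2⟩ := inner_intOp_ker F (absPow_cauchy_apply s hv.ne) (by fun_prop)
      (absPow_cauchy_apply s hw'.ne') (by fun_prop)
    rw [inner_eq_zero_of_mem_Alg_latS hT s hv hw'] at h2
    have h3 : (fun p : ℝ × ℝ => starRingEnd ℂ
          (Complex.exp (Complex.I * (s * Real.log |p.1| : ℝ)) * ((p.1 : ℂ) - starRingEnd ℂ w)⁻¹) *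
        (F p * (Complex.exp (Complex.I * (s * Real.log |p.1 * Real.exp p.2| : ℝ)) *
          (((p.1 * Real.exp p.2 : ℝ) : ℂ) - v)⁻¹))) =ᵐ[muV.prod muW]
        fun p : ℝ × ℝ => Complex.exp (Complex.I * (s * p.2 : ℝ)) *
          (F p * (((p.1 * Real.exp p.2 : ℝ) : ℂ) - v)⁻¹ * ((p.1 : ℂ) - w)⁻¹) := by
      filter_upwards [hx0] with p hp
      rw [map_mul, ← Complex.exp_conj, map_inv₀, map_sub, Complex.conj_conj, Complex.conj_ofReal,
        map_mul, Complex.conj_I, Complex.conj_ofReal, abs_mul, abs_of_pos (Real.exp_pos _),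
        Real.log_mul (abs_ne_zero.2 hp) (Real.exp_ne_zero _), Real.log_exp]
      have : Complex.exp (Complex.I * ((s * (Real.log |p.1| + p.2) : ℝ) : ℂ))
          = Complex.exp (Complex.I * (s * p.2 : ℝ)) *
            Complex.exp (Complex.I * (s * Real.log |p.1| : ℝ)) := by
        rw [← Complex.exp_add]; congr 1; push_cast; ring
      have h4 : Complex.exp (-Complex.I * ((s * Real.log |p.1| : ℝ) : ℂ)) *
          Complex.exp (Complex.I * (s * Real.log |p.1| : ℝ)) = 1 := by
        rw [← Complex.exp_add, neg_mul, neg_add_cancel, Complex.exp_zero]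
      rw [this]
      linear_combination (((p.1 : ℂ) - w)⁻¹ * F p * Complex.exp (Complex.I * (s * p.2 : ℝ)) *
        (((p.1 * Real.exp p.2 : ℝ) : ℂ) - v)⁻¹) * h4
    exact ⟨h1.congr h3, by rw [← integral_congr_ae h3, ← h2]⟩
  have hint := (key 0).1
  simp only [zero_mul, Complex.ofReal_zero, mul_zero, Complex.exp_zero, one_mul] at hint
  refine ae_eq_zero_of_fourier hint.integral_prod_right fun s => ?_
  rw [← (key s).2, integral_prod_symm _ (key s).1]
  refine integral_congr_ae (Eventually.of_forall fun t => ?_)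
  simp only
  rw [← integral_const_mul]

lemma ae_memLp_slice (F : Lp ℂ 2 (muV.prod muW)) : ∀ᵐ t ∂muW, MemLp (fun x => F (x, t)) 2 muV := by
  have hF : Measurable F := (Lp.stronglyMeasurable F).measurable
  have h := (memLp_two_iff_integrable_sq_norm (Lp.aestronglyMeasurable F)).1 (Lp.memLp F)
  filter_upwards [h.prod_left_ae] with t ht
  have hm : AEStronglyMeasurable (fun x => F (x, t)) muV :=
    (hF.comp (by fun_prop : Measurable fun x : ℝ => (x, t))).aestronglyMeasurable
  rw [memLp_two_iff_integrable_sq_norm hm]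
  exact ht

/-- Testing `E` against `q̄ r` times indicators in `t` shows that the slice integral has zero
integral over every set of finite measure. -/
lemma ae_integral_conj_slice_eq_zero {E : Lp ℂ 2 (muV.prod muW)} (hE : E ∈ VtensorWᗮ) {v w : ℂ}
    (hv : v ∈ lowerHalfQ) (hw : w ∈ lowerHalfQ) :
    ∀ᵐ t ∂muW, ∫ x, starRingEnd ℂ (E (x, t)) * qr v w x ∂muV = 0 := by
  set h : Lp ℂ 2 muV := (memLp_qr hv.1 hw.1).toLp (qr v w) with hh
  have key : ∀ s : Set ℝ, MeasurableSet s → muW s < ⊤ →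
      Integrable (fun p : ℝ × ℝ => starRingEnd ℂ (E p) * (qr v w p.1 * s.indicator 1 p.2))
        (muV.prod muW) ∧
      ∫ p : ℝ × ℝ, starRingEnd ℂ (E p) * (qr v w p.1 * s.indicator 1 p.2) ∂(muV.prod muW) = 0 := by
    intro s hs hμs
    have hmem : tens h (indicatorConstLp 2 hs hμs.ne 1) ∈ VtensorW :=
      Submodule.le_topologicalClosure _ (Submodule.subset_span
        ⟨h, Submodule.le_topologicalClosure _ (Submodule.subset_span ⟨v, w, hv, hw, rfl⟩), _, rfl⟩)
    have h0 := Submodule.inner_left_of_mem_orthogonal hmem hE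
    have hae : (fun p => inner ℂ (E p) (tens h (indicatorConstLp 2 hs hμs.ne 1) p))
        =ᵐ[muV.prod muW]
        fun p : ℝ × ℝ => starRingEnd ℂ (E p) * (qr v w p.1 * s.indicator 1 p.2) := by
      filter_upwards [tens_apply h (indicatorConstLp 2 hs hμs.ne 1),
        Measure.quasiMeasurePreserving_fst.ae (memLp_qr hv.1 hw.1).coeFn_toLp,
        Measure.quasiMeasurePreserving_snd.ae
          (indicatorConstLp_coeFn (p := 2) (hs := hs) (hμs := hμs.ne) (c := (1 : ℂ)))]
        with p h1 h2 h3
      rw [h1, hh, h2, h3]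
      simp only [RCLike.inner_apply]
      rw [mul_comm]
      rfl
    rw [L2.inner_def, integral_congr_ae hae] at h0
    exact ⟨(L2.integrable_inner E _).congr hae, h0⟩
  have hind : ∀ (s : Set ℝ) (t : ℝ),
      ∫ x, starRingEnd ℂ (E (x, t)) * (qr v w x * s.indicator 1 t) ∂muV
        = s.indicator (fun t => ∫ x, starRingEnd ℂ (E (x, t)) * qr v w x ∂muV) t := by
    intro s t
    by_cases ht : t ∈ s
    · simp [ht]
    · simp [ht]
  refine ae_eq_zero_of_forall_setIntegral_eq_of_sigmaFinite (fun s hs hμs => ?_) fun s hs hμs => ?_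
  · have h1 := (key s hs hμs).1.integral_prod_right
    simp only [hind] at h1
    exact (integrable_indicator_iff hs).1 h1
  · obtain ⟨h1, h2⟩ := key s hs hμs
    rw [integral_prod_symm _ h1] at h2
    simp only [hind] at h2
    rwa [integral_indicator hs] at h2

lemma exp_smul_lowerHalfQ_dense (t : ℝ) :
    {v : ℂ | v.im < 0} ⊆
      closure (((fun v : ℂ => (Real.exp t : ℂ) * v) '' lowerHalfQ) ∩ {v : ℂ | v.im < 0}) := by
  intro z hz
  have hz' : z.im < 0 := hz
  have him : ∀ (s : ℝ) (z : ℂ), z.im < 0 → ((Real.exp s : ℂ) * z).im < 0 := fun s z hz => by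
    rw [Complex.im_ofReal_mul]
    exact mul_neg_of_pos_of_neg (Real.exp_pos s) hz
  have h1 := lowerHalfQ_dense (him (-t) z hz')
  have h2 := map_mem_closure (f := fun v : ℂ => (Real.exp t : ℂ) * v) (by fun_prop) h1
    (t := ((fun v : ℂ => (Real.exp t : ℂ) * v) '' lowerHalfQ) ∩ {v : ℂ | v.im < 0})
    fun v hv => ⟨⟨v, hv.1, rfl⟩, him t v hv.2⟩
  have h3 : (Real.exp t : ℂ) * ((Real.exp (-t) : ℂ) * z) = z := by
    rw [← mul_assoc, ← Complex.ofReal_mul, ← Real.exp_add, add_neg_cancel, Real.exp_zero,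
      Complex.ofReal_one, one_mul]
  simp only [h3] at h2
  exact h2

lemma mem_VtensorW_of_mem_Alg_latS {F : Lp ℂ 2 (muV.prod muW)} (hT : intOp (ker F) ∈ Alg latS) :
    F ∈ VtensorW := by
  have hcl : IsClosed (VtensorW : Set (Lp ℂ 2 (muV.prod muW))) :=
    Submodule.isClosed_topologicalClosure _
  have : CompleteSpace VtensorW := hcl.completeSpace_coe
  rw [← Submodule.orthogonal_orthogonal VtensorW]
  refine (Submodule.mem_orthogonal _ _).2 fun E hE => ?_
  have hFm : Measurable F := (Lp.stronglyMeasurable F).measurable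
  have hEm : Measurable E := (Lp.stronglyMeasurable E).measurable
  -- Countability of the rational poles gives one null set of `t` for all of them.
  have hF0 : ∀ᵐ t ∂muW, ∀ v ∈ lowerHalfQ, ∀ w ∈ lowerHalfQ,
      ∫ x, F (x, t) * (((x * Real.exp t : ℝ) : ℂ) - v)⁻¹ * ((x : ℂ) - w)⁻¹ ∂muV = 0 :=
    (ae_ball_iff countable_lowerHalfQ).2 fun v hv => (ae_ball_iff countable_lowerHalfQ).2 fun w hw =>
      ae_integral_slice_eq_zero hT hv.1 hw.1
  have hE0 : ∀ᵐ t ∂muW, ∀ v ∈ lowerHalfQ, ∀ w ∈ lowerHalfQ,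
      ∫ x, starRingEnd ℂ (E (x, t)) * qr v w x ∂muV = 0 :=
    (ae_ball_iff countable_lowerHalfQ).2 fun v hv => (ae_ball_iff countable_lowerHalfQ).2 fun w hw =>
      ae_integral_conj_slice_eq_zero hE hv hw
  have hae : (fun p => inner ℂ (E p) (F p)) = fun p => starRingEnd ℂ (E p) * F p := by
    ext p
    simp only [RCLike.inner_apply]
    rw [mul_comm]
  have hint := L2.integrable_inner (𝕜 := ℂ) E F
  rw [hae] at hint
  rw [L2.inner_def, hae, integral_prod_symm _ hint]
  refine integral_eq_zero_of_ae ?_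
  filter_upwards [hF0, hE0, ae_memLp_slice F, ae_memLp_slice E] with t h1 h2 h3 h4
  -- Since `1 / (x e^t - v) = e^{-t} / (x - e^{-t} v)`, the first poles available for `F(·, t)` are
  -- the rational ones scaled by `e^{-t}`, still dense in the half-plane.
  refine integral_conj_mul_muV_eq_zero (hFm.comp (by fun_prop : Measurable fun x : ℝ => (x, t)))
    (hEm.comp (by fun_prop : Measurable fun x : ℝ => (x, t))) h3 h4
    (exp_smul_lowerHalfQ_dense (-t)) lowerHalfQ_dense ?_ h2
  rintro _ ⟨v, hv, rfl⟩ _ w hw _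
  have h5 := congrArg ((Real.exp t : ℂ) * ·) (h1 v hv w hw)
  simp only [mul_zero] at h5
  rw [← integral_const_mul] at h5
  rw [← h5]
  refine integral_congr_ae (Eventually.of_forall fun x => ?_)
  have he : (Real.exp t : ℂ) * (Real.exp (-t) : ℂ) = 1 := by
    rw [← Complex.ofReal_mul, ← Real.exp_add, add_neg_cancel, Real.exp_zero, Complex.ofReal_one]
  have h6 : ((x : ℂ) - Real.exp (-t) * v)⁻¹
      = (Real.exp t : ℂ) * (((x * Real.exp t : ℝ) : ℂ) - v)⁻¹ := by
    have hne : (Real.exp t : ℂ) ≠ 0 := Complex.ofReal_ne_zero.2 (Real.exp_ne_zero t)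
    have : ((x * Real.exp t : ℝ) : ℂ) - v = (Real.exp t : ℂ) * ((x : ℂ) - Real.exp (-t) * v) := by
      push_cast at he ⊢
      linear_combination v * he
    rw [this, mul_inv, mul_inv_cancel_left₀ hne]
  simp only [r_eq, h6]
  ring

end HypAlg

/-! ### The cycle of inclusions -/

theorem mainTheorem3 :
    (HypAlg.algH : Set (HypAlg.L2R →L[ℂ] HypAlg.L2R)) ∩ HypAlg.C2
        = (HypAlg.Alg (HypAlg.latM ∪ HypAlg.latS) : Set (HypAlg.L2R →L[ℂ] HypAlg.L2R)) ∩ HypAlg.C2 ∧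
      (HypAlg.Alg (HypAlg.latM ∪ HypAlg.latS) : Set (HypAlg.L2R →L[ℂ] HypAlg.L2R)) ∩ HypAlg.C2
        = {T | ∃ F ∈ HypAlg.VtensorW, T = HypAlg.intOp (HypAlg.ker F)} := by
  have h1 : (HypAlg.algH : Set (HypAlg.L2R →L[ℂ] HypAlg.L2R)) ∩ HypAlg.C2
      ⊆ (HypAlg.Alg (HypAlg.latM ∪ HypAlg.latS) : Set _) ∩ HypAlg.C2 :=
    Set.inter_subset_inter_left _ HypAlg.algH_le_Alg
  have h2 : (HypAlg.Alg (HypAlg.latM ∪ HypAlg.latS) : Set (HypAlg.L2R →L[ℂ] HypAlg.L2R)) ∩ HypAlg.C2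
      ⊆ {T | ∃ F ∈ HypAlg.VtensorW, T = HypAlg.intOp (HypAlg.ker F)} := by
    rintro T ⟨hT, hT2⟩
    obtain ⟨k, rfl⟩ := HypAlg.exists_intOp_of_mem_C2 hT2
    obtain ⟨F, rfl⟩ := HypAlg.exists_ker_eq
      (HypAlg.ae_eq_zero_off_cone fun K hK => hT K (Or.inl hK))
    exact ⟨F, HypAlg.mem_VtensorW_of_mem_Alg_latS fun K hK => hT K (Or.inr hK), rfl⟩
  have h3 : {T | ∃ F ∈ HypAlg.VtensorW, T = HypAlg.intOp (HypAlg.ker F)}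
      ⊆ (HypAlg.algH : Set (HypAlg.L2R →L[ℂ] HypAlg.L2R)) ∩ HypAlg.C2 := by
    rintro _ ⟨F, hF, rfl⟩
    exact ⟨HypAlg.VtensorW_le_goodKernels hF, HypAlg.intOp_mem_C2 _⟩
  exact ⟨h1.antisymm (h2.trans h3), h2.antisymm (h3.trans h1)⟩
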